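/- **Conventions.** A (finite) 2-complex $C$ is a finite graph, possibly with loops and parallel edges, together with a finite family of closed trails in it, called faces (a closed trail is a closed walk, up to cyclic shift and reversal, using no edge twice); every finite 2-dimensional simplicial complex is one, its faces being its triangles. The link graph $L(v)$ at a vertex $v$ has as vertices the edges incident with $v$ (a loop at $v$ gives two vertices), and for every traversal of $v$ by a face it has an edge joining the two edges that the face uses there. A rotation system of a graph is a choice of a cyclic orientation (rotator) of the incident edges at every vertex; it is planar if the closed oriented surface obtained by gluing discs along the facial walks is a disjoint union of spheres. A rotation system of $C$ is a choice of a cyclic orientation of the incident faces at every edge; it induces a rotation system on every $L(v)$, where at the two ends of an edge one takes the chosen orientation and its reverse, respectively. It is planar if all induced rotation systems of link graphs are planar. A 2-complex $C'$ is a *stretching* of $C$ if it is obtained from $C$, up to isomorphism, by finitely many operations of the following five types, where the intermediate complexes may be arbitrary 2-complexes. An elementary subdivision is the subdivision of an edge by a new vertex, or the subdivision of a face into two by a new edge joining two different corners of that face. 1. *Stretching a branch.* Let $L(v)$ be connected with a cut-vertex $e$, let $X$ be a component of $L(v)-e$, and let $B$ be the branch consisting of $X$, $e$ and the edges between them. Add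 a new vertex $v[B]$ and a new edge $e[B]$ from $v$ to $v[B]$. The ends at $v$ of edges that are vertices of $X$ are moved to $v[B]$. Every face that, in $L(v)$, gives an edge between $e$ and $X$ now traverses $e[B]$ between $e$ and the other edge. Then finitely many elementary subdivisions may be applied (in particular, each resulting face of size four may be cut in two by an edge from $v$ to its opposite corner, which gives a simplicial complex again if $C$ was one). 2. *Stretching a 2-separator.* Let $L(v)$ be 2-connected, and let $a\ne b$ be vertices of $L(v)$, coming from non-loops $vw_a$ and $vw_b$ of $C$, such that $L(v)-a-b$ has at least two components. For every component $X$ of $L(v)-a-b$ add a new vertex, again called $X$, with edges to $v$, $w_a$ and $w_b$, and two new triangular faces, one with the edges $a$, $vX$, $w_aX$ and one with the edges $b$, $vX$, $w_bX$. The ends at $v$ of edges that are vertices of $X$ are moved to the new vertex $X$. Every face that, in $L(v)$, joins $a$ (or $b$) to $X$ uses the edge $w_aX$ (or $w_bX$) in place of $a$ (or $b$); faces that join $a$ and $b$ in $L(v)$ are not changed. 3. *Stretching an edge.* Let $f_1\neq f_2$ be faces incident with an edge $e$, and suppose that $e$ has an end at some vertex $v$ such that in every planar rotation system of $L(v)$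 the edges of $L(v)$ given there by $f_1$ and $f_2$ are adjacent in the rotator at that end of $e$. Replace $e$ by two parallel edges $e_1,e_2$, add a face of size two with the edges $e_1$ and $e_2$, let $f_1$ and $f_2$ use $e_1$ in place of $e$, and let all other faces at $e$ use $e_2$. Then finitely many elementary subdivisions may be applied. 4. *Contracting a reversible non-loop edge.* Replace $C$ by $C/e$, where the endvertices of the non-loop $e$ are identified and $e$ is deleted from the graph and from all faces; here $e$ is reversible if $C$ has a planar rotation system if and only if $C/e$ has one. 5. *Splitting a vertex* $v$. Replace $v$ by one vertex for every component of $L(v)$, which is incident with the ends at $v$ of edges that belong to this component. **Lemma.** If $C'$ is a stretching of $C$, then $C$ has a planar rotation system if and only if $C'$ has a planar rotation system. -/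

import Mathlib

universe u

open Relation

/-- The equivalence relation generated by two maps `α` and `β`. -/
def FaceRel {A : Type*} (α β : A → A) : A → A → Prop :=
  EqvGen fun x y => y = α x ∨ y = β x

theorem FaceRel.map {A B : Type*} {α β : A → A} {α' β' : B → B} (p : A → B)
    (h₁ : ∀ x, FaceRel α' β' (p x) (p (α x))) (h₂ : ∀ x, FaceRel α' β' (p x) (p (β x)))
    {x y : A} (h : FaceRel α β x y) : FaceRel α' β' (p x) (p y) := by
  induction h with
  | rel x y h => rcases h with rfl | rfl; exacts [h₁ _, h₂ _]
  | refl x => exact EqvGen.refl _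
  | symm x y _ ih => exact EqvGen.symm _ _ ih
  | trans x y z _ _ ih ih' => exact EqvGen.trans _ _ _ ih ih'

theorem FaceRel.eq_of {A B : Type*} {α β : A → A} (q : A → B)
    (h₁ : ∀ x, q (α x) = q x) (h₂ : ∀ x, q (β x) = q x)
    {x y : A} (h : FaceRel α β x y) : q x = q y := by
  induction h with
  | rel x y h => rcases h with rfl | rfl; exacts [(h₁ _).symm, (h₂ _).symm]
  | refl x => rfl
  | symm x y _ ih => exact ih.symm
  | trans x y z _ _ ih ih' => exact ih.trans ih'

theorem FaceRel.refl {A : Type*} {α β : A → A} (x : A) : FaceRel α β x x := EqvGen.refl x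

theorem FaceRel.symm {A : Type*} {α β : A → A} {x y : A} (h : FaceRel α β x y) :
    FaceRel α β y x := EqvGen.symm _ _ h

theorem FaceRel.trans {A : Type*} {α β : A → A} {x y z : A} (h : FaceRel α β x y)
    (h' : FaceRel α β y z) : FaceRel α β x z := EqvGen.trans _ _ _ h h'

theorem FaceRel.left {A : Type*} {α β : A → A} (x : A) : FaceRel α β x (α x) :=
  EqvGen.rel _ _ (Or.inl rfl)

theorem FaceRel.right {A : Type*} {α β : A → A} (x : A) : FaceRel α β x (β x) :=
  EqvGen.rel _ _ (Or.inr rfl)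

/-- A finite 2-complex: a finite graph (loops and parallel edges allowed) together with a finite
family of closed trails, called faces.

The graph is given by its vertices and half-edges: an edge is a pair `{h, flip h}`, and `vert h`
is the endvertex at the half-edge `h`.  (So an edge is a loop if `vert h = vert (flip h)`.)

A face is given by its flags.  A flag is one traversal of an edge by a face together with one end
of that edge; `half` is the half-edge consisting of that edge and that end.  `across` goes to the
other end of the same traversed edge.  `turn` goes, in the boundary of the face and at the same
vertex, to the adjacent end of the preceding or succeeding edge.  Hence a face is an orbit of flags
under `across` and `turn`: alternately applying these two maps one walks once around a closed walk
in the graph.  `trail` says that these closed walks use no edge twice. -/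
structure TwoComplex where
  V : Type u
  Half : Type u
  Flag : Type u
  finV : Finite V
  finHalf : Finite Half
  finFlag : Finite Flag
  flip : Half → Half
  flip_flip : ∀ h, flip (flip h) = h
  flip_ne : ∀ h, flip h ≠ h
  vert : Half → V
  half : Flag → Half
  across : Flag → Flag
  across_across : ∀ φ, across (across φ) = φ
  half_across : ∀ φ, half (across φ) = flip (half φ)
  turn : Flag → Flag
  turn_turn : ∀ φ, turn (turn φ) = φ
  turn_ne : ∀ φ, turn φ ≠ φ
  vert_turn : ∀ φ, vert (half (turn φ)) = vert (half φ)
  trail : ∀ φ ψ, FaceRel across turn φ ψ → half φ = half ψ → φ = ψ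

namespace TwoComplex

attribute [instance] finV finHalf finFlag

/-- Isomorphism of 2-complexes. -/
structure Iso (C D : TwoComplex.{u}) where
  onV : C.V ≃ D.V
  onHalf : C.Half ≃ D.Half
  onFlag : C.Flag ≃ D.Flag
  flip : ∀ h, onHalf (C.flip h) = D.flip (onHalf h)
  vert : ∀ h, onV (C.vert h) = D.vert (onHalf h)
  half : ∀ φ, onHalf (C.half φ) = D.half (onFlag φ)
  across : ∀ φ, onFlag (C.across φ) = D.across (onFlag φ)
  turn : ∀ φ, onFlag (C.turn φ) = D.turn (onFlag φ)

variable (C : TwoComplex.{u})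

/-- Two flags belong to the same face. -/
def SameFace (φ ψ : C.Flag) : Prop := FaceRel C.across C.turn φ ψ

/-! ### Link graphs

The link graph `L(v)` has as vertices the half-edges at `v` (so each edge at `v` gives one vertex,
and each loop at `v` gives two), and one edge for each traversal of `v` by a face; the two ends of
such a link edge are the flags `φ` and `turn φ`, at the link vertices `half φ` and
`half (turn φ)`. -/

/-- The disjoint union of all link graphs (adjacency only). -/
def linkGraph : SimpleGraph C.Half where
  Adj x y := x ≠ y ∧ ∃ φ, C.half φ = x ∧ C.half (C.turn φ) = y
  symm := ⟨by
    rintro x y ⟨hne, φ, hx, hy⟩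
    exact ⟨hne.symm, C.turn φ, hy, by rw [C.turn_turn, hx]⟩⟩
  loopless := ⟨fun x h => h.1 rfl⟩

/-- The graph `L(v) - S`, obtained from the link graph at `v` by deleting the vertices in `S`. -/
def linkDel (v : C.V) (S : Set C.Half) : SimpleGraph {h : C.Half // C.vert h = v ∧ h ∉ S} :=
  C.linkGraph.comap Subtype.val

/-- The link graph at `v` is connected. -/
def LinkConnected (v : C.V) : Prop := (C.linkDel v ∅).Connected

/-- The link graph at `v` is 2-connected. -/
def LinkTwoConnected (v : C.V) : Prop :=
  2 < Nat.card {h : C.Half // C.vert h = v} ∧ C.LinkConnected v ∧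
    ∀ x, C.vert x = v → (C.linkDel v {x}).Connected

/-- The flags at `v`, that is, the ends of the edges of the link graph `L(v)`. -/
def LinkFlag (v : C.V) : Type u := {φ : C.Flag // C.vert (C.half φ) = v}

/-- The map exchanging the two ends of each edge of `L(v)`. -/
def linkTurn (v : C.V) (φ : C.LinkFlag v) : C.LinkFlag v :=
  ⟨C.turn φ.1, (C.vert_turn φ.1).trans φ.2⟩

end TwoComplex

/-! ### Rotation systems -/

/-- Let a graph be given by the set `D` of ends of its edges, the map `β` exchanging the two ends of
every edge, and a rotation system, given by the permutation `ρ` of `D` whose cycles are the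
rotators.  Gluing discs along the closed walks traced by `ρ ∘ β` gives an embedding in a disjoint
union of closed oriented surfaces, one for each component.  These surfaces are all spheres if and
only if `#vertices - #edges + #discs = 2 * #components`.  (Isolated vertices have no edge-ends and
are left out on both sides; they lie in spheres anyway.) -/
def IsSpherical {D : Type*} (ρ β : D → D) : Prop :=
  (Nat.card (Quot fun x y : D => y = ρ x) : ℤ) - Nat.card (Quot fun x y : D => y = β x)
      + Nat.card (Quot fun x y : D => y = ρ (β x))
    = 2 * Nat.card (Quot fun x y : D => y = ρ x ∨ y = β x)

namespace TwoComplex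

variable (C : TwoComplex.{u})

/-- A planar rotation system of the link graph `L(v)`: for every vertex of `L(v)` a cyclic
orientation of the incident edges, such that the resulting surface is a union of spheres. -/
structure IsPlanarLinkRotation (v : C.V) (ρ : Equiv.Perm (C.LinkFlag v)) : Prop where
  sameCycle : ∀ x y, ρ.SameCycle x y ↔ C.half x.1 = C.half y.1
  planar : IsSpherical ρ (C.linkTurn v)

/-- A rotation system of a 2-complex: for every edge `e` a cyclic orientation of the faces incident
with `e`.  It is recorded at both half-edges of `e`; from one half-edge to the other the
orientation is reversed. -/
structure IsRotationSystem (ρ : Equiv.Perm C.Flag) : Prop where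
  sameCycle : ∀ φ ψ, ρ.SameCycle φ ψ ↔ C.half φ = C.half ψ
  reverse : ∀ φ, ρ (C.across φ) = C.across (ρ⁻¹ φ)

variable {C} in
theorem IsRotationSystem.half_apply {ρ : Equiv.Perm C.Flag} (hρ : C.IsRotationSystem ρ)
    (φ : C.Flag) : C.half (ρ φ) = C.half φ :=
  ((hρ.sameCycle φ (ρ φ)).1 ⟨1, by simp⟩).symm

variable {C} in
/-- The rotation system of the link graph `L(v)` induced by a rotation system of the complex. -/
def IsRotationSystem.atVertex {ρ : Equiv.Perm C.Flag} (hρ : C.IsRotationSystem ρ) (v : C.V) :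
    Equiv.Perm (C.LinkFlag v) :=
  ρ.subtypePerm fun φ => by rw [hρ.half_apply]

/-- The complex has a rotation system that induces a planar rotation system at every link graph. -/
def HasPlanarRotationSystem : Prop :=
  ∃ (ρ : Equiv.Perm C.Flag) (hρ : C.IsRotationSystem ρ),
    ∀ v, IsSpherical (hρ.atVertex v) (C.linkTurn v)

/-! ### Auxiliary facts for the constructions -/

theorem vert_turn' (φ : C.Flag) {v : C.V} : C.vert (C.half (C.turn φ)) = v ↔
    C.vert (C.half φ) = v := by rw [C.vert_turn]

theorem across_ne (φ : C.Flag) : C.across φ ≠ φ := fun h =>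
  C.flip_ne (C.half φ) (by rw [← C.half_across, h])

theorem half_turn_ne (φ : C.Flag) : C.half (C.turn φ) ≠ C.half φ := fun h =>
  C.turn_ne φ (C.trail φ _ (FaceRel.right φ) h.symm).symm

theorem flip_eq_iff {x y : C.Half} : C.flip x = y ↔ x = C.flip y :=
  ⟨fun h => by rw [← h, C.flip_flip], fun h => by rw [h, C.flip_flip]⟩

theorem comp_turn {v : C.V} {S : Set C.Half} (φ : C.Flag)
    (h : C.vert (C.half φ) = v ∧ C.half φ ∉ S)
    (h' : C.vert (C.half (C.turn φ)) = v ∧ C.half (C.turn φ) ∉ S) :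
    (C.linkDel v S).connectedComponentMk ⟨C.half (C.turn φ), h'⟩
      = (C.linkDel v S).connectedComponentMk ⟨C.half φ, h⟩ := by
  apply SimpleGraph.ConnectedComponent.sound
  apply SimpleGraph.Adj.reachable
  exact ⟨C.half_turn_ne φ, C.turn φ, rfl, by rw [C.turn_turn]⟩

theorem contract_aux {h : C.Half} {φ : C.Flag} (hφ : C.half φ ≠ h ∧ C.half φ ≠ C.flip h)
    (h₁ : ¬ (C.half (C.turn φ) ≠ h ∧ C.half (C.turn φ) ≠ C.flip h)) :
    C.half (C.turn (C.across (C.turn φ))) ≠ h ∧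
      C.half (C.turn (C.across (C.turn φ))) ≠ C.flip h := by
  by_contra h₂
  have a₁ := C.half_across (C.turn φ)
  have a₂ := C.half_turn_ne (C.across (C.turn φ))
  have a₃ := C.flip_flip h
  have h₃ : C.half (C.turn (C.across (C.turn φ))) = C.half (C.turn φ) := by grind
  have h₄ := C.trail _ _ ((FaceRel.left _).trans (FaceRel.right _)).symm h₃
  refine C.across_ne φ ?_
  have h₅ : C.across (C.turn φ) = φ := by
    rw [← C.turn_turn (C.across (C.turn φ)), h₄, C.turn_turn]
  have h₆ : C.flip (C.half (C.turn φ)) = C.half φ := by rw [← C.half_across, h₅]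
  grind

instance finite_component (v : C.V) (S : Set C.Half) :
    Finite (C.linkDel v S).ConnectedComponent :=
  Finite.of_surjective (C.linkDel v S).connectedComponentMk
    (fun X => X.exists_rep)

/-! ### Splitting a vertex -/

open Classical in
/-- Splitting the vertex `v`: it is replaced by one vertex for every component of `L(v)`, and this
vertex is incident with the half-edges in that component. -/
noncomputable def splitVertex (v : C.V) : TwoComplex.{u} where
  V := {x : C.V // x ≠ v} ⊕ (C.linkDel v ∅).ConnectedComponent
  Half := C.Half
  Flag := C.Flag
  finV := inferInstance
  finHalf := inferInstance
  finFlag := inferInstance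
  flip := C.flip
  flip_flip := C.flip_flip
  flip_ne := C.flip_ne
  vert h :=
    if hv : C.vert h = v then
      Sum.inr ((C.linkDel v ∅).connectedComponentMk ⟨h, hv, Set.notMem_empty h⟩)
    else Sum.inl ⟨C.vert h, hv⟩
  half := C.half
  across := C.across
  across_across := C.across_across
  half_across := C.half_across
  turn := C.turn
  turn_turn := C.turn_turn
  turn_ne := C.turn_ne
  vert_turn φ := by
    by_cases h : C.vert (C.half φ) = v
    · have h' := (C.vert_turn' φ).2 h
      simp only [h, h', dite_true]
      rw [C.comp_turn (S := ∅) φ ⟨h, by simp⟩]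
    · have h' := mt (C.vert_turn' φ).1 h
      simp only [h, dite_false, C.vert_turn]
  trail := C.trail

/-! ### Contracting an edge -/

open Classical in
/-- The contraction `C/e` of the non-loop `e = {h, flip h}`: its endvertices are identified (the
name `vert h` is kept), and `e` is deleted from the graph and from all faces. -/
noncomputable def contract (h : C.Half) (hh : C.vert h ≠ C.vert (C.flip h)) : TwoComplex.{u} where
  V := {x : C.V // x ≠ C.vert (C.flip h)}
  Half := {k : C.Half // k ≠ h ∧ k ≠ C.flip h}
  Flag := {φ : C.Flag // C.half φ ≠ h ∧ C.half φ ≠ C.flip h}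
  finV := inferInstance
  finHalf := inferInstance
  finFlag := inferInstance
  flip k := ⟨C.flip k.1, fun e => k.2.2 (C.flip_eq_iff.1 e),
    fun e => k.2.1 (by rw [← C.flip_flip k.1, e, C.flip_flip])⟩
  flip_flip k := Subtype.ext (C.flip_flip k.1)
  flip_ne k e := C.flip_ne k.1 (congrArg Subtype.val e)
  vert k := if hk : C.vert k.1 = C.vert (C.flip h) then ⟨C.vert h, hh⟩ else ⟨C.vert k.1, hk⟩
  half φ := ⟨C.half φ.1, φ.2⟩
  across φ := ⟨C.across φ.1, by
    rw [C.half_across]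
    exact ⟨fun e => φ.2.2 (C.flip_eq_iff.1 e),
      fun e => φ.2.1 (by rw [← C.flip_flip (C.half φ.1), e, C.flip_flip])⟩⟩
  across_across φ := Subtype.ext (C.across_across φ.1)
  half_across φ := Subtype.ext (C.half_across φ.1)
  turn φ :=
    if hφ : C.half (C.turn φ.1) ≠ h ∧ C.half (C.turn φ.1) ≠ C.flip h then ⟨C.turn φ.1, hφ⟩
    else ⟨C.turn (C.across (C.turn φ.1)), C.contract_aux φ.2 hφ⟩
  turn_turn φ := by
    obtain ⟨φ, hφ⟩ := φ
    by_cases h₁ : C.half (C.turn φ) ≠ h ∧ C.half (C.turn φ) ≠ C.flip h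
    · simp [h₁, hφ, C.turn_turn]
    · have h₂ : ¬ (C.half (C.across (C.turn φ)) ≠ h ∧
          C.half (C.across (C.turn φ)) ≠ C.flip h) := by
        rw [C.half_across]
        grind [C.flip_flip]
      simp only [h₁, dite_false, C.turn_turn, h₂, C.across_across]
  turn_ne φ := by
    obtain ⟨φ, hφ⟩ := φ
    by_cases h₁ : C.half (C.turn φ) ≠ h ∧ C.half (C.turn φ) ≠ C.flip h
    · simp [h₁, C.turn_ne]
    · simp only [h₁, dite_false, ne_eq, Subtype.mk.injEq]
      intro h₂
      exact C.across_ne (C.turn φ) (by rw [← C.turn_turn (C.across (C.turn φ)), h₂])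
  vert_turn φ := by
    obtain ⟨φ, hφ⟩ := φ
    by_cases h₁ : C.half (C.turn φ) ≠ h ∧ C.half (C.turn φ) ≠ C.flip h
    · simp [h₁, C.vert_turn]
    · have h₂ := C.vert_turn (C.across (C.turn φ))
      have h₃ := C.vert_turn φ
      rw [C.half_across] at h₂
      have h₄ := C.flip_flip h
      simp only [h₁, dite_false]
      grind
  trail φ ψ hs he := by
    refine Subtype.ext (C.trail φ.1 ψ.1 ?_ (congrArg Subtype.val he))
    refine FaceRel.map (fun x : {φ : C.Flag // C.half φ ≠ h ∧ C.half φ ≠ C.flip h} => x.1)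
      (fun x => FaceRel.left _) (fun x => ?_) hs
    by_cases h₁ : C.half (C.turn x.1) ≠ h ∧ C.half (C.turn x.1) ≠ C.flip h
    · simp only [h₁, and_self, ne_eq, not_false_eq_true, dite_true]
      exact FaceRel.right _
    · simp only [h₁, dite_false]
      exact (FaceRel.right _).trans ((FaceRel.left _).trans (FaceRel.right _))

/-! ### Subdivisions -/

open Classical in
/-- Subdividing the edge `{h, flip h}` by one new vertex. -/
noncomputable def subdivideEdge (h : C.Half) : TwoComplex.{u} where
  V := Option C.V
  Half := C.Half ⊕ Bool
  Flag := C.Flag ⊕ {φ : C.Flag // C.half φ = h} × Bool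
  finV := inferInstance
  finHalf := inferInstance
  finFlag := inferInstance
  flip k := match k with
    | Sum.inl k => if k = h then Sum.inr false else if k = C.flip h then Sum.inr true
        else Sum.inl (C.flip k)
    | Sum.inr false => Sum.inl h
    | Sum.inr true => Sum.inl (C.flip h)
  flip_flip k := by
    have h₁ := C.flip_flip h
    have h₂ := C.flip_ne h
    rcases k with k | _ | _
    · have h₃ := C.flip_flip k
      by_cases a₁ : k = h
      · simp [a₁]
      · by_cases a₂ : k = C.flip h
        · simp [a₂, h₂]
        · have a₃ : C.flip k ≠ h := by grind
          have a₄ : C.flip k ≠ C.flip h := by grind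
          simp [a₁, a₂, a₃, a₄, h₃]
    · simp
    · simp [h₂]
  flip_ne k := by
    rcases k with k | _ | _
    · by_cases a₁ : k = h
      · simp [a₁]
      · by_cases a₂ : k = C.flip h
        · simp [a₂, C.flip_ne]
        · simp [a₁, a₂, C.flip_ne]
    · simp
    · simp
  vert k := match k with
    | Sum.inl k => some (C.vert k)
    | Sum.inr _ => none
  half φ := match φ with
    | Sum.inl φ => Sum.inl (C.half φ)
    | Sum.inr (_, i) => Sum.inr i
  across φ := match φ with
    | Sum.inl φ =>
        if hφ : C.half φ = h then Sum.inr (⟨φ, hφ⟩, false)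
        else if hφ' : C.half (C.across φ) = h then Sum.inr (⟨C.across φ, hφ'⟩, true)
        else Sum.inl (C.across φ)
    | Sum.inr (φ, false) => Sum.inl φ.1
    | Sum.inr (φ, true) => Sum.inl (C.across φ.1)
  across_across φ := by
    have h₂ := C.flip_ne h
    rcases φ with φ | ⟨⟨φ, hφ⟩, _ | _⟩
    · have h₃ := C.across_across φ
      by_cases a₁ : C.half φ = h
      · simp [a₁]
      · by_cases a₂ : C.half (C.across φ) = h
        · simp [a₁, a₂, h₃]
        · simp [a₁, a₂, h₃]
    · simp [hφ]
    · have a₁ : C.half (C.across φ) ≠ h := by rw [C.half_across, hφ]; exact h₂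
      simp [a₁, C.across_across, hφ]
  half_across φ := by
    have h₁ := C.flip_flip h
    have h₂ := C.flip_ne h
    rcases φ with φ | ⟨⟨φ, hφ⟩, _ | _⟩
    · have h₄ := C.flip_flip (C.half φ)
      have h₃ := C.half_across φ
      by_cases a₁ : C.half φ = h
      · simp [a₁]
      · by_cases a₂ : C.half (C.across φ) = h
        · have a₃ : C.half φ = C.flip h := by grind
          simp [a₂, a₃, h₂]
        · have a₃ : C.half φ ≠ C.flip h := by grind
          simp only [a₁, a₂, a₃, dite_false, if_false]
          rw [h₃]
    · simp [hφ]
    · simp [hφ, C.half_across]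
  turn φ := match φ with
    | Sum.inl φ => Sum.inl (C.turn φ)
    | Sum.inr (φ, i) => Sum.inr (φ, !i)
  turn_turn φ := by rcases φ with φ | ⟨φ, i⟩ <;> simp [C.turn_turn]
  turn_ne φ := by rcases φ with φ | ⟨φ, _ | _⟩ <;> simp [C.turn_ne]
  vert_turn φ := by rcases φ with φ | ⟨φ, i⟩ <;> simp [C.vert_turn]
  trail φ ψ hs he := by
    have h₁ := FaceRel.map (α' := C.across) (β' := C.turn)
      (fun x : C.Flag ⊕ {φ : C.Flag // C.half φ = h} × Bool => match x with
        | Sum.inl x => x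
        | Sum.inr (x, _) => x.1) (fun x => ?_) (fun x => ?_) hs
    · rcases φ with φ | ⟨⟨φ, hφ⟩, i⟩ <;> rcases ψ with ψ | ⟨⟨ψ, hψ⟩, j⟩ <;> simp at he h₁ ⊢
      · exact C.trail _ _ h₁ he
      · exact ⟨C.trail _ _ h₁ (hφ.trans hψ.symm), he⟩
    · rcases x with x | ⟨⟨x, hx⟩, _ | _⟩
      · by_cases a₁ : C.half x = h
        · simpa [a₁] using FaceRel.refl _
        · by_cases a₂ : C.half (C.across x) = h
          · simpa [a₁, a₂] using FaceRel.left _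
          · simpa [a₁, a₂] using FaceRel.left _
      · exact FaceRel.refl _
      · exact FaceRel.left _
    · rcases x with x | ⟨⟨x, hx⟩, i⟩
      · exact FaceRel.right _
      · exact FaceRel.refl _

/-- The set `S` of flags is an arc of the boundary of a face, which starts at `φ` and ends at
`ψ`: the corners `{φ, turn φ}` and `{ψ, turn ψ}` are the places where `S` is cut off. -/
structure IsArc (S : Set C.Flag) (φ ψ : C.Flag) : Prop where
  left_mem : φ ∈ S
  right_mem : ψ ∈ S
  ne : φ ≠ ψ
  sameFace : C.SameFace φ ψ
  across_mem : ∀ x ∈ S, C.across x ∈ S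
  turn_mem : ∀ x ∈ S, x ≠ φ → x ≠ ψ → C.turn x ∈ S
  turn_left : C.turn φ ∉ S
  turn_right : C.turn ψ ∉ S

open Classical in
/-- Subdividing a face by one new edge through it, which joins the corners `{φ, turn φ}` and
`{ψ, turn ψ}` of this face.  One of the two new faces consists of the arc from `φ` to `ψ` and the
new edge, the other one of the rest of the old face and the new edge.  A new flag `(s, i)` belongs
to the first of these faces for `s = true`, to the other one for `s = false`, and lies at the first
corner for `i = false`, at the second for `i = true`. -/
noncomputable def subdivideFace (φ ψ : C.Flag) (hφψ : ∃ S, C.IsArc S φ ψ) : TwoComplex.{u} where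
  V := C.V
  Half := C.Half ⊕ Bool
  Flag := C.Flag ⊕ Bool × Bool
  finV := inferInstance
  finHalf := inferInstance
  finFlag := inferInstance
  flip k := match k with
    | Sum.inl k => Sum.inl (C.flip k)
    | Sum.inr i => Sum.inr !i
  flip_flip k := by rcases k with k | _ | _ <;> simp [C.flip_flip]
  flip_ne k := by rcases k with k | _ | _ <;> simp [C.flip_ne]
  vert k := match k with
    | Sum.inl k => C.vert k
    | Sum.inr false => C.vert (C.half φ)
    | Sum.inr true => C.vert (C.half ψ)
  half x := match x with
    | Sum.inl x => Sum.inl (C.half x)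
    | Sum.inr (_, i) => Sum.inr i
  across x := match x with
    | Sum.inl x => Sum.inl (C.across x)
    | Sum.inr (s, i) => Sum.inr (s, !i)
  across_across x := by rcases x with x | ⟨s, i⟩ <;> simp [C.across_across]
  half_across x := by rcases x with x | ⟨s, i⟩ <;> simp [C.half_across]
  turn x := match x with
    | Sum.inl x =>
        if x = φ then Sum.inr (true, false)
        else if x = ψ then Sum.inr (true, true)
        else if x = C.turn φ then Sum.inr (false, false)
        else if x = C.turn ψ then Sum.inr (false, true)
        else Sum.inl (C.turn x)
    | Sum.inr (true, false) => Sum.inl φ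
    | Sum.inr (true, true) => Sum.inl ψ
    | Sum.inr (false, false) => Sum.inl (C.turn φ)
    | Sum.inr (false, true) => Sum.inl (C.turn ψ)
  turn_turn x := by
    obtain ⟨S, hS⟩ := hφψ
    have a₁ := hS.ne
    have a₂ := C.turn_turn φ
    have a₃ := C.turn_turn ψ
    have a₄ : C.turn φ ≠ φ := C.turn_ne φ
    have a₅ : C.turn ψ ≠ ψ := C.turn_ne ψ
    have a₆ : C.turn φ ≠ ψ := fun e => hS.turn_left (e ▸ hS.right_mem)
    have a₇ : C.turn ψ ≠ φ := fun e => hS.turn_right (e ▸ hS.left_mem)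
    have a₈ : C.turn ψ ≠ C.turn φ := by grind
    rcases x with x | ⟨_ | _, _ | _⟩
    · have a₉ := C.turn_turn x
      by_cases b₁ : x = φ
      · simp [b₁]
      by_cases b₂ : x = ψ
      · simp [b₂, a₁.symm]
      by_cases b₃ : x = C.turn φ
      · simp [b₃, a₄, a₆]
      by_cases b₄ : x = C.turn ψ
      · simp [b₄, a₅, a₇, a₈]
      have c₁ : C.turn x ≠ φ := by grind
      have c₂ : C.turn x ≠ ψ := by grind
      have c₃ : C.turn x ≠ C.turn φ := by grind
      have c₄ : C.turn x ≠ C.turn ψ := by grind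
      simp [b₁, b₂, b₃, b₄, c₁, c₂, c₃, c₄, a₉]
    · simp [a₄, a₆]
    · simp [a₅, a₇, a₈]
    · simp
    · simp [a₁.symm]
  turn_ne x := by
    rcases x with x | ⟨_ | _, _ | _⟩
    · by_cases b₁ : x = φ
      · simp [b₁]
      by_cases b₂ : x = ψ
      · by_cases b : ψ = φ <;> simp [b₂, b]
      by_cases b₃ : x = C.turn φ
      · simp only [b₁, b₂, if_false]; simp [b₃]
      by_cases b₄ : x = C.turn ψ
      · simp only [b₁, b₂, b₃, if_false]; simp [b₄]
      simp [b₁, b₂, b₃, b₄, C.turn_ne]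
    all_goals simp
  vert_turn x := by
    rcases x with x | ⟨_ | _, _ | _⟩
    · by_cases b₁ : x = φ
      · simp [b₁]
      by_cases b₂ : x = ψ
      · by_cases b : ψ = φ <;> simp [b₂, b]
      by_cases b₃ : x = C.turn φ
      · simp only [b₁, b₂, if_false]; simp [b₃, C.vert_turn]
      by_cases b₄ : x = C.turn ψ
      · simp only [b₁, b₂, b₃, if_false]; simp [b₄, C.vert_turn]
      simp [b₁, b₂, b₃, b₄, C.vert_turn]
    all_goals simp [C.vert_turn]
  trail x y hs he := by
    obtain ⟨S, hS⟩ := hφψ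
    have h₁ := FaceRel.map (α' := C.across) (β' := C.turn)
      (fun x : C.Flag ⊕ Bool × Bool => match x with
        | Sum.inl x => x
        | Sum.inr _ => φ) (fun x => ?_) (fun x => ?_) hs
    · have h₂ := FaceRel.eq_of
        (fun x : C.Flag ⊕ Bool × Bool => match x with
          | Sum.inl x => x ∈ S
          | Sum.inr (s, _) => s = true) (fun x => ?_) (fun x => ?_) hs
      · rcases x with x | ⟨s, i⟩ <;> rcases y with y | ⟨t, j⟩ <;> simp at he h₁ h₂ ⊢
        · exact C.trail _ _ h₁ he
        · exact ⟨h₂, he⟩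
      · rcases x with x | ⟨s, i⟩
        · refine propext ⟨fun h => ?_, fun h => hS.across_mem _ h⟩
          have := hS.across_mem _ h
          rwa [C.across_across] at this
        · rfl
      · have k₁ := hS.left_mem
        have k₂ := hS.right_mem
        have k₃ := hS.turn_left
        have k₄ := hS.turn_right
        rcases x with x | ⟨_ | _, _ | _⟩
        · by_cases b₁ : x = φ
          · simp [b₁, k₁]
          by_cases b₂ : x = ψ
          · simp [b₂, hS.ne.symm, k₂]
          by_cases b₃ : x = C.turn φ
          · simp only [b₁, b₂, if_false]; simp [b₃, k₃]
          by_cases b₄ : x = C.turn ψ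
          · simp only [b₁, b₂, b₃, if_false]; simp [b₄, k₄]
          simp only [b₁, b₂, b₃, b₄, if_false]
          refine propext ⟨fun h => ?_, fun h => hS.turn_mem _ h b₁ b₂⟩
          have := hS.turn_mem _ h (fun e => b₃ (by rw [← e, C.turn_turn]))
            (fun e => b₄ (by rw [← e, C.turn_turn]))
          rwa [C.turn_turn] at this
        all_goals simp [k₁, k₂, k₃, k₄]
    · rcases x with x | ⟨s, i⟩
      · exact FaceRel.left _
      · exact FaceRel.refl _
    · have r : FaceRel C.across C.turn φ ψ := hS.sameFace
      rcases x with x | ⟨_ | _, _ | _⟩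
      · by_cases b₁ : x = φ
        · simpa [b₁] using FaceRel.refl _
        by_cases b₂ : x = ψ
        · simpa [b₂, hS.ne.symm] using r.symm
        by_cases b₃ : x = C.turn φ
        · simp only [b₁, b₂, if_false]
          simpa [b₃] using (FaceRel.right _).symm
        by_cases b₄ : x = C.turn ψ
        · simp only [b₁, b₂, b₃, if_false]
          simpa [b₄] using (FaceRel.right _).symm.trans r.symm
        simpa [b₁, b₂, b₃, b₄] using FaceRel.right _
      · exact FaceRel.right _
      · exact r.trans (FaceRel.right _)
      · exact FaceRel.refl _
      · exact r

/-! ### Stretching a branch -/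

/-- The half-edge `k` belongs to the component `X` of `L(v) - S`. -/
def InComp {v : C.V} {S : Set C.Half} (X : (C.linkDel v S).ConnectedComponent) (k : C.Half) :
    Prop :=
  ∃ hk, (C.linkDel v S).connectedComponentMk ⟨k, hk⟩ = X

open Classical in
/-- Pre-stretching the branch `B = X + e` of the link graph at `v = vert e`, where `X` is a
component of `L(v) - e`.  There is a new vertex `v[B]`, which is `none`, and a new edge `e[B]` from
`v` (half-edge `inr false`) to `v[B]` (half-edge `inr true`).  The half-edges in `X` are moved from
`v` to `v[B]`.  The faces which, in `L(v)`, join `e` to `X` traverse `e[B]` between `e` and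
their half-edge in `X`. -/
noncomputable def preStretchBranch (e : C.Half)
    (X : (C.linkDel (C.vert e) {e}).ConnectedComponent) : TwoComplex.{u} where
  V := Option C.V
  Half := C.Half ⊕ Bool
  Flag := C.Flag ⊕ {φ : C.Flag // C.half φ = e ∧ C.InComp X (C.half (C.turn φ))} × Bool
  finV := inferInstance
  finHalf := inferInstance
  finFlag := inferInstance
  flip k := match k with
    | Sum.inl k => Sum.inl (C.flip k)
    | Sum.inr i => Sum.inr !i
  flip_flip k := by rcases k with k | _ | _ <;> simp [C.flip_flip]
  flip_ne k := by rcases k with k | _ | _ <;> simp [C.flip_ne]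
  vert k := match k with
    | Sum.inl k => if C.InComp X k then none else some (C.vert k)
    | Sum.inr false => some (C.vert e)
    | Sum.inr true => none
  half φ := match φ with
    | Sum.inl φ => Sum.inl (C.half φ)
    | Sum.inr (_, i) => Sum.inr i
  across φ := match φ with
    | Sum.inl φ => Sum.inl (C.across φ)
    | Sum.inr (φ, i) => Sum.inr (φ, !i)
  across_across x := by rcases x with x | ⟨s, i⟩ <;> simp [C.across_across]
  half_across x := by rcases x with x | ⟨s, i⟩ <;> simp [C.half_across]
  turn φ := match φ with
    | Sum.inl φ =>
        if hφ : C.half φ = e ∧ C.InComp X (C.half (C.turn φ)) then Sum.inr (⟨φ, hφ⟩, false)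
        else if hφ' : C.half (C.turn φ) = e ∧ C.InComp X (C.half (C.turn (C.turn φ))) then
          Sum.inr (⟨C.turn φ, hφ'⟩, true)
        else Sum.inl (C.turn φ)
    | Sum.inr (φ, false) => Sum.inl φ.1
    | Sum.inr (φ, true) => Sum.inl (C.turn φ.1)
  turn_turn x := by
    have key : ∀ φ : C.Flag, C.half φ = e → C.half (C.turn φ) ≠ e := fun φ h h' =>
      C.half_turn_ne φ (h'.trans h.symm)
    rcases x with x | ⟨⟨x, hx⟩, _ | _⟩
    · have a₀ := C.turn_turn x
      by_cases b₁ : C.half x = e ∧ C.InComp X (C.half (C.turn x))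
      · simp [b₁]
      by_cases b₂ : C.half (C.turn x) = e ∧ C.InComp X (C.half x)
      · simp only [b₁, dite_false]; simp [b₂, a₀]
      · simp only [b₁, b₂, a₀, dite_false]
    · simp [hx]
    · simp [C.turn_turn, hx, key x hx.1]
  turn_ne x := by
    rcases x with x | ⟨⟨x, hx⟩, _ | _⟩
    · by_cases b₁ : C.half x = e ∧ C.InComp X (C.half (C.turn x))
      · simp [b₁]
      by_cases b₂ : C.half (C.turn x) = e ∧ C.InComp X (C.half x)
      · simp only [b₁, dite_false]; simp [b₂, C.turn_turn]
      · simp only [b₁, dite_false]; simp [b₂, C.turn_turn, C.turn_ne]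
    · simp
    · simp
  vert_turn x := by
    have key : ¬ C.InComp X e := fun ⟨hk, _⟩ => hk.2 rfl
    have key' : ∀ φ : C.Flag, ¬ (C.half (C.turn φ) = e ∧ C.InComp X (C.half φ)) →
        C.InComp X (C.half φ) → C.InComp X (C.half (C.turn φ)) := by
      rintro φ h₁ h₂
      obtain ⟨hk, hX⟩ := id h₂
      have h₃ : C.vert (C.half (C.turn φ)) = C.vert e ∧ C.half (C.turn φ) ∉ ({e} : Set C.Half) :=
        ⟨(C.vert_turn φ).trans hk.1, fun h => h₁ ⟨h, h₂⟩⟩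
      exact ⟨h₃, (C.comp_turn φ hk h₃).trans hX⟩
    rcases x with x | ⟨⟨x, hx⟩, _ | _⟩
    · have a₀ := C.turn_turn x
      have a₁ := C.vert_turn x
      by_cases b₁ : C.half x = e ∧ C.InComp X (C.half (C.turn x))
      · simp only [b₁, and_self, dite_true, key, if_false]
      by_cases b₂ : C.half (C.turn x) = e ∧ C.InComp X (C.half x)
      · simp only [b₁, dite_false]; simp [b₂, a₀]
      · have b₃ : C.InComp X (C.half (C.turn x)) ↔ C.InComp X (C.half x) :=
          ⟨fun h => by
            have := key' (C.turn x) (by rwa [a₀]) h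
            rwa [a₀] at this, key' x b₂⟩
        simp only [b₁, b₂, a₀, dite_false]
        simp only [b₃, a₁]
    · simp [hx, key]
    · simp [hx]
  trail φ ψ hs he := by
    have h₁ := FaceRel.map (α' := C.across) (β' := C.turn)
      (fun x : C.Flag ⊕
          {φ : C.Flag // C.half φ = e ∧ C.InComp X (C.half (C.turn φ))} × Bool => match x with
        | Sum.inl x => x
        | Sum.inr (x, _) => x.1) (fun x => ?_) (fun x => ?_) hs
    · rcases φ with φ | ⟨⟨φ, hφ⟩, i⟩ <;> rcases ψ with ψ | ⟨⟨ψ, hψ⟩, j⟩ <;> simp at he h₁ ⊢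
      · exact C.trail _ _ h₁ he
      · exact ⟨C.trail _ _ h₁ (hφ.1.trans hψ.1.symm), he⟩
    · rcases x with x | ⟨x, i⟩
      · exact FaceRel.left _
      · exact FaceRel.refl _
    · rcases x with x | ⟨⟨x, hx⟩, _ | _⟩
      · by_cases b₁ : C.half x = e ∧ C.InComp X (C.half (C.turn x))
        · simpa [b₁] using FaceRel.refl _
        by_cases b₂ : C.half (C.turn x) = e ∧ C.InComp X (C.half x)
        · simp only [b₁, dite_false]
          simpa [b₂, C.turn_turn] using FaceRel.right _
        · simp only [b₁, dite_false]
          simpa [b₂, C.turn_turn] using FaceRel.right _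
      · exact FaceRel.refl _
      · exact FaceRel.right _

/-! ### Stretching an edge -/

open Classical in
/-- Pre-stretching the edge `e = {h, flip h}` in the direction of the two faces which have at `h` the
flags `f₁` and `f₂`.  The edge `e` is replaced by two parallel edges `e₁` (half-edges `inr false` at
`vert h` and `inr true` at the other end) and `e₂` (half-edges `inl h` and `inl (flip h)`).  The two
given faces are moved to `e₁`, the other faces at `e` to `e₂`, and there is a new face with the two
edges `e₁` and `e₂`.  The flag `(j, i)` of this new face lies at `e₁` for `j = false`, at `e₂` for
`j = true`, and at the endvertex `vert h` for `i = false`, at the other end for `i = true`. -/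
noncomputable def preStretchEdge (h : C.Half) (f₁ f₂ : C.Flag) (h₁ : C.half f₁ = h)
    (h₂ : C.half f₂ = h) : TwoComplex.{u} where
  V := C.V
  Half := C.Half ⊕ Bool
  Flag := C.Flag ⊕ Bool × Bool
  finV := inferInstance
  finHalf := inferInstance
  finFlag := inferInstance
  flip k := match k with
    | Sum.inl k => Sum.inl (C.flip k)
    | Sum.inr i => Sum.inr !i
  flip_flip k := by rcases k with k | _ | _ <;> simp [C.flip_flip]
  flip_ne k := by rcases k with k | _ | _ <;> simp [C.flip_ne]
  vert k := match k with
    | Sum.inl k => C.vert k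
    | Sum.inr false => C.vert h
    | Sum.inr true => C.vert (C.flip h)
  half φ := match φ with
    | Sum.inl φ =>
        if φ = f₁ ∨ φ = f₂ then Sum.inr false
        else if C.across φ = f₁ ∨ C.across φ = f₂ then Sum.inr true
        else Sum.inl (C.half φ)
    | Sum.inr (false, i) => Sum.inr i
    | Sum.inr (true, false) => Sum.inl h
    | Sum.inr (true, true) => Sum.inl (C.flip h)
  across φ := match φ with
    | Sum.inl φ => Sum.inl (C.across φ)
    | Sum.inr (j, i) => Sum.inr (j, !i)
  across_across x := by rcases x with x | ⟨s, i⟩ <;> simp [C.across_across]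
  half_across x := by
    have k₁ := C.flip_flip h
    have k₂ := C.flip_ne h
    rcases x with x | ⟨_ | _, _ | _⟩
    · have k₃ := C.half_across x
      have k₄ := C.across_across x
      have k₅ := C.half_across f₁
      have k₆ := C.half_across f₂
      by_cases b₁ : x = f₁ ∨ x = f₂
      · have b₂ : ¬ (C.across x = f₁ ∨ C.across x = f₂) := by grind
        simp only [b₁, b₂, k₄, if_true, if_false]; simp
      by_cases b₂ : C.across x = f₁ ∨ C.across x = f₂
      · simp only [b₁, b₂, if_true, if_false]; simp
      simp only [b₁, b₂, k₄, if_false, k₃]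
    all_goals simp [k₁]
  turn φ := match φ with
    | Sum.inl φ => Sum.inl (C.turn φ)
    | Sum.inr (j, i) => Sum.inr (!j, i)
  turn_turn x := by rcases x with x | ⟨s, i⟩ <;> simp [C.turn_turn]
  turn_ne x := by rcases x with x | ⟨_ | _, i⟩ <;> simp [C.turn_ne]
  vert_turn x := by
    have k₁ := C.flip_flip h
    have key : ∀ φ : C.Flag, (match (if φ = f₁ ∨ φ = f₂ then Sum.inr false
        else if C.across φ = f₁ ∨ C.across φ = f₂ then Sum.inr true
        else Sum.inl (C.half φ) : C.Half ⊕ Bool) with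
      | Sum.inl k => C.vert k
      | Sum.inr false => C.vert h
      | Sum.inr true => C.vert (C.flip h)) = C.vert (C.half φ) := by
      intro φ
      have k₂ := C.half_across φ
      have k₃ := C.flip_flip (C.half φ)
      by_cases b₁ : φ = f₁ ∨ φ = f₂
      · have : C.half φ = h := by grind
        simp only [b₁, if_true, this]
      by_cases b₂ : C.across φ = f₁ ∨ C.across φ = f₂
      · have : C.half φ = C.flip h := by grind
        simp only [b₁, b₂, if_true, if_false, this]
      · simp only [b₁, b₂, if_false]
    rcases x with x | ⟨_ | _, _ | _⟩
    · exact (key _).trans ((C.vert_turn x).trans (key x).symm)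
    all_goals rfl
  trail x y hs he := by
    have k₂ := C.flip_ne h
    have h₁ := FaceRel.eq_of
      (fun x : C.Flag ⊕ Bool × Bool => match x with
        | Sum.inl x => some (Quot.mk (C.SameFace) x)
        | Sum.inr _ => none) (fun x => ?_) (fun x => ?_) hs
    · have key : ∀ φ : C.Flag, (match (if φ = f₁ ∨ φ = f₂ then Sum.inr false
          else if C.across φ = f₁ ∨ C.across φ = f₂ then Sum.inr true
          else Sum.inl (C.half φ) : C.Half ⊕ Bool) with
        | Sum.inl k => k
        | Sum.inr false => h
        | Sum.inr true => C.flip h) = C.half φ := by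
        intro φ
        have k₂ := C.half_across φ
        have k₃ := C.flip_flip (C.half φ)
        by_cases b₁ : φ = f₁ ∨ φ = f₂
        · have : C.half φ = h := by grind
          simp only [b₁, if_true, this]
        by_cases b₂ : C.across φ = f₁ ∨ C.across φ = f₂
        · have : C.half φ = C.flip h := by grind
          simp only [b₁, b₂, if_true, if_false, this]
        · simp only [b₁, b₂, if_false]
      rcases x with x | ⟨s, i⟩ <;> rcases y with y | ⟨t, j⟩
      · have h₂ : C.half x = C.half y := by
          rw [← key x, ← key y]
          exact congrArg (fun k : C.Half ⊕ Bool => match k with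
            | Sum.inl k => k
            | Sum.inr false => h
            | Sum.inr true => C.flip h) he
        have h₃ : FaceRel C.across C.turn x y :=
          (Equivalence.eqvGen_iff (r := C.SameFace)
            ⟨FaceRel.refl, FaceRel.symm, FaceRel.trans⟩).1
            (Quot.eqvGen_exact (Option.some.inj h₁))
        rw [C.trail x y h₃ h₂]
      · simp at h₁
      · simp at h₁
      · rcases s with _ | _ <;> rcases t with _ | _ <;> rcases i with _ | _ <;>
          rcases j with _ | _ <;> simp [k₂, k₂.symm] at he ⊢
    · rcases x with x | ⟨s, i⟩
      · exact congrArg some (Quot.sound ((FaceRel.left _).symm))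
      · rfl
    · rcases x with x | ⟨s, i⟩
      · exact congrArg some (Quot.sound ((FaceRel.right _).symm))
      · rfl

/-! ### Stretching a 2-separator -/

/-- In a triangle with the three edges `0`, `1`, `2`, each with two ends, the pairing of the ends
at the three corners. -/
def triangleTurn : Fin 3 × Bool → Fin 3 × Bool
  | (0, false) => (1, false)
  | (1, false) => (0, false)
  | (0, true) => (2, false)
  | (2, false) => (0, true)
  | (1, true) => (2, true)
  | (2, true) => (1, true)

open Classical in
/-- The component of `L(v) - S` that contains the half-edge `k`, if there is one. -/
noncomputable def compOf (v : C.V) (S : Set C.Half) (k : C.Half) :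
    Option (C.linkDel v S).ConnectedComponent :=
  if hk : C.vert k = v ∧ k ∉ S then some ((C.linkDel v S).connectedComponentMk ⟨k, hk⟩) else none

theorem compOf_eq_none {v : C.V} {S : Set C.Half} {k : C.Half} (hk : C.vert k ≠ v ∨ k ∈ S) :
    C.compOf v S k = none :=
  dif_neg fun h => hk.elim (fun h' => h' h.1) h.2

theorem compOf_turn {v : C.V} {S : Set C.Half} (φ : C.Flag) (h₁ : C.half φ ∉ S)
    (h₂ : C.half (C.turn φ) ∉ S) :
    C.compOf v S (C.half (C.turn φ)) = C.compOf v S (C.half φ) := by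
  by_cases h : C.vert (C.half φ) = v
  · have h' := (C.vert_turn φ).trans h
    simp only [compOf, h, h', h₁, h₂, not_false_eq_true, and_self, dite_true]
    rw [C.comp_turn φ ⟨h, h₁⟩ ⟨h', h₂⟩]
  · rw [C.compOf_eq_none (Or.inl h), C.compOf_eq_none (Or.inl (by rwa [C.vert_turn]))]

theorem compOf_some {v : C.V} {S : Set C.Half} {k : C.Half} (hk : C.vert k = v) (hS : k ∉ S) :
    ∃ X, C.compOf v S k = some X := ⟨_, dif_pos ⟨hk, hS⟩⟩

open Classical in
/-- Stretching the pair `{a, b}` of vertices of the link graph at `v = vert a`; write `w_a` and `w_b`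
for the other endvertices of the edges `a` and `b`.

There is one new vertex for every component `X` of `L(v) - a - b`, which is joined by new edges to
`v` (label `none`), to `w_a` (label `some false`) and to `w_b` (label `some true`); the half-edges
of these new edges at the vertex `X` carry the label `true`.  The half-edges in `X` are moved from `v`
to the new vertex `X`.  The edges `a` and `b` remain, as the edges `v w_a` and `v w_b`.

A face which in `L(v)` joins `a` to `X` traverses the new edge `w_a X` in place of `a`, similarly
for `b`; a face which in `L(v)` joins `a` and `b` does not change.

There are two new triangles `v w_a X` and `v w_b X` for every `X`.  In `(X, s, j, i)`, the triangle is
given by `X` and `s` (`false` for `a`, `true` for `b`).  Its edge `0` is `a` or `b`, with the end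
`false` at `v`; its edge `1` is `v X`, with the end `false` at `v`; its edge `2` is `w_a X` or
`w_b X`, with the end `true` at `X`. -/
noncomputable def stretchPair (a b : C.Half) (hab : a ≠ b) (hv : C.vert b = C.vert a)
    (ha : C.vert (C.flip a) ≠ C.vert a) (hb : C.vert (C.flip b) ≠ C.vert b) : TwoComplex.{u} where
  V := C.V ⊕ (C.linkDel (C.vert a) {a, b}).ConnectedComponent
  Half := C.Half ⊕ (C.linkDel (C.vert a) {a, b}).ConnectedComponent × Option Bool × Bool
  Flag := C.Flag ⊕ (C.linkDel (C.vert a) {a, b}).ConnectedComponent × Bool × Fin 3 × Bool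
  finV := inferInstance
  finHalf := inferInstance
  finFlag := inferInstance
  flip k := match k with
    | Sum.inl k => Sum.inl (C.flip k)
    | Sum.inr (X, l, i) => Sum.inr (X, l, !i)
  flip_flip k := by rcases k with k | ⟨X, l, i⟩ <;> simp [C.flip_flip]
  flip_ne k := by rcases k with k | ⟨X, l, _ | _⟩ <;> simp [C.flip_ne]
  vert k := match k with
    | Sum.inl k => (C.compOf (C.vert a) {a, b} k).elim (Sum.inl (C.vert k)) Sum.inr
    | Sum.inr (_, none, false) => Sum.inl (C.vert a)
    | Sum.inr (_, some false, false) => Sum.inl (C.vert (C.flip a))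
    | Sum.inr (_, some true, false) => Sum.inl (C.vert (C.flip b))
    | Sum.inr (X, _, true) => Sum.inr X
  half φ := match φ with
    | Sum.inl φ =>
        if C.half φ = a then
          (C.compOf (C.vert a) {a, b} (C.half (C.turn φ))).elim (Sum.inl (C.half φ))
            fun X => Sum.inr (X, some false, true)
        else if C.half φ = b then
          (C.compOf (C.vert a) {a, b} (C.half (C.turn φ))).elim (Sum.inl (C.half φ))
            fun X => Sum.inr (X, some true, true)
        else if C.half φ = C.flip a then
          (C.compOf (C.vert a) {a, b} (C.half (C.turn (C.across φ)))).elim (Sum.inl (C.half φ))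
            fun X => Sum.inr (X, some false, false)
        else if C.half φ = C.flip b then
          (C.compOf (C.vert a) {a, b} (C.half (C.turn (C.across φ)))).elim (Sum.inl (C.half φ))
            fun X => Sum.inr (X, some true, false)
        else Sum.inl (C.half φ)
    | Sum.inr (_, s, 0, false) => Sum.inl (cond s b a)
    | Sum.inr (_, s, 0, true) => Sum.inl (C.flip (cond s b a))
    | Sum.inr (X, _, 1, i) => Sum.inr (X, none, i)
    | Sum.inr (X, s, 2, i) => Sum.inr (X, some s, i)
  across φ := match φ with
    | Sum.inl φ => Sum.inl (C.across φ)
    | Sum.inr (X, s, j, i) => Sum.inr (X, s, j, !i)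
  across_across x := by rcases x with x | ⟨X, s, j, i⟩ <;> simp [C.across_across]
  half_across x := by
    have a₁ := C.flip_flip a
    have a₂ := C.flip_flip b
    have a₃ := C.flip_ne a
    have a₄ := C.flip_ne b
    have a₅ : C.flip a ≠ b := fun e => ha (by rw [e, hv])
    have a₆ : C.flip b ≠ a := fun e => hb (by rw [e, hv])
    have a₇ : C.flip a ≠ C.flip b := fun e => hab (by rw [← a₁, e, a₂])
    rcases x with x | ⟨X, s, j, i⟩
    · have k₁ := C.half_across x
      have k₂ := C.flip_flip (C.half x)
      have k₃ := C.across_across x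
      by_cases b₁ : C.half x = a
      · rw [b₁] at k₁
        simp only [k₁, b₁, a₃, a₅, if_true, if_false, k₃]
        cases C.compOf (C.vert a) {a, b} (C.half (C.turn x)) <;> rfl
      by_cases b₂ : C.half x = b
      · rw [b₂] at k₁
        simp only [k₁, b₂, a₄, a₆, a₇.symm, hab.symm, if_true, if_false, k₃]
        cases C.compOf (C.vert a) {a, b} (C.half (C.turn x)) <;> rfl
      by_cases b₃ : C.half x = C.flip a
      · rw [b₃, a₁] at k₁
        simp only [k₁, b₃, a₃, a₅, if_true, if_false]
        cases C.compOf (C.vert a) {a, b} (C.half (C.turn (C.across x))) <;> simp [a₁]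
      by_cases b₄ : C.half x = C.flip b
      · rw [b₄, a₂] at k₁
        simp only [k₁, b₄, a₄, a₆, a₇.symm, hab.symm, if_true, if_false]
        cases C.compOf (C.vert a) {a, b} (C.half (C.turn (C.across x))) <;> simp [a₂]
      have c₁ : C.flip (C.half x) ≠ a := by grind
      have c₂ : C.flip (C.half x) ≠ b := by grind
      have c₃ : C.flip (C.half x) ≠ C.flip a := by grind
      have c₄ : C.flip (C.half x) ≠ C.flip b := by grind
      simp only [k₁, b₁, b₂, b₃, b₄, c₁, c₂, c₃, c₄, if_false]
    · fin_cases j <;> rcases i with _ | _ <;> simp [C.flip_flip]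
  turn φ := match φ with
    | Sum.inl φ => Sum.inl (C.turn φ)
    | Sum.inr (X, s, x) => Sum.inr (X, s, triangleTurn x)
  turn_turn x := by
    have key : ∀ y, triangleTurn (triangleTurn y) = y := by decide
    rcases x with x | ⟨X, s, y⟩ <;> simp [C.turn_turn, key]
  turn_ne x := by
    have key : ∀ y, triangleTurn y ≠ y := by decide
    rcases x with x | ⟨X, s, y⟩ <;> simp [C.turn_ne, key]
  vert_turn x := by
    have a₃ : C.compOf (C.vert a) {a, b} a = none := C.compOf_eq_none (by simp)
    have a₄ : C.compOf (C.vert a) {a, b} b = none := C.compOf_eq_none (by simp)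
    have a₅ : C.compOf (C.vert a) {a, b} (C.flip a) = none := C.compOf_eq_none (Or.inl ha)
    have a₆ : C.compOf (C.vert a) {a, b} (C.flip b) = none :=
      C.compOf_eq_none (Or.inl (by rwa [← hv]))
    rcases x with x | ⟨X, s, j, i⟩
    · have hx := C.vert_turn x
      have ht := C.turn_turn x
      by_cases h₀ : C.vert (C.half x) = C.vert a
      · have h₀' := hx.trans h₀
        have n₁ : C.half x ≠ C.flip a := fun e => ha (by rw [← e, h₀])
        have n₂ : C.half x ≠ C.flip b := fun e => hb (by rw [← e, h₀, hv])
        have n₃ : C.half (C.turn x) ≠ C.flip a := fun e => ha (by rw [← e, h₀'])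
        have n₄ : C.half (C.turn x) ≠ C.flip b := fun e => hb (by rw [← e, h₀', hv])
        have hc := C.compOf_turn (v := C.vert a) (S := {a, b}) x
        by_cases b₁ : C.half x = a
        · by_cases c₁ : C.half (C.turn x) = a
          · simp [b₁, c₁, a₃, ht]
          by_cases c₂ : C.half (C.turn x) = b
          · simp [b₁, c₂, hab.symm, a₃, a₄, ht, hv]
          obtain ⟨X, hX⟩ := C.compOf_some (S := {a, b}) h₀' (by simp [c₁, c₂])
          simp [b₁, c₁, c₂, n₃, n₄, hX]
        by_cases b₂ : C.half x = b
        · by_cases c₁ : C.half (C.turn x) = a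
          · simp [b₂, c₁, hab.symm, a₃, a₄, ht, hv]
          by_cases c₂ : C.half (C.turn x) = b
          · simp [b₂, c₂, hab.symm, a₄, ht]
          obtain ⟨X, hX⟩ := C.compOf_some (S := {a, b}) h₀' (by simp [c₁, c₂])
          simp [b₂, c₁, c₂, n₃, n₄, hX, hab.symm]
        obtain ⟨X, hX⟩ := C.compOf_some (S := {a, b}) h₀ (by simp [b₁, b₂])
        by_cases c₁ : C.half (C.turn x) = a
        · simp [b₁, b₂, n₁, n₂, c₁, hX, ht]
        by_cases c₂ : C.half (C.turn x) = b
        · simp [b₁, b₂, n₁, n₂, c₂, hab.symm, hX, ht]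
        have hc' := hc (by simp [b₁, b₂]) (by simp [c₁, c₂])
        simp [b₁, b₂, n₁, n₂, n₃, n₄, c₁, c₂, hX, hc']
      · have key : ∀ φ : C.Flag, C.vert (C.half φ) ≠ C.vert a →
            (match (if C.half φ = a then
              (C.compOf (C.vert a) {a, b} (C.half (C.turn φ))).elim (Sum.inl (C.half φ))
                fun X => Sum.inr (X, some false, true)
            else if C.half φ = b then
              (C.compOf (C.vert a) {a, b} (C.half (C.turn φ))).elim (Sum.inl (C.half φ))
                fun X => Sum.inr (X, some true, true)
            else if C.half φ = C.flip a then
              (C.compOf (C.vert a) {a, b} (C.half (C.turn (C.across φ)))).elim (Sum.inl (C.half φ))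
                fun X => Sum.inr (X, some false, false)
            else if C.half φ = C.flip b then
              (C.compOf (C.vert a) {a, b} (C.half (C.turn (C.across φ)))).elim (Sum.inl (C.half φ))
                fun X => Sum.inr (X, some true, false)
            else Sum.inl (C.half φ) : C.Half ⊕
              (C.linkDel (C.vert a) {a, b}).ConnectedComponent × Option Bool × Bool) with
            | Sum.inl k => (C.compOf (C.vert a) {a, b} k).elim (Sum.inl (C.vert k)) Sum.inr
            | Sum.inr (_, none, false) => Sum.inl (C.vert a)
            | Sum.inr (_, some false, false) => Sum.inl (C.vert (C.flip a))
            | Sum.inr (_, some true, false) => Sum.inl (C.vert (C.flip b))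
            | Sum.inr (X, _, true) => Sum.inr X :
              C.V ⊕ (C.linkDel (C.vert a) {a, b}).ConnectedComponent)
              = Sum.inl (C.vert (C.half φ)) := by
          intro φ hφ
          have n₁ : C.half φ ≠ a := fun e => hφ (by rw [e])
          have n₂ : C.half φ ≠ b := fun e => hφ (by rw [e, hv])
          have n₃ := C.compOf_eq_none (S := {a, b}) (Or.inl hφ)
          by_cases b₁ : C.half φ = C.flip a
          · simp only [n₁, n₂, if_false]
            rw [b₁]
            cases C.compOf (C.vert a) {a, b} (C.half (C.turn (C.across φ))) <;> simp [a₅]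
          by_cases b₂ : C.half φ = C.flip b
          · simp only [n₁, n₂, b₁, if_false]
            rw [b₂]
            cases C.compOf (C.vert a) {a, b} (C.half (C.turn (C.across φ))) <;> simp [a₆]
          simp only [n₁, n₂, b₁, b₂, if_false, n₃, Option.elim_none]
        exact (key _ (by rwa [hx])).trans ((congrArg Sum.inl hx).trans (key _ h₀).symm)
    · fin_cases j <;> rcases i with _ | _ <;> rcases s with _ | _ <;>
        simp [triangleTurn, a₃, a₄, a₅, a₆, hv]
  trail x y hs he := by
    have k₂ := C.flip_ne a
    have k₃ := C.flip_ne b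
    have h₁ := FaceRel.eq_of
      (fun x : C.Flag ⊕ (C.linkDel (C.vert a) {a, b}).ConnectedComponent × Bool × Fin 3 × Bool =>
        match x with
        | Sum.inl x => Sum.inl (Quot.mk (C.SameFace) x)
        | Sum.inr (X, s, _, _) => Sum.inr (X, s)) (fun x => ?_) (fun x => ?_) hs
    · have key : ∀ φ : C.Flag, (match (if C.half φ = a then
              (C.compOf (C.vert a) {a, b} (C.half (C.turn φ))).elim (Sum.inl (C.half φ))
                fun X => Sum.inr (X, some false, true)
            else if C.half φ = b then
              (C.compOf (C.vert a) {a, b} (C.half (C.turn φ))).elim (Sum.inl (C.half φ))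
                fun X => Sum.inr (X, some true, true)
            else if C.half φ = C.flip a then
              (C.compOf (C.vert a) {a, b} (C.half (C.turn (C.across φ)))).elim (Sum.inl (C.half φ))
                fun X => Sum.inr (X, some false, false)
            else if C.half φ = C.flip b then
              (C.compOf (C.vert a) {a, b} (C.half (C.turn (C.across φ)))).elim (Sum.inl (C.half φ))
                fun X => Sum.inr (X, some true, false)
            else Sum.inl (C.half φ) : C.Half ⊕
              (C.linkDel (C.vert a) {a, b}).ConnectedComponent × Option Bool × Bool) with
          | Sum.inl k => k
          | Sum.inr (_, none, _) => a
          | Sum.inr (_, some s, true) => cond s b a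
          | Sum.inr (_, some s, false) => C.flip (cond s b a)) = C.half φ := by
        intro φ
        by_cases b₁ : C.half φ = a
        · simp only [b₁, if_true]
          cases C.compOf (C.vert a) {a, b} (C.half (C.turn φ)) <;> rfl
        by_cases b₂ : C.half φ = b
        · simp only [b₂, hab.symm, if_true, if_false]
          cases C.compOf (C.vert a) {a, b} (C.half (C.turn φ)) <;> rfl
        by_cases b₃ : C.half φ = C.flip a
        · simp only [b₁, b₂, if_false]
          rw [if_pos b₃, b₃]
          cases C.compOf (C.vert a) {a, b} (C.half (C.turn (C.across φ))) <;> rfl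
        by_cases b₄ : C.half φ = C.flip b
        · simp only [b₁, b₂, b₃, if_false]
          rw [if_pos b₄, b₄]
          cases C.compOf (C.vert a) {a, b} (C.half (C.turn (C.across φ))) <;> rfl
        simp only [b₁, b₂, b₃, b₄, if_false]
      rcases x with x | ⟨X, s, i, j⟩ <;> rcases y with y | ⟨Y, t, k, l⟩
      · have h₂ : C.half x = C.half y := by
          rw [← key x, ← key y]
          exact congrArg (fun k : C.Half ⊕
              (C.linkDel (C.vert a) {a, b}).ConnectedComponent × Option Bool × Bool => match k with
            | Sum.inl k => k
            | Sum.inr (_, none, _) => a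
            | Sum.inr (_, some s, true) => cond s b a
            | Sum.inr (_, some s, false) => C.flip (cond s b a)) he
        have h₃ : FaceRel C.across C.turn x y :=
          (Equivalence.eqvGen_iff (r := C.SameFace)
            ⟨FaceRel.refl, FaceRel.symm, FaceRel.trans⟩).1
            (Quot.eqvGen_exact (Sum.inl.inj h₁))
        rw [C.trail x y h₃ h₂]
      · simp at h₁
      · simp at h₁
      · obtain ⟨rfl, rfl⟩ := Prod.mk.inj (Sum.inr.inj h₁)
        rcases s with _ | _ <;> fin_cases i <;> fin_cases k <;> rcases j with _ | _ <;>
          rcases l with _ | _ <;> simp [k₂, k₂.symm, k₃, k₃.symm] at he ⊢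
    · rcases x with x | ⟨X, s, i, j⟩
      · exact congrArg Sum.inl (Quot.sound (FaceRel.left _).symm)
      · rfl
    · rcases x with x | ⟨X, s, i, j⟩
      · exact congrArg Sum.inl (Quot.sound (FaceRel.right _).symm)
      · rfl

/-! ### Stretching -/

/-- `D` arises from `C` by subdividing one edge, or one face by a new edge through it. -/
inductive ElementarySubdivision (C D : TwoComplex.{u}) : Prop
  | edge (h : C.Half) (iso : Nonempty (Iso (C.subdivideEdge h) D))
  | face (φ ψ : C.Flag) (arc : ∃ S, C.IsArc S φ ψ)
      (iso : Nonempty (Iso (C.subdivideFace φ ψ arc) D))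

/-- `D` arises from `C` by finitely many elementary subdivisions (possibly none). -/
def IsSubdivision (C D : TwoComplex.{u}) : Prop :=
  ∃ E, ReflTransGen ElementarySubdivision C E ∧ Nonempty (Iso E D)

/-- The non-loop `{h, flip h}` is reversible. -/
def IsReversible (h : C.Half) (hh : C.vert h ≠ C.vert (C.flip h)) : Prop :=
  C.HasPlanarRotationSystem ↔ (C.contract h hh).HasPlanarRotationSystem

/-- In every planar rotation system of the link graph at `vert h`, the edges `f₁` and `f₂` of the
link graph, which are incident with `h`, are adjacent in the rotator at `h`. -/
def AlwaysAdjacent (h : C.Half) (f₁ f₂ : C.Flag) (h₁ : C.half f₁ = h) (h₂ : C.half f₂ = h) : Prop :=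
  ∀ ρ : Equiv.Perm (C.LinkFlag (C.vert h)), C.IsPlanarLinkRotation (C.vert h) ρ →
    ρ ⟨f₁, congrArg C.vert h₁⟩ = ⟨f₂, congrArg C.vert h₂⟩ ∨
      ρ ⟨f₂, congrArg C.vert h₂⟩ = ⟨f₁, congrArg C.vert h₁⟩

/-- `D` arises from `C` by one stretching operation.

* `branch`: stretching a branch `X + e` of the connected link graph at `vert e` at its cut-vertex
  `e`.  The faces that have become longer may be subdivided after pre-stretching.  (For a
  simplicial complex `C`, cutting each new face of size four into two triangles by the diagonal
  from `v` makes `D` simplicial again.)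
* `separator`: stretching a 2-separator `{a, b}` of the 2-connected link graph at `vert a`.  (That
  `a` and `b` belong to non-loops is automatic in simplicial complexes.)
* `edge`: stretching an edge in the direction of two faces which have at `h` the flags `f₁`, `f₂`.
  The new face of size two, and the edges which bound it, may be subdivided after pre-stretching.
* `contraction`: contracting a reversible edge that is not a loop.
* `split`: splitting a vertex. -/
inductive StretchStep (C D : TwoComplex.{u}) : Prop
  | branch (e : C.Half) (X : (C.linkDel (C.vert e) {e}).ConnectedComponent)
      (connected : C.LinkConnected (C.vert e))
      (cutVertex : ¬ (C.linkDel (C.vert e) {e}).Connected)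
      (subdivision : IsSubdivision (C.preStretchBranch e X) D)
  | separator (a b : C.Half) (hab : a ≠ b) (hv : C.vert b = C.vert a)
      (ha : C.vert (C.flip a) ≠ C.vert a) (hb : C.vert (C.flip b) ≠ C.vert b)
      (twoConnected : C.LinkTwoConnected (C.vert a))
      (separates : ∃ X Y : (C.linkDel (C.vert a) {a, b}).ConnectedComponent, X ≠ Y)
      (iso : Nonempty (Iso (C.stretchPair a b hab hv ha hb) D))
  | edge (h : C.Half) (f₁ f₂ : C.Flag) (h₁ : C.half f₁ = h) (h₂ : C.half f₂ = h) (ne : f₁ ≠ f₂)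
      (adjacent : C.AlwaysAdjacent h f₁ f₂ h₁ h₂)
      (subdivision : IsSubdivision (C.preStretchEdge h f₁ f₂ h₁ h₂) D)
  | contraction (h : C.Half) (hh : C.vert h ≠ C.vert (C.flip h)) (reversible : C.IsReversible h hh)
      (iso : Nonempty (Iso (C.contract h hh) D))
  | split (v : C.V) (iso : Nonempty (Iso (C.splitVertex v) D))

/-- `D` is a stretching of `C`: it is obtained from `C` by finitely many stretching operations. -/
def IsStretching (C D : TwoComplex.{u}) : Prop := ReflTransGen StretchStep C D

end TwoComplex

/-!
The proof replaces the Euler characteristic in the definition of a planar rotation system by a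
criterion that is local and linear over the field with two elements.

Let `ρ` be a rotation system of a graph with edge-ends `D`, and let `β` exchange the two ends of
each edge; the facial walks are the cycles of `ρ ∘ β`.  Think of a function `s : D → ZMod 2` as a
function on the corners of the embedding, where `s x` belongs to the corner before `x`, so that
`s (ρ x) + s x` is its jump across the edge at `x`.  If the jumps at the two ends of every edge
agree, they form a cycle of the graph modulo two, and `s` records on which side of it each corner
lies.  The functions that are constant at vertices, or constant along facial walks, are of this kind
for trivial reasons, and counting dimensions (`isSpherical_iff_flat`) shows that the surface is a
union of spheres if and only if every such `s` is a sum `p + q` of a function `p` that is constant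
at vertices and a function `q` that is constant along facial walks.  This is `Flat`, a form of the
Jordan curve theorem.  In it the vertices of the 2-complex no longer appear: a complex has a planar
rotation system if and only if its flags have one that is flat (`PlanarFlags`,
`hasPlanarRotationSystem_iff`).  So splitting a vertex changes nothing, and contracting a reversible
edge is harmless by definition.

The other operations act on the disjoint union of all link graphs, in four ways.

* An edge of the complex is subdivided: a dipole is added to the link graphs.  Flatness of the dipole
  says that its two rotators are reverse to each other (`PlanarFlags.of_subdivide`).
* A face is subdivided: two edges of the link graphs are subdivided (`planarFlags_chord_iff`).
* Some link vertices are expanded to stars (`IsStar`), the leaves of a star being joined to the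
  edges that carry the corresponding label.  Contracting the star edges preserves planarity
  (`IsStar.planarFlags`).  Conversely a planar rotation system can be expanded if the edges with the
  same label form an interval of their rotator (`IsStar.planarFlags_star`).
* Bonds of the link graphs are cut (`IsBond`): the edges between the two sides end at two new
  vertices, one for each side.  Both directions preserve planarity if both sides of the bond are
  connected (`IsBond.planarFlags`, `IsBond.planarFlags_bond`): then the bond is crossed by one closed
  curve, which puts its edges in a cyclic order.

Stretching an edge is an expansion to stars with two labels, and stretching a branch cuts the bond
between the branch and its cut-vertex.  Stretching a 2-separator `{a, b}` expands `a` and `b`, and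
the other ends of these edges, and then cuts one bond for each component `X`, which consists of the
two star edges at `X`.  Here the interval condition is a theorem (`exists_interval`): if the edges
from `a` to `X` were interrupted twice in the rotator at `a`, a closed curve through `a` and `X`
would separate two edges at `a` that are joined by a path through `b` and the other components
(`eq_of_exit`).
-/

/-! ### A linear criterion for spherical rotation systems -/

section Criterion

variable {D : Type*}

/-- A rotation system `ρ` of the graph with the edge-ends `D` and the edges `{x, β x}` is flat if
every function `s` on the corners whose jump `s ∘ ρ + s` agrees at the two ends of each edge is the
sum of a function `p` of the vertices and a function `q` of the facial walks.  The corner of `x` is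
the one before `x` in the rotator.  In other words, the first cohomology mod 2 vanishes. -/
def Flat (ρ : Equiv.Perm D) (β : D → D) : Prop :=
  ∀ s : D → ZMod 2, (∀ x, s (ρ (β x)) + s (β x) = s (ρ x) + s x) →
    ∃ p q : D → ZMod 2, (∀ x, p (ρ x) = p x) ∧ (∀ x, q (ρ (β x)) = q x) ∧
      ∀ x, s x = p x + q x

/-- The functions that are constant on the classes of the equivalence relation generated by `r`. -/
def invariants (r : D → D → Prop) : Submodule (ZMod 2) (D → ZMod 2) where
  carrier := {g | ∀ x y, r x y → g x = g y}
  add_mem' h h' x y hr := by simp [h x y hr, h' x y hr]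
  zero_mem' _ _ _ := rfl
  smul_mem' c g h x y hr := by simp [h x y hr]

theorem finrank_invariants [Finite D] (r : D → D → Prop) :
    Module.finrank (ZMod 2) (invariants r) = Nat.card (Quot r) := by
  have : Finite (Quot r) := Quot.finite r
  have := Fintype.ofFinite (Quot r)
  let e : (Quot r → ZMod 2) ≃ₗ[ZMod 2] invariants r :=
    { toFun g := ⟨fun x => g (Quot.mk r x), fun x y h => congrArg g (Quot.sound h)⟩
      invFun g := Quot.lift g.1 g.2
      left_inv g := by ext x; induction x using Quot.ind; rfl
      right_inv g := rfl
      map_add' _ _ := rfl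
      map_smul' _ _ := rfl }
  rw [← e.finrank_eq, Module.finrank_fintype_fun_eq_card, Nat.card_eq_fintype_card]

/-- `s ↦ s ∘ α + s`. -/
def jump (α : D → D) : (D → ZMod 2) →ₗ[ZMod 2] (D → ZMod 2) :=
  LinearMap.funLeft (ZMod 2) (ZMod 2) α + LinearMap.id

theorem jump_apply (α : D → D) (s : D → ZMod 2) (x : D) : jump α s x = s (α x) + s x := rfl

theorem ZMod.two_add_eq_zero {a b : ZMod 2} : a + b = 0 ↔ a = b := by
  revert a b; decide

theorem ker_jump (α : D → D) : LinearMap.ker (jump α) = invariants fun x y => y = α x := by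
  ext s
  simp only [LinearMap.mem_ker, funext_iff, jump_apply, Pi.zero_apply, ZMod.two_add_eq_zero]
  exact ⟨fun h x y e => by rw [e, h], fun h x => (h x _ rfl).symm⟩

/-- Adjoint operators have the same rank. -/
theorem finrank_range_eq_of_adjoint [Fintype D] (S T : (D → ZMod 2) →ₗ[ZMod 2] (D → ZMod 2))
    (h : ∀ s t, ∑ x, S s x * t x = ∑ x, s x * T t x) :
    Module.finrank (ZMod 2) (LinearMap.range S) = Module.finrank (ZMod 2) (LinearMap.range T) := by
  classical
  have key : LinearMap.toMatrix' T = (LinearMap.toMatrix' S).transpose := by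
    ext i j
    have := h (Pi.single i 1) (Pi.single j 1)
    simpa [LinearMap.toMatrix'_apply, Pi.single_apply, eq_comm] using this.symm
  have h₁ := Matrix.rank_transpose (LinearMap.toMatrix' S)
  rw [← key] at h₁
  rw [Matrix.rank, Matrix.rank, ← Matrix.toLin'_apply', ← Matrix.toLin'_apply',
    Matrix.toLin'_toMatrix', Matrix.toLin'_toMatrix'] at h₁
  exact h₁.symm

theorem sum_jump_mul [Fintype D] (α : Equiv.Perm D) (s t : D → ZMod 2) :
    ∑ x, jump α s x * t x = ∑ x, s x * jump ⇑(α⁻¹) t x := by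
  simp only [jump_apply, add_mul, mul_add, Finset.sum_add_distrib]
  congr 1
  rw [← Equiv.sum_comp α fun x => s x * t (α⁻¹ x)]
  simp

/-- For a fixed-point free involution, every invariant function is a jump. -/
theorem range_jump_of_involutive [Finite D] {β : D → D} (hβ : ∀ x, β (β x) = x)
    (hne : ∀ x, β x ≠ x) : LinearMap.range (jump β) = invariants fun x y => y = β x := by
  classical
  ext g
  constructor
  · rintro ⟨s, rfl⟩ x y rfl
    rw [jump_apply, jump_apply, hβ, add_comm]
  · intro hg
    obtain ⟨n, ⟨e⟩⟩ := Finite.exists_equiv_fin D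
    -- the half of `g` that lives on the smaller end of each edge
    refine ⟨fun x => if e x < e (β x) then g x else 0, ?_⟩
    ext x
    have h₁ : e x ≠ e (β x) := fun h => hne x (e.injective h).symm
    have h₂ : g (β x) = g x := (hg x _ rfl).symm
    rw [jump_apply, hβ, h₂]
    rcases lt_or_gt_of_ne h₁ with h | h <;> simp [h, h.le.not_gt]

theorem finrank_map_add_finrank_inf_ker {V W : Type*} [AddCommGroup V] [Module (ZMod 2) V]
    [AddCommGroup W] [Module (ZMod 2) W] [Module.Finite (ZMod 2) V] (f : V →ₗ[ZMod 2] W)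
    (N : Submodule (ZMod 2) V) :
    Module.finrank (ZMod 2) (N.map f)
        + Module.finrank (ZMod 2) (N ⊓ LinearMap.ker f : Submodule _ _)
      = Module.finrank (ZMod 2) N := by
  rw [← LinearMap.finrank_range_add_finrank_ker (f.domRestrict N), LinearMap.range_domRestrict,
    LinearMap.ker_domRestrict, ← Submodule.finrank_map_subtype_eq N, Submodule.map_comap_subtype]

/-- The functions whose jumps agree at the two ends of each edge form the kernel of
`jump β ∘ₗ jump ρ`, and the dimension of this kernel is the number of edges plus the number of
components, since jumps along a permutation and its inverse are adjoint.  It contains the sum of the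
functions constant at vertices and the functions constant along facial walks, whose dimension is the
number of vertices plus the number of facial walks minus the number of components.  Euler's formula
says that the two dimensions agree. -/
theorem isSpherical_iff_flat [Finite D] (ρ : Equiv.Perm D) {β : D → D} (hβ : ∀ x, β (β x) = x)
    (hne : ∀ x, β x ≠ x) : IsSpherical ρ β ↔ Flat ρ β := by
  have := Fintype.ofFinite D
  let b : Equiv.Perm D := ⟨β, β, hβ, hβ⟩
  have hb : b⁻¹ = b := rfl
  set W := LinearMap.ker (jump β ∘ₗ jump ρ) with hW
  set U := invariants (fun x y => y = ρ x) ⊔ invariants (fun x y => y = ρ (β x)) with hU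
  have hinf : invariants (fun x y => y = ρ x) ⊓ invariants (fun x y => y = ρ (β x))
      = invariants fun x y => y = ρ x ∨ y = β x := by
    ext g
    constructor
    · rintro ⟨h₁, h₂⟩ x y (rfl | rfl)
      · exact h₁ _ _ rfl
      · exact (h₂ _ _ rfl).trans (h₁ _ _ rfl).symm
    · intro h
      refine ⟨fun x y e => h _ _ (Or.inl e), ?_⟩
      rintro x y rfl
      exact (h _ _ (Or.inr rfl)).trans (h _ _ (Or.inl rfl))
  have hinf' : invariants (fun x y => y = β x) ⊓ invariants (fun x y => y = ρ⁻¹ x)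
      = invariants fun x y => y = ρ x ∨ y = β x := by
    ext g
    constructor
    · rintro ⟨h₁, h₂⟩ x y (rfl | rfl)
      · exact (h₂ (ρ x) _ (by simp)).symm
      · exact h₁ _ _ rfl
    · intro h
      refine ⟨fun x y e => h _ _ (Or.inr e), ?_⟩
      rintro x y rfl
      exact (h _ _ (Or.inl (by simp))).symm
  have hUW : U ≤ W := by
    refine sup_le (fun g hg => ?_) fun g hg => ?_
    · have : jump ρ g = 0 := by
        rw [← LinearMap.mem_ker, ker_jump]; exact hg
      simp [hW, this]
    · ext x
      have h₁ := hg x _ rfl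
      have h₂ := hg (β x) _ rfl
      rw [hβ] at h₂
      simp only [LinearMap.comp_apply, jump_apply, Pi.zero_apply]
      rw [← h₁, ← h₂, ZMod.two_add_eq_zero, add_comm]
  have hflat : Flat ρ β ↔ W ≤ U := by
    constructor
    · intro h s hs
      have hs' : ∀ x, s (ρ (β x)) + s (β x) = s (ρ x) + s x := fun x =>
        ZMod.two_add_eq_zero.1 (congrFun hs x)
      obtain ⟨p, q, hp, hq, e⟩ := h s hs'
      refine Submodule.mem_sup.2 ⟨p, ?_, q, ?_, (funext e).symm⟩
      · rintro x y rfl; exact (hp x).symm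
      · rintro x y rfl; exact (hq x).symm
    · intro h s hs
      have hs' : s ∈ W := by
        ext x
        exact ZMod.two_add_eq_zero.2 (hs x)
      obtain ⟨p, hp, q, hq, e⟩ := Submodule.mem_sup.1 (h hs')
      exact ⟨p, q, fun x => (hp x _ rfl).symm, fun x => (hq x _ rfl).symm,
        fun x => (congrFun e x).symm⟩
  have d₁ := LinearMap.finrank_range_add_finrank_ker (jump β)
  rw [range_jump_of_involutive hβ hne, ker_jump] at d₁
  have d₂ := LinearMap.finrank_range_add_finrank_ker (jump β ∘ₗ jump ρ)
  rw [finrank_range_eq_of_adjoint _ (jump ⇑(ρ⁻¹) ∘ₗ jump β) fun s t => by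
    have h₁ := sum_jump_mul b (jump ρ s) t
    rw [hb] at h₁
    exact h₁.trans (sum_jump_mul ρ s (jump b t)), LinearMap.range_comp,
    range_jump_of_involutive hβ hne] at d₂
  have d₃ := finrank_map_add_finrank_inf_ker (jump ⇑(ρ⁻¹)) (invariants fun x y => y = β x)
  rw [ker_jump, hinf'] at d₃
  have d₄ := Submodule.finrank_sup_add_finrank_inf_eq (invariants fun x y => y = ρ x)
    (invariants fun x y => y = ρ (β x))
  rw [hinf] at d₄
  simp only [finrank_invariants] at d₁ d₃ d₄
  have d₅ : W ≤ U ↔ Module.finrank (ZMod 2) U = Module.finrank (ZMod 2) W :=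
    ⟨fun h => by rw [le_antisymm h hUW], fun h => (Submodule.eq_of_le_of_finrank_eq hUW h).ge⟩
  rw [hflat, d₅, IsSpherical]
  rw [← hU] at d₄
  rw [← hW] at d₂
  omega

end Criterion

/-! ### Planarity in terms of flags -/

section PlanarFlags

variable {D H : Type*}

/-- Flatness may be checked on each block of a partition into unions of components. -/
theorem Flat.of_blocks {S : Type*} {ρ : Equiv.Perm D} {β : D → D} (c : D → S)
    (hρ : ∀ x, c (ρ x) = c x) (hβ : ∀ x, c (β x) = c x)
    (h : ∀ s : D → ZMod 2, (∀ x, s (ρ (β x)) + s (β x) = s (ρ x) + s x) → ∀ i,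
      ∃ p q : D → ZMod 2, (∀ x, c x = i → p (ρ x) = p x) ∧
        (∀ x, c x = i → q (ρ (β x)) = q x) ∧ ∀ x, c x = i → s x = p x + q x) :
    Flat ρ β := by
  intro s hs
  choose p q hp hq hs using h s hs
  refine ⟨fun x => p (c x) x, fun x => q (c x) x, fun x => ?_, fun x => ?_, fun x => hs _ x rfl⟩
  · simp only [hρ]; exact hp _ x rfl
  · simp only [hρ, hβ]; exact hq _ x rfl

/-- Let `half` send each flag to its half-edge, let `J` go to the other end of the traversed edge,
and let `β` go to the adjacent edge of the face.  There is a rotation system, reversed by `J`, which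
is flat. -/
def PlanarFlags (half : D → H) (J β : D → D) : Prop :=
  ∃ ρ : Equiv.Perm D, (∀ x y, ρ.SameCycle x y ↔ half x = half y) ∧
    (∀ x, ρ (J x) = J (ρ⁻¹ x)) ∧ Flat ρ β

theorem Flat.conj {D' : Type*} {ρ : Equiv.Perm D} {β : D → D} (h : Flat ρ β) (e : D ≃ D')
    {β' : D' → D'} (hβ : ∀ x, e (β x) = β' (e x)) : Flat (e.permCongr ρ) β' := by
  intro s hs
  have hβ' : ∀ y, e.symm (β' y) = β (e.symm y) := fun y => by
    rw [Equiv.symm_apply_eq, hβ, e.apply_symm_apply]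
  obtain ⟨p, q, hp, hq, hpq⟩ := h (s ∘ e) fun x => by
    have := hs (e x)
    simpa [hβ', ← hβ] using this
  refine ⟨p ∘ e.symm, q ∘ e.symm, fun x => ?_, fun x => ?_, fun x => ?_⟩
  · simpa using hp (e.symm x)
  · simpa [hβ'] using hq (e.symm x)
  · simpa using hpq (e.symm x)

theorem PlanarFlags.conj {D' H' : Type*} {half : D → H} {J β : D → D} {half' : D' → H'}
    {J' β' : D' → D'} (h : PlanarFlags half J β) (e : D ≃ D')
    (hhalf : ∀ x y, half' (e x) = half' (e y) ↔ half x = half y)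
    (hJ : ∀ x, e (J x) = J' (e x)) (hβ : ∀ x, e (β x) = β' (e x)) :
    PlanarFlags half' J' β' := by
  obtain ⟨ρ, h₁, h₂, h₃⟩ := h
  refine ⟨e.permCongr ρ, fun x y => ?_, fun x => ?_, h₃.conj e hβ⟩
  · have h₄ : (e.permCongr ρ).SameCycle x y ↔ ρ.SameCycle (e.symm x) (e.symm y) := by
      have h₅ : ∀ n : ℤ, (e.permCongr ρ) ^ n = e.permCongr (ρ ^ n) := fun n =>
        (map_zpow e.permCongrHom ρ n).symm
      simp [Equiv.Perm.SameCycle, h₅, Equiv.eq_symm_apply]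
    rw [h₄, h₁, ← hhalf, e.apply_symm_apply, e.apply_symm_apply]
  · have h₆ : (e.permCongr ρ)⁻¹ = e.permCongr ρ⁻¹ := rfl
    obtain ⟨x, rfl⟩ := e.surjective x
    simp only [h₆, Equiv.permCongr_apply, e.symm_apply_apply]
    rw [← hJ, e.symm_apply_apply, h₂, hJ]

theorem PlanarFlags.conj_iff {D' H' : Type*} {half : D → H} {J β : D → D} {half' : D' → H'}
    {J' β' : D' → D'} (e : D ≃ D')
    (hhalf : ∀ x y, half' (e x) = half' (e y) ↔ half x = half y)
    (hJ : ∀ x, e (J x) = J' (e x)) (hβ : ∀ x, e (β x) = β' (e x)) :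
    PlanarFlags half J β ↔ PlanarFlags half' J' β' :=
  ⟨fun h => h.conj e hhalf hJ hβ, fun h => h.conj e.symm (fun x y => by simp [← hhalf])
    (fun x => by rw [Equiv.symm_apply_eq, hJ, e.apply_symm_apply])
    (fun x => by rw [Equiv.symm_apply_eq, hβ, e.apply_symm_apply])⟩

end PlanarFlags

namespace TwoComplex

variable (C : TwoComplex.{u})

instance (v : C.V) : Finite (C.LinkFlag v) := Subtype.finite

theorem isSpherical_atVertex_iff {ρ : Equiv.Perm C.Flag} (hρ : C.IsRotationSystem ρ) (v : C.V) :
    IsSpherical (hρ.atVertex v) (C.linkTurn v) ↔ Flat (hρ.atVertex v) (C.linkTurn v) :=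
  isSpherical_iff_flat _ (fun x => Subtype.ext (C.turn_turn x.1))
    fun x h => C.turn_ne x.1 (congrArg Subtype.val h)

theorem flat_iff_atVertex {ρ : Equiv.Perm C.Flag} (hρ : C.IsRotationSystem ρ) :
    Flat ρ C.turn ↔ ∀ v, Flat (hρ.atVertex v) (C.linkTurn v) := by
  classical
  have hc : ∀ x, C.vert (C.half (ρ x)) = C.vert (C.half x) := fun x => by rw [hρ.half_apply]
  constructor
  · intro h v s hs
    obtain ⟨p, q, hp, hq, hpq⟩ := h
      (fun x => if hx : C.vert (C.half x) = v then s ⟨x, hx⟩ else 0) fun x => by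
        by_cases hx : C.vert (C.half x) = v
        · simp only [hc, C.vert_turn, hx, dite_true]
          exact hs ⟨x, hx⟩
        · simp only [hc, C.vert_turn, hx, dite_false]
    refine ⟨fun x => p x.1, fun x => q x.1, fun x => hp x.1, fun x => hq x.1, fun x => ?_⟩
    rw [← hpq x.1, dif_pos x.2]
    rfl
  · intro h
    refine Flat.of_blocks (fun x => C.vert (C.half x)) hc C.vert_turn fun s hs v => ?_
    obtain ⟨p, q, hp, hq, hpq⟩ := h v (fun x => s x.1) fun x => hs x.1
    refine ⟨fun x => if hx : C.vert (C.half x) = v then p ⟨x, hx⟩ else 0,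
      fun x => if hx : C.vert (C.half x) = v then q ⟨x, hx⟩ else 0,
      fun x hx => ?_, fun x hx => ?_, fun x hx => ?_⟩
    · simp only [hc, hx, dite_true]; exact hp ⟨x, hx⟩
    · simp only [hc, C.vert_turn, hx, dite_true]; exact hq ⟨x, hx⟩
    · simp only [hx, dite_true]; exact hpq ⟨x, hx⟩

/-- Planarity of all link graphs does not refer to the vertices of the complex. -/
theorem hasPlanarRotationSystem_iff :
    C.HasPlanarRotationSystem ↔ PlanarFlags C.half C.across C.turn := by
  constructor
  · rintro ⟨ρ, hρ, h⟩
    exact ⟨ρ, hρ.sameCycle, hρ.reverse,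
      (C.flat_iff_atVertex hρ).2 fun v => (C.isSpherical_atVertex_iff hρ v).1 (h v)⟩
  · rintro ⟨ρ, h₁, h₂, h₃⟩
    have hρ : C.IsRotationSystem ρ := ⟨h₁, h₂⟩
    exact ⟨ρ, hρ, fun v => (C.isSpherical_atVertex_iff hρ v).2
      ((C.flat_iff_atVertex hρ).1 h₃ v)⟩

theorem isPlanarLinkRotation_atVertex {ρ : Equiv.Perm C.Flag} (hρ : C.IsRotationSystem ρ)
    (h : Flat ρ C.turn) (v : C.V) : C.IsPlanarLinkRotation v (hρ.atVertex v) where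
  sameCycle x y := by
    rw [← hρ.sameCycle]
    exact Equiv.Perm.sameCycle_subtypePerm
  planar := (C.isSpherical_atVertex_iff hρ v).2 ((C.flat_iff_atVertex hρ).1 h v)

variable {C} in
theorem Iso.hasPlanarRotationSystem_iff {D : TwoComplex.{u}} (i : Iso C D) :
    C.HasPlanarRotationSystem ↔ D.HasPlanarRotationSystem := by
  rw [TwoComplex.hasPlanarRotationSystem_iff, TwoComplex.hasPlanarRotationSystem_iff]
  refine PlanarFlags.conj_iff i.onFlag (fun x y => ?_) i.across i.turn
  rw [← i.half, ← i.half, i.onHalf.injective.eq_iff]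

theorem hasPlanarRotationSystem_splitVertex (v : C.V) :
    C.HasPlanarRotationSystem ↔ (C.splitVertex v).HasPlanarRotationSystem := by
  rw [hasPlanarRotationSystem_iff, hasPlanarRotationSystem_iff]
  rfl

end TwoComplex

/-! ### Permutations: invariant functions, jumps and first returns -/

section Perm

variable {D H : Type*}

theorem eq_of_sameCycle {α : Type*} {ρ : Equiv.Perm D} {g : D → α} (hg : ∀ x, g (ρ x) = g x)
    {x y : D} (h : ρ.SameCycle x y) : g x = g y := by
  obtain ⟨n, rfl⟩ := h
  have key : ∀ (n : ℕ) x, g ((ρ ^ n) x) = g x := fun n => by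
    induction n with
    | zero => simp
    | succ n ih => intro x; rw [pow_succ', Equiv.Perm.mul_apply, hg, ih]
  cases n with
  | ofNat n => exact (key n x).symm
  | negSucc n =>
    rw [zpow_negSucc]
    have h := key (n + 1) ((ρ ^ (n + 1))⁻¹ x)
    rwa [show (ρ ^ (n + 1)) ((ρ ^ (n + 1))⁻¹ x) = x from Equiv.apply_symm_apply _ _] at h

theorem apply_eq_of_sameCycle_iff {ρ : Equiv.Perm D} {half : D → H}
    (h : ∀ x y, ρ.SameCycle x y ↔ half x = half y) (x : D) : half (ρ x) = half x :=
  (h _ _).1 (Equiv.Perm.sameCycle_apply_left.2 (Equiv.Perm.SameCycle.refl _ _))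

theorem sameCycle_iff_of_invariant {ρ : Equiv.Perm D} {half : D → H}
    (hρ : ∀ x, half (ρ x) = half x)
    (h : ∀ g : D → Prop, (∀ x, g (ρ x) = g x) → ∀ x y, half x = half y → g x = g y) (x y : D) :
    ρ.SameCycle x y ↔ half x = half y := by
  refine ⟨eq_of_sameCycle hρ, fun e => ?_⟩
  rw [← h (fun z => ρ.SameCycle x z) (fun z => by simp) x y e]

/-- Along a cycle, a function cannot change at just one place. -/
theorem apply_eq_of_forall_ne [Finite D] {α : Type*} {ρ : Equiv.Perm D} {g : D → α} {t : D}
    (hg : ∀ x, x ≠ t → g (ρ x) = g x) : g (ρ t) = g t := by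
  have key : ∀ n : ℕ, g ((ρ ^ n) (ρ t)) = g (ρ t) := fun n => by
    induction n with
    | zero => simp
    | succ n ih =>
      rw [pow_succ', Equiv.Perm.mul_apply]
      by_cases h : (ρ ^ n) (ρ t) = t
      · rw [h]
      · rw [hg _ h, ih]
  have h : (ρ ^ (orderOf ρ - 1)) (ρ t) = t := by
    rw [← Equiv.Perm.mul_apply, ← pow_succ, Nat.sub_add_cancel (orderOf_pos ρ), pow_orderOf_eq_one,
      Equiv.Perm.one_apply]
  rw [← key (orderOf ρ - 1), h]

/-- A subspace that contains the sum of the indicators of any two points of the same class contains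
every function whose sum over each class vanishes. -/
theorem mem_of_sum_eq_zero [Fintype D] [DecidableEq D] (half : D → H)
    (M : Submodule (ZMod 2) (D → ZMod 2))
    (hM : ∀ x y, half x = half y → Pi.single x 1 + Pi.single y 1 ∈ M) {u : D → ZMod 2}
    (hu : ∀ g : H → ZMod 2, ∑ x, g (half x) * u x = 0) : u ∈ M := by
  classical
  let r : D → D := fun x => (Quotient.mk (Setoid.ker half) x).out
  have hr : ∀ x, half (r x) = half x := fun x => Quotient.mk_out (s := Setoid.ker half) x
  have hr' : ∀ x y, half x = half y → r x = r y := fun x y h =>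
    congrArg Quotient.out (Quotient.sound (s := Setoid.ker half) h)
  have h₁ : u = ∑ x, u x • (Pi.single x 1 + Pi.single (r x) 1 : D → ZMod 2) := by
    ext w
    have h₂ := hu fun h => if ∃ y, half y = h ∧ r y = w then 1 else 0
    have h₃ : ∀ x, (∃ y, half y = half x ∧ r y = w) ↔ w = r x := fun x =>
      ⟨fun ⟨y, h, e⟩ => by rw [← e, hr' _ _ h], fun e => ⟨x, rfl, e.symm⟩⟩
    simp only [h₃, ite_mul, one_mul, zero_mul] at h₂
    simp [Finset.sum_apply, Finset.sum_add_distrib, Pi.single_apply, h₂]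
  rw [h₁]
  exact Submodule.sum_mem _ fun x _ => Submodule.smul_mem _ _ (hM _ _ (hr x).symm)

theorem sum_mul_jump_eq_zero [Fintype D] {ρ : Equiv.Perm D} {half : D → H}
    (hρ : ∀ x, half (ρ x) = half x) (s : D → ZMod 2) (g : H → ZMod 2) :
    ∑ x, g (half x) * (s (ρ x) + s x) = 0 := by
  simp only [mul_add, Finset.sum_add_distrib]
  rw [ZMod.two_add_eq_zero, ← Equiv.sum_comp ρ fun x => g (half x) * s x]
  simp [hρ]

/-- A function is a jump if its sum over each cycle vanishes. -/
theorem exists_jump_eq [Fintype D] {ρ : Equiv.Perm D} {half : D → H}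
    (hρ : ∀ x y, ρ.SameCycle x y ↔ half x = half y) {u : D → ZMod 2}
    (hu : ∀ g : H → ZMod 2, ∑ x, g (half x) * u x = 0) :
    ∃ s : D → ZMod 2, ∀ x, s (ρ x) + s x = u x := by
  classical
  suffices h : u ∈ LinearMap.range (jump ρ) by
    obtain ⟨s, rfl⟩ := h
    exact ⟨s, fun _ => rfl⟩
  refine mem_of_sum_eq_zero half _ (fun x y h => ?_) hu
  obtain ⟨n, -, rfl⟩ := ((hρ x y).2 h).exists_pow_eq'
  clear h
  induction n with
  | zero =>
    convert! Submodule.zero_mem _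
    ext w
    simp [ZMod.two_add_eq_zero]
  | succ n ih =>
    have h₁ : (Pi.single ((ρ ^ n) x) 1 + Pi.single ((ρ ^ (n + 1)) x) 1 : D → ZMod 2)
        ∈ LinearMap.range (jump ρ) := by
      refine ⟨Pi.single ((ρ ^ (n + 1)) x) 1, ?_⟩
      ext w
      rw [pow_succ', Equiv.Perm.mul_apply]
      simp [jump_apply, Pi.single_apply]
    convert! Submodule.add_mem _ ih h₁ using 1
    ext w
    generalize (Pi.single ((ρ ^ n) x) 1 : D → ZMod 2) = c
    have : c w + c w = 0 := ZMod.two_add_eq_zero.2 rfl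
    simp only [Pi.add_apply]
    linear_combination -this

/-- The equivalence generated by passing to a flag at the same half-edge, and by passing to the
other end of a link edge in `P`. -/
def LinkReach (half : D → H) (β : D → D) (P : D → Prop) : D → D → Prop :=
  EqvGen fun x y => half x = half y ∨ (P x ∧ y = β x)

theorem LinkReach.of_half {half : D → H} {β : D → D} {P : D → Prop} {x y : D}
    (h : half x = half y) : LinkReach half β P x y := EqvGen.rel _ _ (Or.inl h)

theorem LinkReach.edge {half : D → H} {β : D → D} {P : D → Prop} {x : D}
    (h : P x) : LinkReach half β P x (β x) := EqvGen.rel _ _ (Or.inr ⟨h, rfl⟩)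

theorem LinkReach.symm {half : D → H} {β : D → D} {P : D → Prop} {x y : D}
    (h : LinkReach half β P x y) : LinkReach half β P y x := EqvGen.symm _ _ h

theorem LinkReach.trans {half : D → H} {β : D → D} {P : D → Prop} {x y z : D}
    (h : LinkReach half β P x y) (h' : LinkReach half β P y z) : LinkReach half β P x z :=
  EqvGen.trans _ _ _ h h'

theorem LinkReach.apply_eq {α : Type*} {half : D → H} {β : D → D} {P : D → Prop} {g : D → α}
    (h₁ : ∀ x y, half x = half y → g x = g y) (h₂ : ∀ x, P x → g (β x) = g x) {x y : D}
    (h : LinkReach half β P x y) : g x = g y := by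
  induction h with
  | rel x y h =>
    rcases h with h | ⟨h, rfl⟩
    exacts [h₁ _ _ h, (h₂ _ h).symm]
  | refl x => rfl
  | symm x y _ ih => exact ih.symm
  | trans x y z _ _ ih ih' => exact ih.trans ih'

/-- The edges of a path from `x` to `y`, as a function on the edge-ends. -/
theorem LinkReach.exists_path [Fintype D] {half : D → H} {β : D → D} {P : D → Prop}
    (hβ : ∀ x, β (β x) = x) (hP : ∀ x, P x → P (β x)) {x y : D}
    (h : LinkReach half β P x y) : ∃ u : D → ZMod 2, (∀ w, u (β w) = u w) ∧
      (∀ w, ¬ P w → u w = 0) ∧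
      ∀ g : H → ZMod 2, ∑ w, g (half w) * u w = g (half x) + g (half y) := by
  classical
  induction h with
  | rel x y h =>
    rcases h with h | ⟨h, rfl⟩
    · exact ⟨0, fun _ => rfl, fun _ _ => rfl, fun g => by
        simp [h, (ZMod.two_add_eq_zero (a := g (half y))).2 rfl]⟩
    · refine ⟨Pi.single x 1 + Pi.single (β x) 1, fun w => ?_, fun w hw => ?_, fun g => ?_⟩
      · have h₁ : β w = x ↔ w = β x := ⟨fun e => by rw [← e, hβ], fun e => by rw [e, hβ]⟩
        have h₂ : β w = β x ↔ w = x := ⟨fun e => by rw [← hβ w, e, hβ], fun e => by rw [e]⟩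
        simp only [Pi.add_apply, Pi.single_apply, h₁, h₂]
        exact add_comm _ _
      · have h₁ : w ≠ x := fun e => hw (e ▸ h)
        have h₂ : w ≠ β x := fun e => hw (e ▸ hP _ h)
        simp [h₁, h₂]
      · simp [mul_add, Finset.sum_add_distrib, Pi.single_apply]
  | refl x =>
    exact ⟨0, fun _ => rfl, fun _ _ => rfl, fun g => by
        simp [(ZMod.two_add_eq_zero (a := g (half x))).2 rfl]⟩
  | symm x y _ ih =>
    obtain ⟨u, h₁, h₂, h₃⟩ := ih
    exact ⟨u, h₁, h₂, fun g => (h₃ g).trans (add_comm _ _)⟩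
  | trans x y z _ _ ih ih' =>
    obtain ⟨u, h₁, h₂, h₃⟩ := ih
    obtain ⟨u', h₁', h₂', h₃'⟩ := ih'
    refine ⟨u + u', fun w => by simp [h₁, h₁'], fun w hw => by simp [h₂ w hw, h₂' w hw],
      fun g => ?_⟩
    simp only [Pi.add_apply, mul_add, Finset.sum_add_distrib, h₃, h₃']
    have := (ZMod.two_add_eq_zero (a := g (half y))).2 rfl
    linear_combination this

variable {D' : Type*}

/-- Applying `π` repeatedly to `y`, starting with `y` itself, the first point in the range of `i`
is `i x`. -/
inductive Hits (π : Equiv.Perm D') (i : D → D') : D' → D → Prop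
  | here (x : D) : Hits π i (i x) x
  | step {y : D'} {x : D} (hy : ∀ z, y ≠ i z) (h : Hits π i (π y) x) : Hits π i y x

theorem Hits.unique {π : Equiv.Perm D'} {i : D → D'} (hi : Function.Injective i) {y : D'}
    {x z : D} (h : Hits π i y x) (h' : Hits π i y z) : x = z := by
  induction h with
  | here x =>
    generalize hy : i x = y at h'
    cases h' with
    | here => exact hi hy
    | step h₁ => exact (h₁ _ hy.symm).elim
  | step h₁ _ ih =>
    cases h' with
    | here => exact (h₁ _ rfl).elim
    | step _ h₂ => exact ih h₂

/-- The permutation `ρ` arises from `π` by leaving out the points that are not in the range of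
`i`. -/
def IsFirstReturn (π : Equiv.Perm D') (i : D → D') (ρ : Equiv.Perm D) : Prop :=
  ∀ x, Hits π i (π (i x)) (ρ x)

theorem exists_isFirstReturn [Finite D'] (π : Equiv.Perm D') {i : D → D'}
    (hi : Function.Injective i) : ∃ ρ, IsFirstReturn π i ρ := by
  have hfin : Finite D := Finite.of_injective i hi
  have h₀ : ∀ x, (π ^ (orderOf π - 1)) (π (i x)) = i x := fun x => by
    rw [← Equiv.Perm.mul_apply, ← pow_succ, Nat.sub_add_cancel (orderOf_pos π),
      pow_orderOf_eq_one, Equiv.Perm.one_apply]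
  have h₁ : ∀ (n : ℕ) y x, (π ^ n) y = i x → ∃ z, Hits π i y z := fun n => by
    induction n with
    | zero => intro y x h; exact ⟨x, by rw [show y = i x from h]; exact Hits.here x⟩
    | succ n ih =>
      intro y x h
      by_cases hy : ∃ z, y = i z
      · obtain ⟨z, rfl⟩ := hy; exact ⟨z, Hits.here z⟩
      · rw [pow_succ, Equiv.Perm.mul_apply] at h
        obtain ⟨z, hz⟩ := ih _ _ h
        exact ⟨z, Hits.step (fun z e => hy ⟨z, e⟩) hz⟩
  choose r hr using fun x => h₁ _ _ _ (h₀ x)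
  have h₂ : ∀ (n : ℕ) x z, Hits π i ((π ^ n) (π (i x))) z → ∃ w, Hits π i (π (i w)) z := fun n => by
    induction n with
    | zero => exact fun x z h => ⟨x, h⟩
    | succ n ih =>
      intro x z h
      by_cases hy : ∃ w, (π ^ n) (π (i x)) = i w
      · obtain ⟨w, hw⟩ := hy
        rw [pow_succ', Equiv.Perm.mul_apply, hw] at h
        exact ⟨w, h⟩
      · rw [pow_succ', Equiv.Perm.mul_apply] at h
        exact ih x z (Hits.step (fun w e => hy ⟨w, e⟩) h)
  have hsurj : Function.Surjective r := fun z => by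
    obtain ⟨w, hw⟩ := h₂ _ z z (by rw [h₀]; exact Hits.here z)
    exact ⟨w, (hr w).unique hi hw⟩
  exact ⟨Equiv.ofBijective r (Finite.surjective_iff_bijective.1 hsurj), hr⟩

theorem Hits.apply_eq {α : Type*} {π : Equiv.Perm D'} {i : D → D'} {g : D' → α}
    (hg : ∀ y, (∀ z, y ≠ i z) → g (π y) = g y) {y : D'} {x : D} (h : Hits π i y x) :
    g y = g (i x) := by
  induction h with
  | here => rfl
  | step hy _ ih => rw [← ih, hg _ hy]

theorem Hits.sameCycle {π : Equiv.Perm D'} {i : D → D'} {y : D'} {x : D} (h : Hits π i y x) :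
    π.SameCycle y (i x) := by
  induction h with
  | here => exact Equiv.Perm.SameCycle.refl _ _
  | step _ _ ih => exact (Equiv.Perm.sameCycle_apply_left).1 ih

theorem IsFirstReturn.sameCycle_iff [Finite D'] {π : Equiv.Perm D'} {i : D → D'}
    (hi : Function.Injective i) {ρ : Equiv.Perm D} (hρ : IsFirstReturn π i ρ) (x z : D) :
    ρ.SameCycle x z ↔ π.SameCycle (i x) (i z) := by
  constructor
  · intro h
    have := eq_of_sameCycle (ρ := ρ) (g := fun w => π.SameCycle (i x) (i w)) (fun w => ?_) h
    · exact this ▸ Equiv.Perm.SameCycle.refl _ _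
    · refine propext ⟨fun h => ?_, fun h => ?_⟩
      · exact (Equiv.Perm.sameCycle_apply_right).1 (h.trans (hρ w).sameCycle.symm)
      · exact ((Equiv.Perm.sameCycle_apply_right).2 h).trans (hρ w).sameCycle
  · intro h
    have key : ∀ (n : ℕ) y x, Hits π i y x → (π ^ n) y = i z → ρ.SameCycle x z := fun n => by
      induction n with
      | zero =>
        intro y x h e
        have e' : y = i z := e
        subst e'
        rw [h.unique hi (Hits.here z)]
      | succ n ih =>
        intro y x h e
        rw [pow_succ, Equiv.Perm.mul_apply] at e
        cases h with
        | here => exact (Equiv.Perm.sameCycle_apply_left).1 (ih _ _ (hρ x) e)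
        | step _ h => exact ih _ _ h e
    obtain ⟨n, -, e⟩ := h.exists_pow_eq'
    exact key n _ _ (Hits.here x) e

/-- A function on the range of `i` extends so that it is constant along `π` outside this range. -/
theorem exists_extension {α : Type*} [Nonempty α] (π : Equiv.Perm D') {i : D → D'}
    (hi : Function.Injective i) (s : D → α) :
    ∃ s' : D' → α, (∀ x, s' (i x) = s x) ∧ ∀ y, (∀ z, y ≠ i z) → s' (π y) = s' y := by
  classical
  let F : (D → Prop) → α := fun R => if h : ∃ x, R x then s h.choose else Classical.arbitrary α
  refine ⟨fun y => F (Hits π i y), fun x => ?_, fun y hy => ?_⟩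
  · have h : ∃ z, Hits π i (i x) z := ⟨x, Hits.here x⟩
    simp only [F, dif_pos h]
    rw [h.choose_spec.unique hi (Hits.here x)]
  · refine congrArg F (funext fun x => propext ⟨fun h => Hits.step hy h, fun h => ?_⟩)
    cases h with
    | here => exact (hy _ rfl).elim
    | step _ h => exact h

/-- A first return is reversed by `J` if the original permutation is reversed by an extension of
`J`. -/
theorem IsFirstReturn.reverse {π : Equiv.Perm D'} {i : D → D'}
    (hi : Function.Injective i) {ρ : Equiv.Perm D} (hρ : IsFirstReturn π i ρ) {J : D → D}
    {J' : D' → D'} (hJ : ∀ x, J' (i x) = i (J x)) (hJ' : ∀ y, (∀ z, y ≠ i z) → ∀ z, J' y ≠ i z)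
    (hπ : ∀ y, π (J' (π y)) = J' y) (x : D) : ρ (J (ρ x)) = J x := by
  have key : ∀ {y z w}, Hits π i y z → Hits π i (π (J' y)) w → Hits π i (π (J' (i z))) w := by
    intro y z w h h'
    induction h with
    | here => exact h'
    | step hy _ ih =>
      refine ih ?_
      rw [hπ]
      exact Hits.step (hJ' _ hy) h'
  have h := key (hρ x) (w := J x) (by rw [hπ, hJ]; exact Hits.here _)
  rw [hJ] at h
  exact (hρ _).unique hi h

end Perm

/-! ### Expanding link vertices into stars -/

section Star

variable {D H H' ι : Type*}

/-- The flags labelled `i`, which lie at the link vertex `base i`, are moved to a new link vertex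
`leaf i`, and a new edge joins `leaf i` to what remains of `base i`, which is now called
`centre (base i)`.  The new edge has the ends `(false, i)` at the leaf and `(true, i)` at the
centre. -/
def starHalf (half : D → H) (lab : D → Option ι) (base : ι → H) (leaf : ι → H')
    (centre : H → H') : D ⊕ Bool × ι → H'
  | Sum.inl x => (lab x).elim (centre (half x)) leaf
  | Sum.inr (false, i) => leaf i
  | Sum.inr (true, i) => centre (base i)

/-- The link vertex before the expansion. -/
def starOrigin (half : D → H) (base : ι → H) : D ⊕ Bool × ι → H
  | Sum.inl x => half x
  | Sum.inr (_, i) => base i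

/-- The map `J` extended to the new flags by means of `τ`. -/
def starAcross (J : D → D) (τ : ι → ι) : D ⊕ Bool × ι → D ⊕ Bool × ι
  | Sum.inl x => Sum.inl (J x)
  | Sum.inr (c, i) => Sum.inr (c, τ i)

/-- The map `β` extended by exchanging the two ends of every new edge. -/
def starTurn (β : D → D) : D ⊕ Bool × ι → D ⊕ Bool × ι
  | Sum.inl x => Sum.inl (β x)
  | Sum.inr (c, i) => Sum.inr (!c, i)

/-- The permutation that exchanges the ends of every new edge and fixes the old flags. -/
def starFlip : Equiv.Perm (D ⊕ Bool × ι) :=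
  Function.Involutive.toPerm (starTurn id) fun x => by rcases x with x | ⟨c, i⟩ <;> simp [starTurn]

theorem starFlip_inl (x : D) : (starFlip (Sum.inl x) : D ⊕ Bool × ι) = Sum.inl x := rfl

theorem starFlip_inr (c : Bool) (i : ι) :
    (starFlip (Sum.inr (c, i)) : D ⊕ Bool × ι) = Sum.inr (!c, i) := rfl

theorem starFlip_starFlip (x : D ⊕ Bool × ι) : starFlip (starFlip x) = x := by
  rcases x with x | ⟨c, i⟩ <;> simp [starFlip_inl, starFlip_inr]

/-- Apply `ρ` after passing to the other end of a new edge. -/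
def starReturn (ρ : Equiv.Perm (D ⊕ Bool × ι)) : Equiv.Perm (D ⊕ Bool × ι) := starFlip.trans ρ

theorem starReturn_apply (ρ : Equiv.Perm (D ⊕ Bool × ι)) (x : D ⊕ Bool × ι) :
    starReturn ρ x = ρ (starFlip x) := rfl

theorem starFlip_starAcross (J : D → D) (τ : ι → ι) (x : D ⊕ Bool × ι) :
    starFlip (starAcross J τ x) = starAcross J τ (starFlip x) := by
  rcases x with x | ⟨c, i⟩ <;> rfl

/-- The properties of the labelling `lab` and of the names `leaf` and `centre` that make
`starHalf` the expansion described there. -/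
structure IsStar (half : D → H) (lab : D → Option ι) (base : ι → H) (leaf : ι → H')
    (centre : H → H') : Prop where
  half_eq : ∀ x i, lab x = some i → half x = base i
  exists_lab : ∀ i, ∃ x, lab x = some i
  leaf_injective : Function.Injective leaf
  centre_injective : Function.Injective centre
  leaf_ne : ∀ i h, leaf i ≠ centre h

variable {half : D → H} {lab : D → Option ι} {base : ι → H} {leaf : ι → H'} {centre : H → H'}

theorem IsStar.origin_eq (hs : IsStar half lab base leaf centre) {x y : D ⊕ Bool × ι}
    (h : starHalf half lab base leaf centre x = starHalf half lab base leaf centre y) :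
    starOrigin half base x = starOrigin half base y := by
  have key : ∀ x, (∃ i, starHalf half lab base leaf centre x = leaf i ∧
      starOrigin half base x = base i) ∨
      starHalf half lab base leaf centre x = centre (starOrigin half base x) := by
    rintro (x | ⟨_ | _, i⟩)
    · cases hx : lab x with
      | none => exact Or.inr (by simp [starHalf, starOrigin, hx])
      | some i => exact Or.inl ⟨i, by simp [starHalf, hx], hs.half_eq x i hx⟩
    · exact Or.inl ⟨i, rfl, rfl⟩
    · exact Or.inr rfl
  rcases key x with ⟨i, h₁, h₂⟩ | h₁ <;> rcases key y with ⟨j, h₃, h₄⟩ | h₃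
  · rw [h₂, h₄, hs.leaf_injective (h₁.symm.trans (h.trans h₃))]
  · exact (hs.leaf_ne _ _ (h₁.symm.trans (h.trans h₃))).elim
  · exact (hs.leaf_ne _ _ (h₃.symm.trans (h.symm.trans h₁))).elim
  · exact hs.centre_injective (h₁.symm.trans (h.trans h₃))

theorem starOrigin_starFlip (x : D ⊕ Bool × ι) :
    starOrigin half base (starFlip x) = starOrigin half base x := by
  rcases x with x | ⟨c, i⟩ <;> rfl

/-- Contracting the new edges does not change flatness. -/
theorem IsStar.flat_iff (hs : IsStar half lab base leaf centre) {ρ : Equiv.Perm D}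
    {ρ' : Equiv.Perm (D ⊕ Bool × ι)} {β : D → D} (hρ : ∀ x y, ρ.SameCycle x y ↔ half x = half y)
    (hρ' : ∀ x y, ρ'.SameCycle x y ↔
      starHalf half lab base leaf centre x = starHalf half lab base leaf centre y)
    (hret : IsFirstReturn (starReturn ρ') Sum.inl ρ) : Flat ρ β ↔ Flat ρ' (starTurn β) := by
  have hπ : ∀ x, ρ' x = (starReturn ρ') (starFlip x) := fun x => by
    rw [starReturn_apply, starFlip_starFlip]
  have hR : ∀ g : D ⊕ Bool × ι → ZMod 2, (∀ y, g ((starReturn ρ') (Sum.inr y)) = g (Sum.inr y)) →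
      ∀ x, g (ρ' (Sum.inl x)) = g (Sum.inl (ρ x)) := fun g hg x => by
    refine Hits.apply_eq (fun y hy => ?_) (hret x)
    rcases y with y | y
    exacts [(hy y rfl).elim, hg y]
  have hO : ∀ x, starOrigin half base (ρ' x) = starOrigin half base x := fun x =>
    hs.origin_eq (apply_eq_of_sameCycle_iff hρ' x)
  constructor
  · intro h s hW
    -- after adding the function `δ` of the leaves, `s` no longer jumps at the new edges
    let δ : ι → ZMod 2 := fun i => s (ρ' (Sum.inr (false, i))) + s (Sum.inr (true, i))
    have hδ : ∀ i, δ i = s (ρ' (Sum.inr (true, i))) + s (Sum.inr (false, i)) := fun i => by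
      have h₁ : s (ρ' (Sum.inr (true, i))) + s (Sum.inr (true, i))
          = s (ρ' (Sum.inr (false, i))) + s (Sum.inr (false, i)) := hW (Sum.inr (false, i))
      have h₂ := (ZMod.two_add_eq_zero (a := s (Sum.inr (false, i)))).2 rfl
      have h₃ := (ZMod.two_add_eq_zero (a := s (Sum.inr (true, i)))).2 rfl
      simp only [δ]
      linear_combination -h₁ - h₂ + h₃
    have hδ₀ : ∃ d : H' → ZMod 2, (∀ i, d (leaf i) = δ i) ∧ ∀ h, d (centre h) = 0 := by
      refine ⟨Function.extend leaf δ 0, fun i => hs.leaf_injective.extend_apply _ _ _, fun h => ?_⟩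
      exact Function.extend_apply' _ _ _ fun ⟨i, hi⟩ => hs.leaf_ne _ _ hi
    obtain ⟨d, hd₁, hd₂⟩ := hδ₀
    let c := fun x => d (starHalf half lab base leaf centre x)
    have hc : ∀ x, c (ρ' x) = c x := fun x => congrArg d (apply_eq_of_sameCycle_iff hρ' x)
    have hcf : ∀ i, c (Sum.inr (false, i)) = δ i := hd₁
    have hct : ∀ i, c (Sum.inr (true, i)) = 0 := fun i => hd₂ _
    let s₁ := fun x => s x + c x
    have h₁ : ∀ y, s₁ ((starReturn ρ') (Sum.inr y)) = s₁ (Sum.inr y) := by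
      rintro ⟨_ | _, i⟩
      · simp only [starReturn_apply, starFlip_inr, Bool.not_false, s₁, hc, hcf, hct, hδ]
        have := (ZMod.two_add_eq_zero (a := s (Sum.inr (false, i)))).2 rfl
        linear_combination -this
      · simp only [starReturn_apply, starFlip_inr, Bool.not_true, s₁, hc, hcf, hct, δ]
        have := (ZMod.two_add_eq_zero (a := s (ρ' (Sum.inr (false, i))))).2 rfl
        linear_combination this
    have h₂ := hR s₁ h₁
    have h₃ : ∀ x, s₁ (ρ' (starTurn β x)) + s₁ (starTurn β x) = s₁ (ρ' x) + s₁ x := fun x => by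
      have h₄ := (ZMod.two_add_eq_zero (a := c (starTurn β x))).2 rfl
      have h₅ := (ZMod.two_add_eq_zero (a := c x)).2 rfl
      simp only [s₁, hc]
      linear_combination hW x + h₄ - h₅
    obtain ⟨p, q, hp, hq, hpq⟩ := h (fun x => s₁ (Sum.inl x)) fun x => by
      rw [← h₂, ← h₂]; exact h₃ (Sum.inl x)
    -- `p` extends to the new flags as a function of the old link vertices
    have hfac : Function.FactorsThrough p half := fun x y e => eq_of_sameCycle hp ((hρ x y).2 e)
    let p₁ : D ⊕ Bool × ι → ZMod 2 := fun x => Function.extend half p 0 (starOrigin half base x)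
    have hp₁ : ∀ x, p₁ (ρ' x) = p₁ x := fun x => by simp only [p₁, hO]
    have hp₂ : ∀ x, p₁ (Sum.inl x) = p x := fun x => hfac.extend_apply 0 x
    have hp₃ : ∀ x, p₁ (starFlip x) = p₁ x := fun x => by simp only [p₁, starOrigin_starFlip]
    refine ⟨fun x => p₁ x + c x, fun x => s₁ x + p₁ x, fun x => by simp only [hp₁, hc],
      fun x => ?_,
      fun x => ?_⟩
    · rcases x with x | y
      · have h₆ := hR (fun x => s₁ x + p₁ x) (fun y => by
          rw [h₁, starReturn_apply, hp₁, hp₃]) (β x)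
        simp only [starTurn]
        rw [h₆, hp₂, hp₂, hpq, hpq, hp]
        have h₇ := hq x
        have h₈ := (ZMod.two_add_eq_zero (a := p (β x))).2 rfl
        have h₉ := (ZMod.two_add_eq_zero (a := p x)).2 rfl
        linear_combination h₇ + h₈ - h₉
      · have h₆ : starTurn β (Sum.inr y) = starFlip (Sum.inr y) := rfl
        simp only [h₆, hp₁, hp₃, ← h₁ y, starReturn_apply]
    · have h₄ := (ZMod.two_add_eq_zero (a := c x)).2 rfl
      have h₅ := (ZMod.two_add_eq_zero (a := p₁ x)).2 rfl
      simp only [s₁]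
      linear_combination -h₄ - h₅
  · intro h s hW
    obtain ⟨s₁, h₁, h₂⟩ := exists_extension (starReturn ρ') (Sum.inl_injective (β := Bool × ι)) s
    have h₂' : ∀ y, s₁ ((starReturn ρ') (Sum.inr y)) = s₁ (Sum.inr y) := fun y =>
      h₂ _ fun z e => by cases e
    have h₃ := hR s₁ h₂'
    obtain ⟨p, q, hp, hq, hpq⟩ := h s₁ fun x => by
      rcases x with x | y
      · simp only [starTurn, h₃, h₁]; exact hW x
      · have h₄ : starTurn β (Sum.inr y) = starFlip (Sum.inr y) := rfl
        have h₅ := h₂' y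
        have h₆ := h₂' (!y.1, y.2)
        have h₇ : starFlip (Sum.inr y) = (Sum.inr (!y.1, y.2) : D ⊕ Bool × ι) := rfl
        rw [starReturn_apply, starFlip_inr, Bool.not_not] at h₆
        rw [starReturn_apply] at h₅
        rw [h₄, h₅, h₇, h₆, add_comm]
    have hq₁ : ∀ y, q ((starReturn ρ') (Sum.inr y)) = q (Sum.inr y) := fun y => hq (Sum.inr y)
    have hp₁ : ∀ y, p ((starReturn ρ') (Sum.inr y)) = p (Sum.inr y) := fun y => by
      have h₄ := h₂' y
      rw [hpq, hpq, hq₁] at h₄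
      exact add_right_cancel h₄
    refine ⟨fun x => p (Sum.inl x), fun x => q (Sum.inl x), fun x => ?_, fun x => ?_, fun x => ?_⟩
    · beta_reduce; rw [← hR p hp₁, hp]
    · beta_reduce; rw [← hR q hq₁]; exact hq (Sum.inl x)
    · rw [← h₁, hpq]

variable {J β : D → D} {τ : ι → ι}

/-- Contracting the new edges turns a planar rotation system into a planar rotation system. -/
theorem IsStar.planarFlags [Finite D] [Finite ι] (hs : IsStar half lab base leaf centre)
    (h : PlanarFlags (starHalf half lab base leaf centre) (starAcross J τ) (starTurn β)) :
    PlanarFlags half J β := by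
  obtain ⟨ρ', h₁, h₂, h₃⟩ := h
  obtain ⟨ρ, hρ⟩ := exists_isFirstReturn (starReturn ρ') (Sum.inl_injective (β := Bool × ι))
  have hπ : ∀ x, ρ' x = (starReturn ρ') (starFlip x) := fun x => by
    rw [starReturn_apply, starFlip_starFlip]
  have hO : ∀ x, starOrigin half base (ρ' x) = starOrigin half base x := fun x =>
    hs.origin_eq (apply_eq_of_sameCycle_iff h₁ x)
  have hcyc : ∀ x y, ρ.SameCycle x y ↔ half x = half y := fun x y => by
    rw [hρ.sameCycle_iff Sum.inl_injective]
    constructor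
    · exact eq_of_sameCycle (g := starOrigin half base) fun x => by
        rw [starReturn_apply, hO, starOrigin_starFlip]
    · intro e
      let g := fun z => (starReturn ρ').SameCycle (Sum.inl x) z
      have hg : ∀ z, g ((starReturn ρ') z) = g z := fun z => by
        exact propext Equiv.Perm.sameCycle_apply_right
      have hg₁ : ∀ z, g (ρ' z) = g (starFlip z) := fun z => by rw [hπ, hg]
      -- along the cycle of a leaf, `g` could change only at the new flag
      have hg₂ : ∀ i, g (Sum.inr (true, i)) = g (Sum.inr (false, i)) := fun i => by
        have h₄ := apply_eq_of_forall_ne (ρ := ρ') (t := Sum.inr (false, i))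
          (g := fun z => starHalf half lab base leaf centre z = leaf i ∧ g z) fun z hz => by
            simp only [apply_eq_of_sameCycle_iff h₁, hg₁]
            by_cases h₅ : starHalf half lab base leaf centre z = leaf i
            · rcases z with z | ⟨_ | _, j⟩
              · rfl
              · exact (hz (by rw [hs.leaf_injective h₅])).elim
              · exact (hs.leaf_ne _ _ h₅.symm).elim
            · simp only [h₅, false_and]
        simp only [apply_eq_of_sameCycle_iff h₁, hg₁] at h₄
        simpa [starHalf, starFlip_inr] using h₄
      have hg₃ : ∀ z, g (ρ' z) = g z := fun z => by
        rw [hg₁]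
        rcases z with z | ⟨_ | _, i⟩
        exacts [rfl, hg₂ i, (hg₂ i).symm]
      have hg₄ : ∀ z, ∃ w, starHalf half lab base leaf centre w = centre (half z) ∧
          g w = g (Sum.inl z) := fun z => by
        cases hz : lab z with
        | none => exact ⟨Sum.inl z, by simp [starHalf, hz], rfl⟩
        | some i =>
          refine ⟨Sum.inr (true, i), by rw [hs.half_eq z i hz]; rfl, (hg₂ i).trans ?_⟩
          exact eq_of_sameCycle hg₃ ((h₁ _ _).2 (by simp [starHalf, hz]))
      obtain ⟨w, hw, hw'⟩ := hg₄ x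
      obtain ⟨w₁, hw₁, hw₁'⟩ := hg₄ y
      have h₅ : g (Sum.inl x) = g (Sum.inl y) := by
        rw [← hw', ← hw₁']
        exact eq_of_sameCycle hg₃ ((h₁ _ _).2 (by rw [hw, hw₁, e]))
      exact h₅.mp (Equiv.Perm.SameCycle.refl _ _)
  refine ⟨ρ, hcyc, fun x => ?_, (hs.flat_iff hcyc h₁ hρ).2 h₃⟩
  have h₄ := hρ.reverse Sum.inl_injective (J := J)
    (J' := fun y => starAcross J τ (starFlip y)) (fun x => rfl) (fun y hy z => by
      rcases y with y | ⟨c, i⟩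
      · exact (hy y rfl).elim
      · simp [starFlip_inr, starAcross]) (fun y => by
      have h₅ := h₂ (ρ' (starFlip y))
      rw [show ρ'⁻¹ (ρ' (starFlip y)) = starFlip y from Equiv.symm_apply_apply _ _] at h₅
      rw [starReturn_apply, starReturn_apply, starFlip_starAcross, starFlip_starFlip, h₅])
    (ρ⁻¹ x)
  rwa [show ρ (ρ⁻¹ x) = x from Equiv.apply_symm_apply _ _] at h₄

end Star

section Star

variable {D H H' ι : Type*} {half : D → H} {lab : D → Option ι} {base : ι → H} {leaf : ι → H'}
  {centre : H → H'} {J β : D → D} {τ : ι → ι}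

open Classical in
/-- The permutation that exchanges `γ i` with the new flag `(c, i)`. -/
noncomputable def starSwap (γ : ι → D) (hγ : Function.Injective γ) (c : Bool) :
    Equiv.Perm (D ⊕ Bool × ι) :=
  Function.Involutive.toPerm (fun x => match x with
    | Sum.inl x => if h : ∃ i, γ i = x then Sum.inr (c, h.choose) else Sum.inl x
    | Sum.inr (d, i) => if d = c then Sum.inl (γ i) else Sum.inr (d, i)) fun x => by
      have key : ∀ i (h : ∃ j, γ j = γ i), h.choose = i := fun i h => hγ h.choose_spec
      rcases x with x | ⟨d, i⟩
      · by_cases h : ∃ i, γ i = x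
        · obtain ⟨i, rfl⟩ := h
          simp [key]
        · simp [h]
      · by_cases h : d = c
        · simp [h, key]
        · simp [h]

theorem starSwap_apply {γ : ι → D} (hγ : Function.Injective γ) (c : Bool) (i : ι) :
    starSwap γ hγ c (Sum.inl (γ i)) = Sum.inr (c, i) := by
  have h : ∃ j, γ j = γ i := ⟨i, rfl⟩
  exact (dif_pos h).trans (by rw [hγ h.choose_spec])

theorem starSwap_inl {γ : ι → D} (hγ : Function.Injective γ) (c : Bool) {x : D}
    (h : ∀ i, x ≠ γ i) : starSwap γ hγ c (Sum.inl x) = Sum.inl x :=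
  dif_neg fun ⟨i, hi⟩ => h i hi.symm

theorem starSwap_inr {γ : ι → D} (hγ : Function.Injective γ) (c : Bool) (i : ι) :
    starSwap γ hγ c (Sum.inr (c, i)) = Sum.inl (γ i) := if_pos rfl

theorem starSwap_inr_not {γ : ι → D} (hγ : Function.Injective γ) (c : Bool) (i : ι) :
    starSwap γ hγ c (Sum.inr (!c, i)) = Sum.inr (!c, i) := if_neg (by simp)

theorem starSwap_starSwap {γ : ι → D} (hγ : Function.Injective γ) (c : Bool)
    (x : D ⊕ Bool × ι) : starSwap γ hγ c (starSwap γ hγ c x) = x :=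
  Function.Involutive.toPerm_involutive _ x

theorem starAcross_starSwap {γ δ : ι → D} (hγ : Function.Injective γ) (hδ : Function.Injective δ)
    (c : Bool) (hJ : ∀ x, J (J x) = x) (hτ : ∀ i, τ (τ i) = i) (hJγ : ∀ i, J (γ i) = δ (τ i))
    (x : D ⊕ Bool × ι) : starAcross J τ (starSwap γ hγ c x)
      = starFlip (starSwap δ hδ (!c) (starFlip (starAcross J τ x))) := by
  have hJδ : ∀ i, J (δ i) = γ (τ i) := fun i => by rw [← hτ i, ← hJγ, hJ, hτ]
  rcases x with x | ⟨d, i⟩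
  · by_cases h : ∃ i, x = γ i
    · obtain ⟨i, rfl⟩ := h
      simp only [starSwap_apply, starAcross, starFlip_inl, hJγ, starFlip_inr, Bool.not_not]
    · have h₁ : ∀ i, x ≠ γ i := fun i e => h ⟨i, e⟩
      have h₂ : ∀ i, J x ≠ δ i := fun i e => h ⟨τ i, by rw [← hJδ, ← e, hJ]⟩
      simp only [starSwap_inl _ _ h₁, starAcross, starFlip_inl, starSwap_inl _ _ h₂]
  · by_cases h : d = c
    · subst h
      simp only [starSwap_inr, starAcross, starFlip_inr, hJγ, starFlip_inl]
    · obtain rfl : d = !c := by revert h; cases d <;> cases c <;> simp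
      rw [starSwap_inr_not]
      simp only [starAcross, starFlip_inr, Bool.not_not]
      have := starSwap_inr_not hδ (!c) (τ i)
      rw [Bool.not_not] at this
      rw [this, starFlip_inr]

/-- If the flags with label `i` always form an interval of the rotator, from `α i` to `ω i`, then
the expansion has a planar rotation system, too. -/
theorem IsStar.planarFlags_star (hs : IsStar half lab base leaf centre)
    (hJ : ∀ x, J (J x) = x) (hτ : ∀ i, τ (τ i) = i) {ρ : Equiv.Perm D}
    (h₁ : ∀ x y, ρ.SameCycle x y ↔ half x = half y) (h₂ : ∀ x, ρ (J x) = J (ρ⁻¹ x))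
    (h₃ : Flat ρ β) {α ω : ι → D} (hα : ∀ i, lab (α i) = some i) (hω : ∀ i, lab (ω i) = some i)
    (hJα : ∀ i, J (α i) = ω (τ i))
    (hnext : ∀ x i, lab x = some i → x = ω i ∨ (lab (ρ x) = some i ∧ ρ x ≠ α i))
    (hprev : ∀ x i, lab (ρ x) = some i → ρ x = α i ∨ (lab x = some i ∧ x ≠ ω i)) :
    PlanarFlags (starHalf half lab base leaf centre) (starAcross J τ) (starTurn β) := by
  have hJω : ∀ i, J (ω i) = α (τ i) := fun i => by rw [← hτ i, ← hJα, hJ, hτ]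
  have hαi : Function.Injective α := fun i j e => Option.some.inj (by rw [← hα, e, hα])
  have hωi : Function.Injective ω := fun i j e => Option.some.inj (by rw [← hω, e, hω])
  set A := starSwap α hαi true with hA
  set B := starSwap ω hωi false with hB
  let R : Equiv.Perm (D ⊕ Bool × ι) := Equiv.sumCongr ρ (Equiv.refl _)
  let ρ' : Equiv.Perm (D ⊕ Bool × ι) := ((starFlip.trans B).trans R).trans A
  have hρ' : ∀ x, ρ' x = A (R (B (starFlip x))) := fun x => rfl
  have hR₁ : ∀ x, R (Sum.inl x) = Sum.inl (ρ x) := fun x => rfl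
  have hR₂ : ∀ y, R (Sum.inr y) = Sum.inr y := fun x => rfl
  have hBf : ∀ i, B (Sum.inr (false, i)) = Sum.inl (ω i) := fun i => starSwap_inr _ _ _
  have hBt : ∀ i, B (Sum.inr (true, i)) = Sum.inr (true, i) := fun i => starSwap_inr_not _ false _
  have hAt : ∀ i, A (Sum.inr (true, i)) = Sum.inl (α i) := fun i => starSwap_inr _ _ _
  have hAf : ∀ i, A (Sum.inr (false, i)) = Sum.inr (false, i) := fun i => starSwap_inr_not _ true _
  -- the effect of the new rotation system
  have e₁ : ∀ i, ρ' (Sum.inr (false, i)) = Sum.inl (α i) := fun i => by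
    rw [hρ', starFlip_inr, Bool.not_false, hBt, hR₂, hAt]
  have e₂ : ∀ i, ρ' (Sum.inr (true, i)) = A (Sum.inl (ρ (ω i))) := fun i => by
    rw [hρ', starFlip_inr, Bool.not_true, hBf, hR₁]
  have e₃ : ∀ i, ρ' (Sum.inl (ω i)) = Sum.inr (false, i) := fun i => by
    rw [hρ', starFlip_inl, hB, starSwap_apply, hR₂, hAf]
  have e₄ : ∀ x, (∀ i, x ≠ ω i) → ρ' (Sum.inl x) = A (Sum.inl (ρ x)) := fun x hx => by
    rw [hρ', starFlip_inl, hB, starSwap_inl _ _ hx, hR₁]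
  have eA : ∀ i, A (Sum.inl (α i)) = Sum.inr (true, i) := fun i => starSwap_apply _ _ _
  have eA' : ∀ x, (∀ i, x ≠ α i) → A (Sum.inl x) = Sum.inl x := fun x hx => starSwap_inl _ _ hx
  have hhalf : ∀ x, half (ρ x) = half x := apply_eq_of_sameCycle_iff h₁
  have hbase : ∀ x i, lab x = some i → half x = base i := hs.half_eq
  -- the target of `A` is as expected, if it is in the remaining part of the rotator
  have hcen : ∀ x, (lab x = none ∨ ∃ i, x = ω i) →
      (∃ i, ρ x = α i ∧ A (Sum.inl (ρ x)) = Sum.inr (true, i)) ∨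
      (lab (ρ x) = none ∧ A (Sum.inl (ρ x)) = Sum.inl (ρ x)) := fun x hx => by
    cases hl : lab (ρ x) with
    | none =>
      exact Or.inr ⟨rfl, eA' _ fun i e => by rw [e, hα] at hl; cases hl⟩
    | some i =>
      rcases hprev x i hl with e | ⟨h, hne⟩
      · exact Or.inl ⟨i, e, by rw [e, eA]⟩
      · rcases hx with hx | ⟨j, rfl⟩
        · rw [hx] at h; cases h
        · rw [hω] at h; cases h; exact (hne rfl).elim
  have hinv : ∀ x, starHalf half lab base leaf centre (ρ' x)
      = starHalf half lab base leaf centre x := by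
    have hA' : ∀ x, (lab x = none ∨ ∃ i, x = ω i) →
        starHalf half lab base leaf centre (A (Sum.inl (ρ x))) = centre (half x) := fun x hx => by
      rcases hcen x hx with ⟨i, h, h'⟩ | ⟨h, h'⟩
      · rw [h', ← hhalf, h, hbase _ _ (hα i)]; rfl
      · rw [h', ← hhalf]; simp [starHalf, h]
    rintro (x | ⟨_ | _, i⟩)
    · by_cases hx : ∃ i, x = ω i
      · obtain ⟨i, rfl⟩ := hx
        rw [e₃]; simp [starHalf, hω]
      · rw [e₄ x fun i e => hx ⟨i, e⟩]
        cases hl : lab x with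
        | none => rw [hA' x (Or.inl hl)]; simp [starHalf, hl]
        | some i =>
          rcases hnext x i hl with e | ⟨h, hne⟩
          · exact (hx ⟨i, e⟩).elim
          · rw [eA' _ fun j e => by
              have h' := h
              rw [e, hα] at h'; cases h'; exact hne e]
            simp [starHalf, h, hl]
    · rw [e₁]; simp [starHalf, hα]
    · rw [e₂, hA' _ (Or.inr ⟨i, rfl⟩), hbase _ _ (hω i)]; rfl
  have hcyc : ∀ x y, ρ'.SameCycle x y ↔
      starHalf half lab base leaf centre x = starHalf half lab base leaf centre y := by
    refine sameCycle_iff_of_invariant hinv fun g hg => ?_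
    have gω : ∀ i, g (Sum.inr (false, i)) = g (Sum.inl (ω i)) := fun i => by rw [← e₃, hg]
    have gα : ∀ i, g (Sum.inl (α i)) = g (Sum.inl (ω i)) := fun i => by rw [← gω, ← e₁, hg]
    have hleaf : ∀ x i, lab x = some i → g (Sum.inl x) = g (Sum.inl (ω i)) := fun x i hx => by
      classical
      have key := eq_of_sameCycle (ρ := ρ)
        (g := fun y => if lab y = some i then g (Sum.inl y) else g (Sum.inl (ω i))) (fun y => ?_)
        ((h₁ x (ω i)).2 (by rw [hbase x i hx, hbase _ i (hω i)]))
      · simpa [hx, hω] using key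
      · by_cases hy : lab y = some i
        · by_cases hyω : y = ω i
          · subst hyω
            simp only [hω, if_true]
            by_cases h : lab (ρ (ω i)) = some i
            · rcases hprev _ _ h with e | ⟨_, hne⟩
              · simp only [h, if_true]; rw [e, gα]
              · exact (hne rfl).elim
            · simp only [h, if_false]
          · rcases hnext y i hy with e | ⟨h, hne⟩
            · exact (hyω e).elim
            · simp only [hy, h, if_true]
              rw [← hg (Sum.inl y), e₄ y fun j e => ?_, eA' _ fun j e => ?_]
              · have h' := h
                rw [e, hα] at h'; cases h'; exact hne e
              · have h' := hy
                rw [e, hω] at h'; cases h'; exact hyω e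
        · simp only [hy, if_false]
          by_cases h : lab (ρ y) = some i
          · rcases hprev _ _ h with e | ⟨h', _⟩
            · simp only [h, if_true]; rw [e, gα]
            · exact (hy h').elim
          · simp only [h, if_false]
    let gc : D → Prop := fun y => (lab y).elim (g (Sum.inl y)) fun i => g (Sum.inr (true, i))
    have gc_none : ∀ y, lab y = none → gc y = g (Sum.inl y) := fun y h => by simp [gc, h]
    have gc_some : ∀ y i, lab y = some i → gc y = g (Sum.inr (true, i)) := fun y i h => by
      simp [gc, h]
    have gc_next : ∀ x, (lab x = none ∨ ∃ i, x = ω i) → gc (ρ x) = g (A (Sum.inl (ρ x))) :=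
      fun x hx => by
        rcases hcen x hx with ⟨i, h, h'⟩ | ⟨h, h'⟩
        · rw [h', gc_some _ i (by rw [h, hα])]
        · rw [h', gc_none _ h]
    have hgc : ∀ y, gc (ρ y) = gc y := fun y => by
      cases hy : lab y with
      | none =>
        rw [gc_next y (Or.inl hy), gc_none y hy, ← hg (Sum.inl y), e₄ y fun j e => ?_]
        rw [e, hω] at hy; cases hy
      | some i =>
        rcases hnext y i hy with rfl | ⟨h, -⟩
        · rw [gc_next _ (Or.inr ⟨i, rfl⟩), gc_some _ i hy, ← e₂, hg]
        · rw [gc_some _ i h, gc_some _ i hy]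
    have key : ∀ x, (∃ i, starHalf half lab base leaf centre x = leaf i ∧ g x = g (Sum.inl (ω i))) ∨
        ∃ d, starHalf half lab base leaf centre x = centre (half d) ∧ g x = gc d := by
      rintro (x | ⟨_ | _, i⟩)
      · cases hx : lab x with
        | none => exact Or.inr ⟨x, by simp [starHalf, hx], (gc_none x hx).symm⟩
        | some i => exact Or.inl ⟨i, by simp [starHalf, hx], hleaf x i hx⟩
      · exact Or.inl ⟨i, rfl, gω i⟩
      · exact Or.inr ⟨α i, by rw [hbase _ _ (hα i)]; rfl, (gc_some _ i (hα i)).symm⟩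
    intro x y e
    rcases key x with ⟨i, k₁, k₂⟩ | ⟨d, k₁, k₂⟩ <;> rcases key y with ⟨j, k₃, k₄⟩ | ⟨d', k₃, k₄⟩
    · rw [k₂, k₄, hs.leaf_injective (k₁.symm.trans (e.trans k₃))]
    · exact (hs.leaf_ne _ _ (k₁.symm.trans (e.trans k₃))).elim
    · exact (hs.leaf_ne _ _ (k₃.symm.trans (e.symm.trans k₁))).elim
    · rw [k₂, k₄]
      exact eq_of_sameCycle hgc
        ((h₁ d d').2 (hs.centre_injective (k₁.symm.trans (e.trans k₃))))
  have hret : IsFirstReturn (starReturn ρ') Sum.inl ρ := by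
    have hA' : ∀ x, Hits (starReturn ρ') Sum.inl (A (Sum.inl (ρ x))) (ρ x) := fun x => by
      by_cases h : ∃ i, ρ x = α i
      · obtain ⟨i, h⟩ := h
        rw [h, eA]
        refine Hits.step (fun z e => by cases e) ?_
        rw [starReturn_apply, starFlip_inr, Bool.not_true, e₁]
        exact Hits.here _
      · rw [eA' _ fun i e => h ⟨i, e⟩]
        exact Hits.here _
    intro x
    rw [starReturn_apply, starFlip_inl]
    by_cases hx : ∃ i, x = ω i
    · obtain ⟨i, rfl⟩ := hx
      rw [e₃]
      refine Hits.step (fun z e => by cases e) ?_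
      rw [starReturn_apply, starFlip_inr, Bool.not_false, e₂]
      exact hA' _
    · rw [e₄ x fun i e => hx ⟨i, e⟩]
      exact hA' x
  have hrev : ∀ x, ρ' (starAcross J τ (ρ' x)) = starAcross J τ x := fun x => by
    have k₁ : ∀ y, starAcross J τ (A y) = starFlip (B (starFlip (starAcross J τ y))) :=
      starAcross_starSwap hαi hωi true hJ hτ hJα
    have k₂ : ∀ y, starAcross J τ (B y) = starFlip (A (starFlip (starAcross J τ y))) :=
      starAcross_starSwap hωi hαi false hJ hτ hJω
    have k₃ : ∀ y, R (starAcross J τ (R y)) = starAcross J τ y := by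
      rintro (y | y)
      · have := h₂ (ρ y)
        rw [show ρ⁻¹ (ρ y) = y from Equiv.symm_apply_apply _ _] at this
        exact congrArg Sum.inl this
      · rfl
    have k₄ : ∀ y, R (starFlip y) = starFlip (R y) := by
      rintro (y | y) <;> rfl
    have k₅ : ∀ y, A (A y) = y := starSwap_starSwap _ _
    have k₆ : ∀ y, B (B y) = y := starSwap_starSwap _ _
    rw [hρ', hρ', k₁, starFlip_starFlip, k₆, k₄, k₃, k₂, starFlip_starFlip, k₅,
      starFlip_starAcross, starFlip_starFlip]
  refine ⟨ρ', hcyc, fun x => ?_, (hs.flat_iff h₁ hcyc hret).1 h₃⟩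
  rw [← hrev (ρ'⁻¹ x), show ρ' (ρ'⁻¹ x) = x from Equiv.apply_symm_apply _ _]

end Star

/-! ### Cutting a bond -/

section Bond

variable {D H K G : Type*}

theorem LinkReach.mono {half : D → H} {β : D → D} {P Q : D → Prop} (hPQ : ∀ x, P x → Q x) {x y : D}
    (h : LinkReach half β P x y) : LinkReach half β Q x y :=
  EqvGen.mono (fun _ _ => Or.imp_right fun h => ⟨hPQ _ h.1, h.2⟩) _ _ h

/-- Let `T` be a union of rotators, and let the edges leaving `T` be those at the flags `k κ`.  A
function on `T` with consistent jumps extends to the remaining flags: the jumps at the edges leaving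
`T` are paired up along paths that avoid `T`. -/
theorem exists_extension_of_linkReach [Fintype D] [Fintype K] {ρ : Equiv.Perm D} {half : D → H}
    {β : D → D} (hρ : ∀ x y, ρ.SameCycle x y ↔ half x = half y) (hβ : ∀ x, β (β x) = x)
    {T : D → Prop} (hT : ∀ x y, half x = half y → (T x ↔ T y)) {k : K → D}
    (hk : Function.Injective k) (hkT : ∀ κ, T (k κ))
    (hcross : ∀ x, T x → ¬ T (β x) → ∃ κ, x = k κ) (j : K → G)
    (hreach : ∀ κ κ', j κ = j κ' →
      LinkReach half β (fun x => ¬ T x ∧ ¬ T (β x)) (β (k κ)) (β (k κ')))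
    {s : D → ZMod 2} (hs : ∀ x, T x → T (β x) → s (ρ (β x)) + s (β x) = s (ρ x) + s x)
    (hsum : ∀ g : G → ZMod 2, ∑ κ, g (j κ) * (s (ρ (k κ)) + s (k κ)) = 0) :
    ∃ s' : D → ZMod 2, (∀ x, s' (ρ (β x)) + s' (β x) = s' (ρ x) + s' x) ∧
      ∀ x, T x → s' x = s x := by
  classical
  let M : Submodule (ZMod 2) (K → ZMod 2) :=
    { carrier := {c | ∃ u : D → ZMod 2, (∀ w, u (β w) = u w) ∧
        (∀ w, ¬ (¬ T w ∧ ¬ T (β w)) → u w = 0) ∧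
        ∀ g : H → ZMod 2, ∑ w, g (half w) * u w = ∑ κ, g (half (β (k κ))) * c κ}
      add_mem' := by
        rintro c c' ⟨u, h₁, h₂, h₃⟩ ⟨u', h₁', h₂', h₃'⟩
        refine ⟨u + u', fun w => by simp [h₁, h₁'], fun w hw => by simp [h₂ w hw, h₂' w hw],
          fun g => ?_⟩
        simp only [Pi.add_apply, mul_add, Finset.sum_add_distrib, h₃, h₃']
      zero_mem' := ⟨0, fun _ => rfl, fun _ _ => rfl, fun g => by simp⟩
      smul_mem' := by
        rintro r c ⟨u, h₁, h₂, h₃⟩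
        refine ⟨r • u, fun w => by simp [h₁], fun w hw => by simp [h₂ w hw], fun g => ?_⟩
        simp only [Pi.smul_apply, smul_eq_mul, mul_left_comm _ r, ← Finset.mul_sum, h₃] }
  have hM : (fun κ => s (ρ (k κ)) + s (k κ)) ∈ M := by
    refine mem_of_sum_eq_zero j M (fun κ κ' e => ?_) hsum
    obtain ⟨u, h₁, h₂, h₃⟩ := (hreach κ κ' e).exists_path hβ (fun x hx => ⟨hx.2, by
      rw [hβ]; exact hx.1⟩)
    refine ⟨u, h₁, h₂, fun g => ?_⟩
    simp [h₃, mul_add, Finset.sum_add_distrib, Pi.single_apply]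
  obtain ⟨u, h₁, h₂, h₃⟩ := hM
  let c : D → ZMod 2 := fun x => ∑ κ, if x = β (k κ) then s (ρ (k κ)) + s (k κ) else 0
  have hc₁ : ∀ κ, c (β (k κ)) = s (ρ (k κ)) + s (k κ) := fun κ => by
    have : ∀ κ', β (k κ) = β (k κ') ↔ κ = κ' := fun κ' =>
      ⟨fun e => hk (by rw [← hβ (k κ), e, hβ]), fun e => by rw [e]⟩
    simp [c, this]
  have hc₂ : ∀ x, ¬ T (β x) → c x = 0 := fun x hx =>
    Finset.sum_eq_zero fun κ _ => if_neg fun e => hx (by rw [e, hβ]; exact hkT κ)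
  obtain ⟨s₂, hs₂⟩ := exists_jump_eq hρ (u := u + c) fun g => by
    have h₄ : ∑ x, g (half x) * (u + c) x = ∑ x, g (half x) * u x + ∑ x, g (half x) * c x := by
      simp only [Pi.add_apply, mul_add, Finset.sum_add_distrib]
    rw [h₄, h₃, ZMod.two_add_eq_zero]
    simp only [c, Finset.mul_sum]
    rw [Finset.sum_comm]
    simp
  have hTρ : ∀ x, T (ρ x) ↔ T x := fun x => hT _ _ (apply_eq_of_sameCycle_iff hρ x)
  refine ⟨fun x => if T x then s x else s₂ x, fun x => ?_, fun x hx => if_pos hx⟩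
  have key : ∀ κ, s₂ (ρ (β (k κ))) + s₂ (β (k κ)) = s (ρ (k κ)) + s (k κ) := fun κ => by
    rw [hs₂, Pi.add_apply, hc₁, h₂ _ (by rw [hβ]; exact fun h => h.2 (hkT κ)), zero_add]
  by_cases hx : T x <;> by_cases hx' : T (β x)
  · simp only [hTρ, hx, hx', if_true]; exact hs x hx hx'
  · simp only [hTρ, hx, hx', if_true, if_false]
    obtain ⟨κ, rfl⟩ := hcross x hx hx'
    exact key κ
  · simp only [hTρ, hx, hx', if_true, if_false]
    obtain ⟨κ, hκ⟩ := hcross (β x) hx' (by rwa [hβ])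
    have hx₁ : x = β (k κ) := by rw [← hκ, hβ]
    rw [hx₁, key, hβ]
  · simp only [hTρ, hx, hx', if_false, hs₂, Pi.add_apply, h₁]
    rw [hc₂ x hx', hc₂ (β x) (by rwa [hβ])]

/-- The new flags of each cut edge are exchanged. -/
def bondAcross (J : D → D) : D ⊕ K × Bool → D ⊕ K × Bool
  | Sum.inl x => Sum.inl (J x)
  | Sum.inr (κ, b) => Sum.inr (κ, !b)

/-- The link edges `{k κ, β (k κ)}` lead from the side `none` to the side `some (j κ)`, and no other
edge leaves a side.  Every one of them is cut into two edges, which end at new flags `(κ, false)`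
and `(κ, true)`; for each `g`, the flags `(κ, false)` with `j κ = g` form a new link vertex, and so
do the flags `(κ, true)` with `j κ = g`. -/
structure IsBond {H' : Type*} (half : D → H) (β : D → D) (side : D → Option G) (k : K → D)
    (j : K → G) (half' : D ⊕ K × Bool → H') (β' : D ⊕ K × Bool → D ⊕ K × Bool) : Prop where
  turn_turn : ∀ x, β (β x) = x
  turn_ne : ∀ x, β x ≠ x
  injective : Function.Injective k
  side_cut : ∀ κ, side (k κ) = none
  side_turn_cut : ∀ κ, side (β (k κ)) = some (j κ)
  side_eq : ∀ x y, half x = half y → side x = side y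
  side_turn : ∀ x, (∀ κ, x ≠ k κ) → (∀ κ, x ≠ β (k κ)) → side (β x) = side x
  half_inl : ∀ x y, half' (Sum.inl x) = half' (Sum.inl y) ↔ half x = half y
  half_inr : ∀ κ b κ' b', half' (Sum.inr (κ, b)) = half' (Sum.inr (κ', b')) ↔ b = b' ∧ j κ = j κ'
  half_ne : ∀ x y, half' (Sum.inl x) ≠ half' (Sum.inr y)
  turn_inl : ∀ x, (∀ κ, x ≠ k κ) → (∀ κ, x ≠ β (k κ)) → β' (Sum.inl x) = Sum.inl (β x)
  turn_cut : ∀ κ, β' (Sum.inl (k κ)) = Sum.inr (κ, false)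
  turn_cut' : ∀ κ, β' (Sum.inl (β (k κ))) = Sum.inr (κ, true)
  turn_false : ∀ κ, β' (Sum.inr (κ, false)) = Sum.inl (k κ)
  turn_true : ∀ κ, β' (Sum.inr (κ, true)) = Sum.inl (β (k κ))

variable {H' : Type*} {half : D → H} {J β : D → D} {side : D → Option G} {k : K → D}
    {j : K → G} {half' : D ⊕ K × Bool → H'} {β' : D ⊕ K × Bool → D ⊕ K × Bool}

/-- The jumps of a function at the cut edges of one side add up to zero. -/
theorem IsBond.sum_eq_zero [Fintype D] [Fintype K] (h : IsBond half β side k j half' β')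
    {ρ : Equiv.Perm D} (hρ : ∀ x, half (ρ x) = half x) {s : D → ZMod 2}
    (hs : ∀ x, s (ρ (β x)) + s (β x) = s (ρ x) + s x) (g : G → ZMod 2) :
    ∑ κ, g (j κ) * (s (ρ (k κ)) + s (k κ)) = 0 := by
  classical
  let G' : Option G → ZMod 2 := fun o => o.elim 0 g
  have h₀ := sum_mul_jump_eq_zero (half := side) (fun x => h.side_eq _ _ (hρ x)) s G'
  let c : D → ZMod 2 := fun x =>
    ∑ κ, if x = β (k κ) then g (j κ) * (s (ρ (k κ)) + s (k κ)) else 0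
  have hc₁ : ∀ κ, c (β (k κ)) = g (j κ) * (s (ρ (k κ)) + s (k κ)) := fun κ => by
    have : ∀ κ', β (k κ) = β (k κ') ↔ κ = κ' := fun κ' =>
      ⟨fun e => h.injective (by rw [← h.turn_turn (k κ), e, h.turn_turn]), fun e => by rw [e]⟩
    simp [c, this]
  have hc₂ : ∀ x, (∀ κ, x ≠ β (k κ)) → c x = 0 := fun x hx =>
    Finset.sum_eq_zero fun κ _ => if_neg (hx κ)
  have hne : ∀ κ κ', k κ ≠ β (k κ') := fun κ κ' e => by
    have := congrArg side e
    rw [h.side_cut, h.side_turn_cut] at this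
    cases this
  have h₁ : ∑ x, (G' (side x) * (s (ρ x) + s x) + c x) = 0 := by
    have z₁ : ∀ κ, G' (side (k κ)) * (s (ρ (k κ)) + s (k κ)) + c (k κ) = 0 := fun κ => by
      rw [h.side_cut, hc₂ _ (hne κ)]; simp [G']
    have z₂ : ∀ κ, G' (side (β (k κ))) * (s (ρ (β (k κ))) + s (β (k κ))) + c (β (k κ)) = 0 :=
      fun κ => by
        rw [h.side_turn_cut, hc₁, hs]; exact ZMod.two_add_eq_zero.2 rfl
    refine Finset.sum_involution (fun x _ => β x) (fun x _ => ?_)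
      (fun x _ _ => h.turn_ne x) (fun _ _ => Finset.mem_univ _) fun x _ => h.turn_turn x
    by_cases hx : ∃ κ, x = k κ
    · obtain ⟨κ, rfl⟩ := hx
      rw [z₁, z₂, zero_add]
    by_cases hx' : ∃ κ, x = β (k κ)
    · obtain ⟨κ, rfl⟩ := hx'
      rw [h.turn_turn, z₁, z₂, zero_add]
    have k₁ : ∀ κ, x ≠ k κ := fun κ e => hx ⟨κ, e⟩
    have k₂ : ∀ κ, x ≠ β (k κ) := fun κ e => hx' ⟨κ, e⟩
    have k₃ : ∀ κ, β x ≠ β (k κ) := fun κ e => k₁ κ (by rw [← h.turn_turn x, e, h.turn_turn])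
    rw [h.side_turn x k₁ k₂, hc₂ x k₂, hc₂ _ k₃, hs]
    exact ZMod.two_add_eq_zero.2 rfl
  rw [Finset.sum_add_distrib, h₀, zero_add] at h₁
  rw [← h₁]
  simp only [c]
  rw [Finset.sum_comm]
  simp

/-- Gluing the two ends of a bond turns a planar rotation system into a planar rotation system. -/
theorem IsBond.planarFlags [Finite D] [Finite K] (h : IsBond half β side k j half' β')
    (hp : PlanarFlags half' (bondAcross J) β') : PlanarFlags half J β := by
  classical
  have := Fintype.ofFinite D
  have := Fintype.ofFinite K
  obtain ⟨ρ', h₁, h₂, h₃⟩ := hp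
  have h₂' : ∀ x, ρ' (bondAcross J (ρ' x)) = bondAcross J x := fun x => by
    rw [h₂, show ρ'⁻¹ (ρ' x) = x from Equiv.symm_apply_apply _ _]
  have hinv := apply_eq_of_sameCycle_iff h₁
  obtain ⟨ρ, hρ⟩ := exists_isFirstReturn ρ' (Sum.inl_injective (α := D) (β := K × Bool))
  have hi : Function.Injective fun κ : K => (Sum.inr (κ, true) : D ⊕ K × Bool) := fun κ κ' e => by
    simpa using e
  obtain ⟨σ, hσ⟩ := exists_isFirstReturn ρ' hi
  have r₁ : ∀ x, ρ' (Sum.inl x) = Sum.inl (ρ x) := fun x => by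
    have h₄ := hρ x
    have h₅ := hinv (Sum.inl x)
    generalize ρ' (Sum.inl x) = y at h₄ h₅
    rcases y with y | y
    · rw [h₄.unique Sum.inl_injective (Hits.here y)]
    · exact (h.half_ne _ _ h₅.symm).elim
  have r₂ : ∀ κ, ρ' (Sum.inr (κ, true)) = Sum.inr (σ κ, true) := fun κ => by
    have h₄ := hσ κ
    have h₅ := hinv (Sum.inr (κ, true))
    generalize ρ' (Sum.inr (κ, true)) = y at h₄ h₅
    rcases y with y | ⟨κ', b⟩
    · exact (h.half_ne _ _ h₅).elim
    · obtain ⟨rfl, -⟩ := (h.half_inr _ _ _ _).1 h₅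
      rw [h₄.unique hi (Hits.here κ')]
  have r₃ : ∀ κ, ρ' (Sum.inr (σ κ, false)) = Sum.inr (κ, false) := fun κ => by
    have := h₂' (Sum.inr (κ, true))
    rwa [r₂] at this
  have cρ : ∀ x y, ρ.SameCycle x y ↔ half x = half y := fun x y => by
    rw [hρ.sameCycle_iff Sum.inl_injective, h₁, h.half_inl]
  have cσ : ∀ κ κ', σ.SameCycle κ κ' ↔ j κ = j κ' := fun κ κ' => by
    rw [hσ.sameCycle_iff hi, h₁, h.half_inr]; simp
  have hside : ∀ x, side (ρ x) = side x := fun x => h.side_eq _ _ (apply_eq_of_sameCycle_iff cρ x)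
  refine ⟨ρ, cρ, fun x => ?_, fun s hs => ?_⟩
  · have := hρ.reverse Sum.inl_injective (J := J) (J' := bondAcross J) (fun _ => rfl)
      (fun y hy z => by
        rcases y with y | ⟨κ, b⟩
        · exact (hy y rfl).elim
        · simp [bondAcross]) h₂' (ρ⁻¹ x)
    rwa [show ρ (ρ⁻¹ x) = x from Equiv.apply_symm_apply _ _] at this
  obtain ⟨a, ha⟩ := exists_jump_eq cσ (h.sum_eq_zero (apply_eq_of_sameCycle_iff cρ) hs)
  obtain ⟨p, q, hp, hq, hpq⟩ := h₃
    (fun y => match y with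
      | Sum.inl x => s x
      | Sum.inr (κ, true) => a κ
      | Sum.inr (κ, false) => a (σ κ)) fun y => by
    rcases y with x | ⟨κ, _ | _⟩
    · by_cases hx : ∃ κ, x = k κ
      · obtain ⟨κ, rfl⟩ := hx
        obtain ⟨κ, rfl⟩ := σ.surjective κ
        rw [h.turn_cut, r₃, r₁]
        simp only [← ha]
        exact add_comm _ _
      by_cases hx' : ∃ κ, x = β (k κ)
      · obtain ⟨κ, rfl⟩ := hx'
        rw [h.turn_cut', r₂, r₁]
        simp only [ha, hs]
      rw [h.turn_inl x (fun κ e => hx ⟨κ, e⟩) fun κ e => hx' ⟨κ, e⟩, r₁, r₁]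
      exact hs x
    · obtain ⟨κ, rfl⟩ := σ.surjective κ
      rw [h.turn_false, r₁, r₃]
      simp only [← ha]
      exact add_comm _ _
    · rw [h.turn_true, r₁, r₂]
      simp only [ha, hs]
  -- `p` and `q` are shifted by a constant on each side, so that they fit together along the bond
  let c₀ : K → ZMod 2 := fun κ => p (Sum.inr (σ κ, true)) + p (Sum.inr (κ, false))
  have hc₀ : ∀ κ, c₀ (σ κ) = c₀ κ := fun κ => by
    have e₁ := hp (Sum.inr (σ κ, true))
    have e₂ := hp (Sum.inr (σ κ, false))
    rw [r₂] at e₁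
    rw [r₃] at e₂
    simp only [c₀, e₁, e₂]
  have hfac : Function.FactorsThrough c₀ j := fun κ κ' e => eq_of_sameCycle hc₀ ((cσ _ _).2 e)
  let c : Option G → ZMod 2 := fun o => o.elim 0 (Function.extend j c₀ 0)
  have hc : ∀ κ, c (some (j κ)) = q (Sum.inr (σ κ, true)) + q (Sum.inr (κ, false)) := fun κ => by
    have e₁ := hpq (Sum.inr (σ κ, true))
    have e₂ := hpq (Sum.inr (κ, false))
    simp only at e₁ e₂
    rw [e₁] at e₂
    have e₃ : c (some (j κ)) = c₀ κ := hfac.extend_apply 0 κ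
    have z₁ := (ZMod.two_add_eq_zero (a := q (Sum.inr (σ κ, true)))).2 rfl
    have z₂ := (ZMod.two_add_eq_zero (a := p (Sum.inr (κ, false)))).2 rfl
    rw [e₃]
    simp only [c₀]
    linear_combination e₂ - z₁ + z₂
  refine ⟨fun x => p (Sum.inl x) + c (side x), fun x => q (Sum.inl x) + c (side x), fun x => ?_,
    fun x => ?_, fun x => ?_⟩
  · simp only [hside, ← r₁, hp]
  · simp only [hside]
    by_cases hx : ∃ κ, x = k κ
    · obtain ⟨κ, rfl⟩ := hx
      obtain ⟨κ, rfl⟩ := σ.surjective κ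
      have e₁ := hq (Sum.inl (k (σ κ)))
      have e₂ := hq (Sum.inr (σ κ, true))
      have e₃ : j (σ κ) = j κ := apply_eq_of_sameCycle_iff cσ κ
      rw [h.turn_cut, r₃] at e₁
      rw [h.turn_true, r₁] at e₂
      rw [h.side_cut, h.side_turn_cut, e₃, hc, e₂, ← e₁]
      have z := (ZMod.two_add_eq_zero (a := q (Sum.inr (σ κ, true)))).2 rfl
      simp only [c, Option.elim_none]
      linear_combination z
    by_cases hx' : ∃ κ, x = β (k κ)
    · obtain ⟨κ, rfl⟩ := hx'
      have e₁ := hq (Sum.inl (β (k κ)))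
      have e₂ := hq (Sum.inr (κ, false))
      rw [h.turn_cut', r₂] at e₁
      rw [h.turn_false, r₁] at e₂
      rw [h.turn_turn, h.side_cut, h.side_turn_cut, hc, e₂, ← e₁]
      have z := (ZMod.two_add_eq_zero (a := q (Sum.inr (σ κ, true)))).2 rfl
      simp only [c, Option.elim_none]
      linear_combination -z
    have k₁ : ∀ κ, x ≠ k κ := fun κ e => hx ⟨κ, e⟩
    have k₂ : ∀ κ, x ≠ β (k κ) := fun κ e => hx' ⟨κ, e⟩
    have e₁ := hq (Sum.inl x)
    rw [h.turn_inl x k₁ k₂, r₁] at e₁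
    rw [e₁, h.side_turn x k₁ k₂]
  · have e₁ := hpq (Sum.inl x)
    have z := (ZMod.two_add_eq_zero (a := c (side x))).2 rfl
    simp only at e₁
    linear_combination e₁ - z

end Bond

section Bond

variable {D H K G H' : Type*} {half : D → H} {J β : D → D} {side : D → Option G} {k : K → D}
    {j : K → G} {half' : D ⊕ K × Bool → H'} {β' : D ⊕ K × Bool → D ⊕ K × Bool}

/-- The faces that lie on one side of the cut edges, walked along from a cut edge until the next cut
edge. -/
theorem IsBond.exists_faceReturn [Finite D] (h : IsBond half β side k j half' β')
    {ρ : Equiv.Perm D} (hρ : ∀ x y, ρ.SameCycle x y ↔ half x = half y) :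
    ∃ τ : Equiv.Perm K, (∀ κ, j (τ κ) = j κ) ∧
      (∀ q : D → ZMod 2, (∀ x, q (ρ (β x)) = q x) →
        ∀ κ, q (ρ (β (k κ))) = q (β (k (τ κ)))) ∧
      ∀ g : K → Prop, (∀ κ, g (τ κ) = g κ) → ∃ g' : D → Prop, (∀ κ, g' (β (k κ)) = g κ) ∧
        (∀ κ, g' (ρ (β (k κ))) = g κ) ∧
        ∀ x, (∀ κ, x ≠ k κ) → (∀ κ, x ≠ β (k κ)) → g' (ρ (β x)) = g' x := by
  classical
  have hi : Function.Injective fun κ => β (k κ) := fun κ κ' e =>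
    h.injective (by rw [← h.turn_turn (k κ), ← h.turn_turn (k κ')]; exact congrArg β e)
  let δ : D → D := fun x => if (∃ κ, x = k κ) ∨ ∃ κ, x = β (k κ) then x else β x
  have δ₁ : ∀ κ, δ (β (k κ)) = β (k κ) := fun κ => if_pos (Or.inr ⟨κ, rfl⟩)
  have δ₂ : ∀ x, (∀ κ, x ≠ k κ) → (∀ κ, x ≠ β (k κ)) → δ x = β x := fun x h₁ h₂ =>
    if_neg fun h₃ => h₃.elim (fun ⟨κ, e⟩ => h₁ κ e) fun ⟨κ, e⟩ => h₂ κ e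
  have δδ : ∀ x, δ (δ x) = x := fun x => by
    by_cases hx : (∃ κ, x = k κ) ∨ ∃ κ, x = β (k κ)
    · simp only [δ, hx, if_true]
    · have hx' : ¬ ((∃ κ, β x = k κ) ∨ ∃ κ, β x = β (k κ)) := by
        rintro (⟨κ, e⟩ | ⟨κ, e⟩)
        · exact hx (Or.inr ⟨κ, by rw [← e, h.turn_turn]⟩)
        · exact hx (Or.inl ⟨κ, by rw [← h.turn_turn x, e, h.turn_turn]⟩)
      simp only [δ, hx, hx', if_false, h.turn_turn]
  let φ : Equiv.Perm D := Equiv.trans (Function.Involutive.toPerm δ δδ) ρ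
  have hφ : ∀ x, φ x = ρ (δ x) := fun x => rfl
  have hside : ∀ x, side (φ x) = side x := fun x => by
    rw [hφ, h.side_eq _ _ (apply_eq_of_sameCycle_iff hρ _)]
    by_cases hx : (∃ κ, x = k κ) ∨ ∃ κ, x = β (k κ)
    · simp only [δ, hx, if_true]
    · rw [δ₂ x (fun κ e => hx (Or.inl ⟨κ, e⟩)) fun κ e => hx (Or.inr ⟨κ, e⟩)]
      exact h.side_turn x (fun κ e => hx (Or.inl ⟨κ, e⟩)) fun κ e => hx (Or.inr ⟨κ, e⟩)
  have hsideρ : ∀ x, side (ρ x) = side x := fun x =>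
    h.side_eq _ _ (apply_eq_of_sameCycle_iff hρ x)
  obtain ⟨τ, hτ⟩ := exists_isFirstReturn φ hi
  refine ⟨τ, fun κ => ?_, fun q hq κ => ?_, fun g hg => ?_⟩
  · have := (hτ κ).apply_eq (g := side) fun y _ => hside y
    rw [hside, h.side_turn_cut, h.side_turn_cut] at this
    exact (Option.some.inj this).symm
  · have := (hτ κ).apply_eq (g := fun y => if side y = none then 0 else q y) fun y hy => by
      simp only [hside]
      by_cases hn : side y = none
      · simp only [hn, if_true]
      · rw [hφ, δ₂ y (fun κ e => hn (by rw [e, h.side_cut])) hy, hq]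
    simpa [hsideρ, hφ, δ₁, h.side_turn_cut] using this
  · obtain ⟨g', h₁, h₂⟩ := exists_extension φ hi g
    have h₃ : ∀ κ, g' (φ (β (k κ))) = g κ := fun κ => by
      rw [(hτ κ).apply_eq h₂, h₁, hg]
    refine ⟨g', h₁, fun κ => ?_, fun x k₁ k₂ => ?_⟩
    · rw [← h₃, hφ, δ₁]
    · rw [← h₂ x k₂, hφ, δ₂ x k₁ k₂]

/-- In a planar rotation system, the edges of each bond inherit a cyclic order. -/
theorem IsBond.sameCycle_faceReturn [Finite D] (h : IsBond half β side k j half' β')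
    (hin : ∀ κ κ', j κ = j κ' → LinkReach half β
      (fun x => side x = some (j κ) ∧ side (β x) = some (j κ)) (β (k κ)) (β (k κ')))
    (hout : ∀ κ κ', j κ = j κ' → LinkReach half β
      (fun x => side x ≠ some (j κ) ∧ side (β x) ≠ some (j κ)) (k κ) (k κ'))
    {ρ : Equiv.Perm D} (hρ : ∀ x y, ρ.SameCycle x y ↔ half x = half y) (hflat : Flat ρ β)
    {τ : Equiv.Perm K} (hj : ∀ κ, j (τ κ) = j κ)
    (hτ : ∀ g : K → Prop, (∀ κ, g (τ κ) = g κ) → ∃ g' : D → Prop, (∀ κ, g' (β (k κ)) = g κ) ∧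
        (∀ κ, g' (ρ (β (k κ))) = g κ) ∧
        ∀ x, (∀ κ, x ≠ k κ) → (∀ κ, x ≠ β (k κ)) → g' (ρ (β x)) = g' x) (κ κ' : K) :
    τ.SameCycle κ κ' ↔ j κ = j κ' := by
  classical
  refine sameCycle_iff_of_invariant hj (fun g hg κ κ' e => ?_) κ κ'
  have hside : ∀ x, side (ρ x) = side x := fun x => h.side_eq _ _ (apply_eq_of_sameCycle_iff hρ x)
  obtain ⟨g', h₁, h₂, h₃⟩ := hτ g hg
  let s : D → ZMod 2 := fun x => if side x = some (j κ) ∧ g' x then 1 else 0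
  have hs₁ : ∀ κ', s (ρ (β (k κ'))) = s (β (k κ')) := fun κ' => by
    simp only [s, hside, h₁, h₂]
  have hs₂ : ∀ x, side x ≠ some (j κ) → s x = 0 := fun x hx => if_neg fun h => hx h.1
  have hs₃ : ∀ x, (∀ κ, x ≠ k κ) → (∀ κ, x ≠ β (k κ)) → s (ρ (β x)) = s x := fun x k₁ k₂ => by
    simp only [s, hside, h.side_turn x k₁ k₂, h₃ x k₁ k₂]
  have hs₄ : ∀ κ', s (ρ (k κ')) + s (k κ') = 0 := fun κ' => by
    rw [hs₂, hs₂, add_zero]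
    · rw [h.side_cut]; exact fun e => by cases e
    · rw [hside, h.side_cut]; exact fun e => by cases e
  have hs₅ : ∀ κ', s (ρ (β (k κ'))) + s (β (k κ')) = 0 := fun κ' =>
    ZMod.two_add_eq_zero.2 (hs₁ κ')
  obtain ⟨p, q, hp, hq, hpq⟩ := hflat s fun x => by
    by_cases hx : ∃ κ, x = k κ
    · obtain ⟨κ, rfl⟩ := hx; rw [hs₄, hs₅]
    by_cases hx' : ∃ κ, x = β (k κ)
    · obtain ⟨κ, rfl⟩ := hx'; rw [h.turn_turn, hs₄, hs₅]
    have k₁ : ∀ κ, x ≠ k κ := fun κ e => hx ⟨κ, e⟩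
    have k₂ : ∀ κ, x ≠ β (k κ) := fun κ e => hx' ⟨κ, e⟩
    rw [hs₃ x k₁ k₂, ← hs₃ (β x) (fun κ e => k₂ κ (by rw [← e, h.turn_turn]))
      fun κ e => k₁ κ (by rw [← h.turn_turn x, e, h.turn_turn]), h.turn_turn, add_comm]
  have hp' : ∀ x y, half x = half y → p x = p y := fun x y e => eq_of_sameCycle hp ((hρ x y).2 e)
  have hpq' : ∀ x, side x ≠ some (j κ) → p x = q x := fun x hx => by
    rw [← ZMod.two_add_eq_zero, ← hpq, hs₂ x hx]
  -- outside the bond, `p = q` is constant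
  have e₁ : p (k κ) = p (k κ') := (hout κ κ' e).apply_eq hp' fun x hx => by
    rw [hpq' x hx.1, ← hq, ← hpq' _ (by rw [hside]; exact hx.2), hp]
  -- inside the bond, `p` is constant
  have e₂ : p (β (k κ)) = p (β (k κ')) := (hin κ κ' e).apply_eq hp' fun x hx => by
    have k₁ : ∀ κ, x ≠ k κ := fun κ e => by
      have := hx.1; rw [e, h.side_cut] at this; cases this
    have k₂ : ∀ κ, x ≠ β (k κ) := fun κ e => by
      have := hx.2; rw [e, h.turn_turn, h.side_cut] at this; cases this
    have := hs₃ x k₁ k₂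
    rw [hpq, hpq, hq, hp] at this
    exact add_right_cancel this
  have hn : ∀ κ', side (k κ') ≠ some (j κ) := fun κ' => by
    rw [h.side_cut]; exact fun e => by cases e
  have e₃ : s (β (k κ)) = s (β (k κ')) := by
    rw [← hs₁, ← hs₁, hpq, hpq, hp, hp, hq, hq, e₂, ← hpq' _ (hn κ), ← hpq' _ (hn κ'), e₁]
  simp only [s, h.side_turn_cut, e, h₁, true_and] at e₃
  by_cases a₁ : g κ <;> by_cases a₂ : g κ' <;> simp [a₁, a₂] at e₃ ⊢

/-- If the two ends of every bond are connected, cutting the bonds turns a planar rotation system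
into a planar rotation system. -/
theorem IsBond.planarFlags_bond [Finite D] [Finite K] (h : IsBond half β side k j half' β')
    (hin : ∀ κ κ', j κ = j κ' → LinkReach half β
      (fun x => side x = some (j κ) ∧ side (β x) = some (j κ)) (β (k κ)) (β (k κ')))
    (hout : ∀ κ κ', j κ = j κ' → LinkReach half β
      (fun x => side x ≠ some (j κ) ∧ side (β x) ≠ some (j κ)) (k κ) (k κ'))
    (hp : PlanarFlags half J β) : PlanarFlags half' (bondAcross J) β' := by
  classical
  have := Fintype.ofFinite D
  have := Fintype.ofFinite K
  obtain ⟨ρ, hρ, hrev, hflat⟩ := hp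
  obtain ⟨τ, hj, hτ₁, hτ₂⟩ := h.exists_faceReturn hρ
  have cτ := h.sameCycle_faceReturn hin hout hρ hflat hj hτ₂
  let ρ' : Equiv.Perm (D ⊕ K × Bool) := Equiv.sumCongr ρ
    { toFun := fun y => match y with
        | (κ, false) => (τ κ, false)
        | (κ, true) => (τ⁻¹ κ, true)
      invFun := fun y => match y with
        | (κ, false) => (τ⁻¹ κ, false)
        | (κ, true) => (τ κ, true)
      left_inv := by rintro ⟨κ, _ | _⟩ <;> simp
      right_inv := by rintro ⟨κ, _ | _⟩ <;> simp }
  have r₁ : ∀ x, ρ' (Sum.inl x) = Sum.inl (ρ x) := fun x => rfl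
  have r₂ : ∀ κ, ρ' (Sum.inr (κ, false)) = Sum.inr (τ κ, false) := fun κ => rfl
  have r₃ : ∀ κ, ρ' (Sum.inr (τ κ, true)) = Sum.inr (κ, true) := fun κ => by
    have : ρ' (Sum.inr (τ κ, true)) = Sum.inr (τ⁻¹ (τ κ), true) := rfl
    rw [this, show τ⁻¹ (τ κ) = κ from Equiv.symm_apply_apply _ _]
  have r₃' : ∀ κ, ρ' (Sum.inr (κ, true)) = Sum.inr (τ⁻¹ κ, true) := fun κ => rfl
  have hj' : ∀ κ, j (τ⁻¹ κ) = j κ := fun κ => by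
    rw [← hj, show τ (τ⁻¹ κ) = κ from Equiv.apply_symm_apply _ _]
  have hside : ∀ x, side (ρ x) = side x := fun x => h.side_eq _ _ (apply_eq_of_sameCycle_iff hρ x)
  have hrev' : ∀ x, ρ' (bondAcross J (ρ' x)) = bondAcross J x := by
    rintro (x | ⟨κ, _ | _⟩)
    · have := hrev (ρ x)
      rw [show ρ⁻¹ (ρ x) = x from Equiv.symm_apply_apply _ _] at this
      exact congrArg Sum.inl this
    · exact r₃ κ
    · obtain ⟨κ, rfl⟩ := τ.surjective κ
      rw [r₃]; exact r₂ κ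
  refine ⟨ρ', ?_, fun x => ?_, ?_⟩
  · refine sameCycle_iff_of_invariant ?_ fun g hg => ?_
    · rintro (x | ⟨κ, _ | _⟩)
      · rw [r₁, h.half_inl]; exact apply_eq_of_sameCycle_iff hρ x
      · rw [r₂, h.half_inr]; exact ⟨rfl, hj κ⟩
      · obtain ⟨κ, rfl⟩ := τ.surjective κ
        rw [r₃, h.half_inr]; exact ⟨rfl, (hj κ).symm⟩
    · rintro (x | ⟨κ, b⟩) (y | ⟨κ', b'⟩) e
      · exact eq_of_sameCycle (g := fun x => g (Sum.inl x)) (fun x => hg (Sum.inl x))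
          ((hρ x y).2 ((h.half_inl _ _).1 e))
      · exact (h.half_ne _ _ e).elim
      · exact (h.half_ne _ _ e.symm).elim
      · obtain ⟨rfl, e'⟩ := (h.half_inr _ _ _ _).1 e
        refine eq_of_sameCycle (g := fun κ => g (Sum.inr (κ, b))) (fun κ => ?_) ((cτ _ _).2 e')
        cases b
        · exact hg (Sum.inr (κ, false))
        · rw [← hg (Sum.inr (τ κ, true)), r₃]
  · rw [← hrev' (ρ'⁻¹ x), show ρ' (ρ'⁻¹ x) = x from Equiv.apply_symm_apply _ _]
  refine Flat.of_blocks (fun y => match y with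
    | Sum.inl x => side x
    | Sum.inr (κ, true) => some (j κ)
    | Sum.inr (κ, false) => none) ?_ ?_ fun s hs i => ?_
  · rintro (x | ⟨κ, _ | _⟩)
    · exact hside x
    · rfl
    · obtain ⟨κ, rfl⟩ := τ.surjective κ
      rw [r₃]; exact congrArg some (hj κ).symm
  · rintro (x | ⟨κ, _ | _⟩)
    · by_cases hx : ∃ κ, x = k κ
      · obtain ⟨κ, rfl⟩ := hx
        rw [h.turn_cut]; exact (h.side_cut κ).symm
      by_cases hx' : ∃ κ, x = β (k κ)
      · obtain ⟨κ, rfl⟩ := hx'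
        rw [h.turn_cut']; exact (h.side_turn_cut κ).symm
      rw [h.turn_inl x (fun κ e => hx ⟨κ, e⟩) fun κ e => hx' ⟨κ, e⟩]
      exact h.side_turn x (fun κ e => hx ⟨κ, e⟩) fun κ e => hx' ⟨κ, e⟩
    · rw [h.turn_false]; exact h.side_cut κ
    · rw [h.turn_true]; exact h.side_turn_cut κ
  have hT : ∀ i x y, half x = half y → (side x = i ↔ side y = i) := fun i x y e => by
    rw [h.side_eq x y e]
  -- the jump condition on one side
  have hs₀ : ∀ x, side (β x) = side x →
      s (Sum.inl (ρ (β x))) + s (Sum.inl (β x)) = s (Sum.inl (ρ x)) + s (Sum.inl x) := fun x hx => by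
    have k₁ : ∀ κ, x ≠ k κ := fun κ e => by
      rw [e, h.side_cut, h.side_turn_cut] at hx; cases hx
    have k₂ : ∀ κ, x ≠ β (k κ) := fun κ e => by
      rw [e, h.turn_turn, h.side_cut, h.side_turn_cut] at hx; cases hx
    have := hs (Sum.inl x)
    rwa [h.turn_inl x k₁ k₂, r₁, r₁] at this
  cases i with
  | none =>
    obtain ⟨s', hs', hss⟩ := exists_extension_of_linkReach hρ h.turn_turn
      (T := fun x => side x = none) (hT none) h.injective h.side_cut
      (fun x h₁ h₂ => by
        by_contra hx
        push Not at hx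
        refine h₂ ((h.side_turn x hx fun κ e => ?_).trans h₁)
        rw [e, h.side_turn_cut] at h₁; cases h₁) j
      (fun κ κ' e => (hin κ κ' e).mono fun x hx => by rw [hx.1, hx.2]; simp)
      (s := fun x => s (Sum.inl x)) (fun x h₁ h₂ => hs₀ x (h₂.trans h₁.symm)) fun g => by
        have := sum_mul_jump_eq_zero (half := j) (ρ := τ) hj (fun κ => s (Sum.inr (κ, false))) g
        refine (Finset.sum_congr rfl fun κ _ => ?_).trans this
        have := hs (Sum.inl (k κ))
        rw [h.turn_cut, r₂, r₁] at this
        rw [← this]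
    obtain ⟨p, q, hp, hq, hpq⟩ := hflat s' hs'
    have hqτ := hτ₁ q hq
    -- the face through the corner of `(τ κ, false)` is the one through the corner of `k κ`
    let q' : D ⊕ K × Bool → ZMod 2 := fun y => match y with
      | Sum.inl x => q x
      | Sum.inr (κ, _) => q (k (τ⁻¹ κ))
    have hq' : ∀ κ b, q' (Sum.inr (τ κ, b)) = q (k κ) := fun κ b => by
      change q (k (τ⁻¹ (τ κ))) = _
      rw [show τ⁻¹ (τ κ) = κ from Equiv.symm_apply_apply _ _]
    have hq'' : ∀ κ, q (ρ (k (τ κ))) = q (k κ) := fun κ => by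
      have := hq (β (k (τ κ)))
      rw [h.turn_turn] at this
      rw [this, ← hqτ, hq]
    refine ⟨fun y => match y with
      | Sum.inl x => p x
      | Sum.inr y => s (Sum.inr y) + q' (Sum.inr y), q', ?_, ?_, ?_⟩
    · rintro (x | ⟨κ, _ | _⟩) hc
      · exact hp x
      · obtain ⟨κ, rfl⟩ := τ.surjective κ
        have e₁ := hs (Sum.inl (k (τ κ)))
        rw [h.turn_cut, r₁, r₂] at e₁
        rw [← hss (k (τ κ)) (h.side_cut _),
          ← hss (ρ (k (τ κ))) ((hside _).trans (h.side_cut _)), hpq, hpq, hp, hq''] at e₁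
        change s (Sum.inr (τ (τ κ), false)) + q' (Sum.inr (τ (τ κ), false))
          = s (Sum.inr (τ κ, false)) + q' (Sum.inr (τ κ, false))
        rw [hq' (τ κ) false, hq' κ false]
        have z₁ := (ZMod.two_add_eq_zero (a := p (k (τ κ)))).2 rfl
        have z₂ := (ZMod.two_add_eq_zero (a := s (Sum.inr (τ κ, false)))).2 rfl
        have z₃ := (ZMod.two_add_eq_zero (a := q (k (τ κ)))).2 rfl
        linear_combination e₁ + z₁ - z₂ + z₃
      · cases hc
    · rintro (x | ⟨κ, _ | _⟩) hc
      · by_cases hx : ∃ κ, x = k κ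
        · obtain ⟨κ, rfl⟩ := hx
          rw [h.turn_cut, r₂]; exact hq' κ false
        by_cases hx' : ∃ κ, x = β (k κ)
        · obtain ⟨κ, rfl⟩ := hx'
          have hc' : side (β (k κ)) = none := hc
          rw [h.side_turn_cut] at hc'; cases hc'
        rw [h.turn_inl x (fun κ e => hx ⟨κ, e⟩) fun κ e => hx' ⟨κ, e⟩, r₁]
        exact hq x
      · obtain ⟨κ, rfl⟩ := τ.surjective κ
        rw [h.turn_false, r₁, hq' κ false]; exact hq'' κ
      · cases hc
    · rintro (x | ⟨κ, _ | _⟩) hc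
      · exact (hss x hc).symm.trans (hpq x)
      · have z := (ZMod.two_add_eq_zero (a := q' (Sum.inr (κ, false)))).2 rfl
        simp only
        linear_combination -z
      · cases hc
  | some i =>
    obtain ⟨s', hs', hss⟩ := exists_extension_of_linkReach hρ h.turn_turn
      (T := fun x => side x = some i) (hT (some i)) (k := fun κ : {κ // j κ = i} => β (k κ.1))
      (fun κ κ' e => Subtype.ext (h.injective (by
        rw [← h.turn_turn (k κ.1), ← h.turn_turn (k κ'.1)]; exact congrArg β e)))
      (fun κ => by rw [h.side_turn_cut, κ.2])
      (fun x h₁ h₂ => by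
        by_contra hx
        push Not at hx
        refine h₂ ((h.side_turn x (fun κ e => ?_) fun κ e => ?_).trans h₁)
        · rw [e, h.side_cut] at h₁; cases h₁
        · refine hx ⟨κ, ?_⟩ e
          rw [e, h.side_turn_cut] at h₁
          exact Option.some.inj h₁) (fun _ => ())
      (fun κ κ' _ => by
        rw [h.turn_turn, h.turn_turn]
        refine (hout κ κ' (κ.2.trans κ'.2.symm)).mono fun x hx => ?_
        rwa [κ.2] at hx)
      (s := fun x => s (Sum.inl x)) (fun x h₁ h₂ => hs₀ x (h₂.trans h₁.symm)) fun g => by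
        have := sum_mul_jump_eq_zero (half := j) (ρ := τ⁻¹) hj' (fun κ => s (Sum.inr (κ, true)))
          fun i' => if i' = i then g () else 0
        simp only [ite_mul, zero_mul] at this
        rw [← Finset.sum_filter, Finset.sum_subtype _ (p := fun κ => j κ = i) (by simp)] at this
        refine (Finset.sum_congr rfl fun κ _ => ?_).trans this
        have e₁ := hs (Sum.inl (β (k κ)))
        rw [h.turn_cut', r₃', r₁] at e₁
        rw [e₁]
    obtain ⟨p, q, hp, hq, hpq⟩ := hflat s' hs'
    have hqτ := hτ₁ q hq
    let q' : D ⊕ K × Bool → ZMod 2 := fun y => match y with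
      | Sum.inl x => q x
      | Sum.inr (κ, _) => q (β (k (τ κ)))
    have hq' : ∀ κ b, q' (Sum.inr (τ⁻¹ κ, b)) = q (β (k κ)) := fun κ b => by
      change q (β (k (τ (τ⁻¹ κ)))) = _
      rw [show τ (τ⁻¹ κ) = κ from Equiv.apply_symm_apply _ _]
    refine ⟨fun y => match y with
      | Sum.inl x => p x
      | Sum.inr y => s (Sum.inr y) + q' (Sum.inr y), q', ?_, ?_, ?_⟩
    · rintro (x | ⟨κ, _ | _⟩) hc
      · exact hp x
      · cases hc
      · have hc' : j κ = i := Option.some.inj hc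
        have e₀ : side (β (k κ)) = some i := by rw [h.side_turn_cut, hc']
        have e₁ := hs (Sum.inl (β (k κ)))
        rw [h.turn_cut', r₃', r₁] at e₁
        rw [← hss (β (k κ)) e₀, ← hss (ρ (β (k κ))) ((hside _).trans e₀), hpq, hpq, hp, hqτ] at e₁
        change s (Sum.inr (τ⁻¹ κ, true)) + q' (Sum.inr (τ⁻¹ κ, true))
          = s (Sum.inr (κ, true)) + q (β (k (τ κ)))
        rw [hq' κ true]
        have z₁ := (ZMod.two_add_eq_zero (a := p (β (k κ)))).2 rfl
        have z₂ := (ZMod.two_add_eq_zero (a := s (Sum.inr (κ, true)))).2 rfl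
        have z₃ := (ZMod.two_add_eq_zero (a := q (β (k κ)))).2 rfl
        linear_combination e₁ + z₁ - z₂ + z₃
    · rintro (x | ⟨κ, _ | _⟩) hc
      · by_cases hx : ∃ κ, x = k κ
        · obtain ⟨κ, rfl⟩ := hx
          have hc' : side (k κ) = some i := hc
          rw [h.side_cut] at hc'; cases hc'
        by_cases hx' : ∃ κ, x = β (k κ)
        · obtain ⟨κ, rfl⟩ := hx'
          rw [h.turn_cut', r₃']; exact hq' κ true
        rw [h.turn_inl x (fun κ e => hx ⟨κ, e⟩) fun κ e => hx' ⟨κ, e⟩, r₁]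
        exact hq x
      · cases hc
      · rw [h.turn_true, r₁]; exact hqτ κ
    · rintro (x | ⟨κ, _ | _⟩) hc
      · exact (hss x hc).symm.trans (hpq x)
      · cases hc
      · have z := (ZMod.two_add_eq_zero (a := q' (Sum.inr (κ, true)))).2 rfl
        simp only
        linear_combination -z

end Bond

/-! ### Subdividing an edge -/

section SubdivideEdge

variable {D H : Type*} {half : D → H} {J β : D → D} {h : H}

/-- The half-edges after the edge at `h` is subdivided by a new vertex, whose two half-edges are
`inr false` and `inr true`. -/
def subdivideHalf (half : D → H) (h : H) : D ⊕ {x : D // half x = h} × Bool → H ⊕ Bool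
  | Sum.inl x => Sum.inl (half x)
  | Sum.inr (_, i) => Sum.inr i

open Classical in
/-- A flag at the subdivided edge is separated from its former partner by two new flags. -/
noncomputable def subdivideAcross (half : D → H) (J : D → D) (h : H) :
    D ⊕ {x : D // half x = h} × Bool → D ⊕ {x : D // half x = h} × Bool
  | Sum.inl x =>
      if hx : half x = h then Sum.inr (⟨x, hx⟩, false)
      else if hx' : half (J x) = h then Sum.inr (⟨J x, hx'⟩, true)
      else Sum.inl (J x)
  | Sum.inr (x, false) => Sum.inl x.1
  | Sum.inr (x, true) => Sum.inl (J x.1)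

/-- At the new vertex, each face turns from one half of the subdivided edge to the other. -/
def subdivideTurn (half : D → H) (β : D → D) (h : H) :
    D ⊕ {x : D // half x = h} × Bool → D ⊕ {x : D // half x = h} × Bool
  | Sum.inl x => Sum.inl (β x)
  | Sum.inr (x, i) => Sum.inr (x, !i)

theorem subdivideAcross_left {x : D} (hx : half x = h) :
    subdivideAcross half J h (Sum.inl x) = Sum.inr (⟨x, hx⟩, false) := dif_pos hx

theorem subdivideAcross_right (hne : ∀ x, half x = h → half (J x) ≠ h) {x : D}
    (hx : half (J x) = h) :
    subdivideAcross half J h (Sum.inl x) = Sum.inr (⟨J x, hx⟩, true) := by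
  have h₁ : half x ≠ h := fun e => hne x e hx
  simp [subdivideAcross, h₁, hx]

theorem subdivideAcross_inl {x : D} (hx : half x ≠ h) (hx' : half (J x) ≠ h) :
    subdivideAcross half J h (Sum.inl x) = Sum.inl (J x) := by
  simp [subdivideAcross, hx, hx']

theorem planarFlags_subdivide [Finite D]
    (hne : ∀ x, half x = h → half (J x) ≠ h) (hp : PlanarFlags half J β) :
    PlanarFlags (subdivideHalf half h) (subdivideAcross half J h) (subdivideTurn half β h) := by
  obtain ⟨ρ, hρ, hrev, hflat⟩ := hp
  have hρh := apply_eq_of_sameCycle_iff hρ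
  have hrev₁ : ∀ x, ρ (J (ρ x)) = J x := fun x => by
    rw [hrev, show ρ⁻¹ (ρ x) = x from Equiv.symm_apply_apply _ _]
  let σ : Equiv.Perm {x : D // half x = h} := ρ.subtypePerm fun x => by rw [hρh]
  have hσ : ∀ x, (σ x).1 = ρ x.1 := fun x => rfl
  let ρ' : Equiv.Perm (D ⊕ {x : D // half x = h} × Bool) := Equiv.sumCongr ρ
    { toFun := fun y => match y with
        | (κ, false) => (σ⁻¹ κ, false)
        | (κ, true) => (σ κ, true)
      invFun := fun y => match y with
        | (κ, false) => (σ κ, false)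
        | (κ, true) => (σ⁻¹ κ, true)
      left_inv := by rintro ⟨κ, _ | _⟩ <;> simp
      right_inv := by rintro ⟨κ, _ | _⟩ <;> simp }
  have r₁ : ∀ x, ρ' (Sum.inl x) = Sum.inl (ρ x) := fun x => rfl
  have r₂ : ∀ κ, ρ' (Sum.inr (κ, true)) = Sum.inr (σ κ, true) := fun κ => rfl
  have r₃ : ∀ κ, ρ' (Sum.inr (σ κ, false)) = Sum.inr (κ, false) := fun κ => by
    have : ρ' (Sum.inr (σ κ, false)) = Sum.inr (σ⁻¹ (σ κ), false) := rfl
    rw [this, show σ⁻¹ (σ κ) = κ from Equiv.symm_apply_apply _ _]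
  have hrev' : ∀ y, ρ' (subdivideAcross half J h (ρ' y)) = subdivideAcross half J h y := by
    rintro (x | ⟨κ, _ | _⟩)
    · rw [r₁]
      have hJρ : half (J (ρ x)) = half (J x) := by rw [← hrev₁ x, hρh]
      by_cases h₁ : half x = h
      · rw [subdivideAcross_left h₁, subdivideAcross_left ((hρh x).trans h₁)]
        exact r₃ ⟨x, h₁⟩
      by_cases h₂ : half (J x) = h
      · rw [subdivideAcross_right hne h₂, subdivideAcross_right hne (hJρ.trans h₂), r₂]
        exact congrArg (fun z => Sum.inr (z, true)) (Subtype.ext (hrev₁ x))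
      · rw [subdivideAcross_inl h₁ h₂, subdivideAcross_inl (by rwa [hρh]) (by rwa [hJρ]), r₁,
          hrev₁]
    · obtain ⟨κ, rfl⟩ := σ.surjective κ
      rw [r₃]
      exact r₁ κ.1
    · rw [r₂]
      exact congrArg Sum.inl (hrev₁ κ.1)
  refine ⟨ρ', ?_, fun y => ?_, ?_⟩
  · have cσ : ∀ κ κ', σ.SameCycle κ κ' := fun κ κ' =>
      Equiv.Perm.sameCycle_subtypePerm.2 ((hρ _ _).2 (κ.2.trans κ'.2.symm))
    refine sameCycle_iff_of_invariant ?_ fun g hg => ?_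
    · rintro (x | ⟨κ, _ | _⟩)
      · exact congrArg Sum.inl (hρh x)
      · rfl
      · rfl
    · rintro (x | ⟨κ, b⟩) (y | ⟨κ', b'⟩) e
      · exact eq_of_sameCycle (g := fun x => g (Sum.inl x)) (fun x => hg (Sum.inl x))
          ((hρ x y).2 (Sum.inl.inj e))
      · cases e
      · cases e
      · obtain rfl : b = b' := Sum.inr.inj e
        refine eq_of_sameCycle (g := fun κ => g (Sum.inr (κ, b))) (fun κ => ?_) (cσ κ κ')
        cases b
        · exact (hg (Sum.inr (σ κ, false))).symm.trans (by rw [r₃])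
        · exact hg (Sum.inr (κ, true))
  · rw [← hrev' (ρ'⁻¹ y), show ρ' (ρ'⁻¹ y) = y from Equiv.apply_symm_apply _ _]
  · intro s hs
    obtain ⟨p, q, hp, hq, hpq⟩ := hflat (fun x => s (Sum.inl x)) fun x => hs (Sum.inl x)
    refine ⟨fun y => match y with
      | Sum.inl x => p x
      | Sum.inr (_, false) => 0
      | Sum.inr (κ, true) => s (Sum.inr (σ⁻¹ κ, false)) + s (Sum.inr (κ, true)),
      fun y => match y with
      | Sum.inl x => q x
      | Sum.inr (κ, false) => s (Sum.inr (κ, false))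
      | Sum.inr (κ, true) => s (Sum.inr (σ⁻¹ κ, false)), ?_, ?_, ?_⟩
    · rintro (x | ⟨κ, _ | _⟩)
      · exact hp x
      · rfl
      · have e : s (Sum.inr (σ κ, true)) + s (Sum.inr (κ, true))
            = s (Sum.inr (σ⁻¹ κ, false)) + s (Sum.inr (κ, false)) := hs (Sum.inr (κ, false))
        change s (Sum.inr (σ⁻¹ (σ κ), false)) + s (Sum.inr (σ κ, true))
          = s (Sum.inr (σ⁻¹ κ, false)) + s (Sum.inr (κ, true))
        rw [show σ⁻¹ (σ κ) = κ from Equiv.symm_apply_apply _ _]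
        have z₁ := (ZMod.two_add_eq_zero (a := s (Sum.inr (κ, true)))).2 rfl
        have z₂ := (ZMod.two_add_eq_zero (a := s (Sum.inr (κ, false)))).2 rfl
        linear_combination e - z₁ + z₂
    · rintro (x | ⟨κ, _ | _⟩)
      · exact hq x
      · change s (Sum.inr (σ⁻¹ (σ κ), false)) = _
        rw [show σ⁻¹ (σ κ) = κ from Equiv.symm_apply_apply _ _]
      · rfl
    · rintro (x | ⟨κ, _ | _⟩)
      · exact hpq x
      · exact (zero_add _).symm
      · have z := (ZMod.two_add_eq_zero (a := s (Sum.inr (σ⁻¹ κ, false)))).2 rfl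
        simp only
        linear_combination -z

/-- The link graph at the new vertex is a dipole, and flatness there means that its two rotators are
reverse to each other. -/
theorem PlanarFlags.of_subdivide [Finite D] (hJ : ∀ x, J (J x) = x)
    (hhalf : ∀ x y, half x = half y → half (J x) = half (J y))
    (hp : PlanarFlags (subdivideHalf half h) (subdivideAcross half J h)
      (subdivideTurn half β h)) : PlanarFlags half J β := by
  classical
  have := Fintype.ofFinite D
  obtain ⟨ρ', h₁, h₂, h₃⟩ := hp
  have h₂' : ∀ y, ρ' (subdivideAcross half J h (ρ' y)) = subdivideAcross half J h y := fun y => by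
    rw [h₂, show ρ'⁻¹ (ρ' y) = y from Equiv.symm_apply_apply _ _]
  have hinv := apply_eq_of_sameCycle_iff h₁
  obtain ⟨ρ, hρ⟩ := exists_isFirstReturn ρ'
    (Sum.inl_injective (α := D) (β := {x : D // half x = h} × Bool))
  have hi : ∀ b, Function.Injective fun κ : {x : D // half x = h} =>
      (Sum.inr (κ, b) : D ⊕ {x : D // half x = h} × Bool) := fun b κ κ' e => by simpa using e
  obtain ⟨σ, hσ⟩ := exists_isFirstReturn ρ' (hi true)
  obtain ⟨σ₀, hσ₀⟩ := exists_isFirstReturn ρ' (hi false)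
  have r₁ : ∀ x, ρ' (Sum.inl x) = Sum.inl (ρ x) := fun x => by
    have h₄ := hρ x
    have h₅ := hinv (Sum.inl x)
    generalize ρ' (Sum.inl x) = y at h₄ h₅
    rcases y with y | y
    · rw [h₄.unique Sum.inl_injective (Hits.here y)]
    · cases h₅
  have r₂ : ∀ κ, ρ' (Sum.inr (κ, true)) = Sum.inr (σ κ, true) := fun κ => by
    have h₄ := hσ κ
    have h₅ := hinv (Sum.inr (κ, true))
    generalize ρ' (Sum.inr (κ, true)) = y at h₄ h₅
    rcases y with y | ⟨κ', b⟩
    · cases h₅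
    · obtain rfl : b = true := Sum.inr.inj h₅
      rw [h₄.unique (hi true) (Hits.here κ')]
  have r₃ : ∀ κ, ρ' (Sum.inr (κ, false)) = Sum.inr (σ₀ κ, false) := fun κ => by
    have h₄ := hσ₀ κ
    have h₅ := hinv (Sum.inr (κ, false))
    generalize ρ' (Sum.inr (κ, false)) = y at h₄ h₅
    rcases y with y | ⟨κ', b⟩
    · cases h₅
    · obtain rfl : b = false := Sum.inr.inj h₅
      rw [h₄.unique (hi false) (Hits.here κ')]
  have cρ : ∀ x y, ρ.SameCycle x y ↔ half x = half y := fun x y => by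
    rw [hρ.sameCycle_iff Sum.inl_injective, h₁]
    exact Sum.inl_injective.eq_iff
  have cσ : ∀ κ κ', σ.SameCycle κ κ' ↔ () = () := fun κ κ' => by
    rw [hσ.sameCycle_iff (hi true), h₁]
    exact ⟨fun _ => rfl, fun _ => rfl⟩
  have hρh := apply_eq_of_sameCycle_iff cρ
  -- flatness of the dipole
  have hdip : ∀ κ, σ₀ (σ κ) = κ := fun κ => by
    let a : {x : D // half x = h} → ZMod 2 := Pi.single κ 1
    obtain ⟨b, hb⟩ := exists_jump_eq cσ (u := fun κ => a (σ₀ κ) + a κ)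
      (sum_mul_jump_eq_zero (ρ := σ₀) (fun _ => rfl) a)
    obtain ⟨p, q, hp, hq, hpq⟩ := h₃
      (fun y => match y with
        | Sum.inl _ => 0
        | Sum.inr (κ, true) => b κ
        | Sum.inr (κ, false) => a κ) fun y => by
      rcases y with x | ⟨κ, _ | _⟩
      · change _ + 0 = _ + 0
        simp only [r₁, subdivideTurn]
      · simp only [subdivideTurn, r₂, r₃, Bool.not_false, hb]
      · simp only [subdivideTurn, r₂, r₃, Bool.not_true, hb]
    have e₁ := hq (Sum.inr (κ, false))
    have e₂ := hq (Sum.inr (σ κ, true))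
    have e₃ : p (Sum.inr (σ₀ (σ κ), false)) = p (Sum.inr (κ, false)) :=
      eq_of_sameCycle hp ((h₁ _ _).2 rfl)
    simp only [subdivideTurn, r₂, r₃, Bool.not_false, Bool.not_true] at e₁ e₂
    have e₄ := hpq (Sum.inr (σ₀ (σ κ), false))
    have e₅ := hpq (Sum.inr (κ, false))
    rw [e₃, e₂, e₁, ← e₅] at e₄
    by_contra hκ
    simp [a, hκ] at e₄
  have hJσ : ∀ κ, ρ (J (σ κ).1) = J κ.1 := fun κ => by
    have := h₂' (Sum.inr (κ, true))
    rw [r₂] at this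
    exact Sum.inl.inj ((r₁ _).symm.trans this)
  have hσρ : ∀ κ, (σ κ).1 = ρ κ.1 := fun κ => by
    have := h₂' (Sum.inr (σ κ, false))
    rw [r₃, hdip] at this
    exact (Sum.inl.inj ((r₁ _).symm.trans this)).symm
  refine ⟨ρ, cρ, fun x => ?_, fun s hs => ?_⟩
  · suffices key : ∀ x, ρ (J (ρ x)) = J x by
      rw [← key (ρ⁻¹ x), show ρ (ρ⁻¹ x) = x from Equiv.apply_symm_apply _ _]
    intro x
    by_cases a₁ : half x = h
    · rw [← hσρ ⟨x, a₁⟩, hJσ]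
    have hJρ : half (J (ρ x)) = half (J x) := hhalf _ _ (hρh x)
    by_cases a₂ : half (J x) = h
    · have e := hJσ ⟨J (ρ x), hJρ.trans a₂⟩
      rw [hσρ, hJ] at e
      exact (hJ _).symm.trans (congrArg J (ρ.injective e))
    · have := h₂' (Sum.inl x)
      rw [r₁, subdivideAcross_inl a₁ a₂, subdivideAcross_inl (by rwa [hρh]) (by rwa [hJρ]),
        r₁] at this
      exact Sum.inl.inj this
  · obtain ⟨p, q, hp, hq, hpq⟩ := h₃
      (fun y => match y with
        | Sum.inl x => s x
        | Sum.inr _ => 0) fun y => by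
      rcases y with x | ⟨κ, _ | _⟩
      · simp only [subdivideTurn, r₁]; exact hs x
      · simp only [subdivideTurn, r₂, r₃, Bool.not_false]
      · simp only [subdivideTurn, r₂, r₃, Bool.not_true]
    refine ⟨fun x => p (Sum.inl x), fun x => q (Sum.inl x), fun x => ?_, fun x => ?_,
      fun x => hpq (Sum.inl x)⟩
    · simp only [← r₁, hp]
    · simp only [← r₁]; exact hq (Sum.inl x)

end SubdivideEdge

/-! ### Subdividing a face -/

section SubdivideFace

variable {D H : Type*} {half : D → H} {J β : D → D}

/-- The half-edges after a new edge with the half-edges `inr false` and `inr true` is drawn through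
a face. -/
def chordHalf (half : D → H) : D ⊕ Bool × Bool → H ⊕ Bool
  | Sum.inl x => Sum.inl (half x)
  | Sum.inr (_, i) => Sum.inr i

/-- The flag on the other side of the edge after a new edge is drawn through a face; the new flag
`inr (s, i)` lies in the part `s` of the face, at the half-edge `inr i`. -/
def chordAcross (J : D → D) : D ⊕ Bool × Bool → D ⊕ Bool × Bool
  | Sum.inl x => Sum.inl (J x)
  | Sum.inr (s, i) => Sum.inr (s, !i)

/-- In the link graphs, subdividing a face by a new edge subdivides the two edges
`{n (true, i), n (false, i)}` by new vertices of degree two. -/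
theorem planarFlags_chord_iff [Finite D] {n : Bool × Bool → D}
    {β' : D ⊕ Bool × Bool → D ⊕ Bool × Bool}
    (hn : ∀ s i, n (!s, i) = β (n (s, i)))
    (h₁ : ∀ y, β' (Sum.inl (n y)) = Sum.inr y) (h₂ : ∀ y, β' (Sum.inr y) = Sum.inl (n y))
    (h₃ : ∀ x, (∀ y, x ≠ n y) → β' (Sum.inl x) = Sum.inl (β x)) :
    PlanarFlags half J β ↔ PlanarFlags (chordHalf half) (chordAcross J) β' := by
  classical
  constructor
  · rintro ⟨ρ, hρ, hrev, hflat⟩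
    have hρh := apply_eq_of_sameCycle_iff hρ
    let ρ' : Equiv.Perm (D ⊕ Bool × Bool) := Equiv.sumCongr ρ
      (Equiv.prodCongr Equiv.boolNot (Equiv.refl Bool))
    have r₁ : ∀ x, ρ' (Sum.inl x) = Sum.inl (ρ x) := fun x => rfl
    have r₂ : ∀ s i, ρ' (Sum.inr (s, i)) = Sum.inr (!s, i) := fun s i => rfl
    refine ⟨ρ', ?_, ?_, fun s hs => ?_⟩
    · refine sameCycle_iff_of_invariant ?_ fun g hg => ?_
      · rintro (x | ⟨s, i⟩)
        · exact congrArg Sum.inl (hρh x)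
        · rfl
      · rintro (x | ⟨s, i⟩) (y | ⟨t, j⟩) e
        · exact eq_of_sameCycle (g := fun x => g (Sum.inl x)) (fun x => hg (Sum.inl x))
            ((hρ x y).2 (Sum.inl.inj e))
        · cases e
        · cases e
        · obtain rfl : i = j := Sum.inr.inj e
          have := hg (Sum.inr (s, i))
          rw [r₂] at this
          by_cases hst : s = t
          · rw [hst]
          · rw [← this, Bool.eq_not.2 (Ne.symm hst)]
    · rintro (x | ⟨s, i⟩)
      · exact congrArg Sum.inl (hrev x)
      · rfl
    · have key : ∀ t i, s (Sum.inl (ρ (n (t, i)))) + s (Sum.inl (n (t, i)))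
          = s (Sum.inr (!t, i)) + s (Sum.inr (t, i)) := fun t i => by
        have := hs (Sum.inr (t, i))
        rwa [h₂, r₁, r₂] at this
      obtain ⟨p, q, hp, hq, hpq⟩ := hflat (fun x => s (Sum.inl x)) fun x => by
        by_cases hx : ∃ y, x = n y
        · obtain ⟨⟨t, i⟩, rfl⟩ := hx
          rw [← hn, key, key, Bool.not_not, add_comm]
        · have := hs (Sum.inl x)
          rwa [h₃ x fun y e => hx ⟨y, e⟩, r₁, r₁] at this
      have hq' : ∀ t i, q (ρ (n (t, i))) = q (n (!t, i)) := fun t i => by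
        rw [← hq (n (!t, i)), ← hn, Bool.not_not]
      refine ⟨fun y => match y with
        | Sum.inl x => p x
        | Sum.inr (t, i) => s (Sum.inr (t, i)) + q (n (!t, i)),
        fun y => match y with
        | Sum.inl x => q x
        | Sum.inr (t, i) => q (n (!t, i)), ?_, ?_, ?_⟩
      · rintro (x | ⟨t, i⟩)
        · exact hp x
        · have e := key t i
          rw [hpq, hpq, hp, hq'] at e
          simp only [r₂, Bool.not_not]
          have z₁ := (ZMod.two_add_eq_zero (a := s (Sum.inr (t, i)))).2 rfl
          have z₂ := (ZMod.two_add_eq_zero (a := p (n (t, i)))).2 rfl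
          have z₃ := (ZMod.two_add_eq_zero (a := q (n (t, i)))).2 rfl
          linear_combination -e - z₁ + z₂ + z₃
      · rintro (x | ⟨t, i⟩)
        · by_cases hx : ∃ y, x = n y
          · obtain ⟨⟨t, i⟩, rfl⟩ := hx
            rw [h₁, r₂]
            simp only [Bool.not_not]
          · rw [h₃ x fun y e => hx ⟨y, e⟩, r₁]
            exact hq x
        · rw [h₂, r₁]
          exact hq' t i
      · rintro (x | ⟨t, i⟩)
        · exact hpq x
        · have z := (ZMod.two_add_eq_zero (a := q (n (!t, i)))).2 rfl
          simp only
          linear_combination -z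
  · rintro ⟨ρ', k₁, k₂, k₃⟩
    have hinv := apply_eq_of_sameCycle_iff k₁
    obtain ⟨ρ, hρ⟩ := exists_isFirstReturn ρ' (Sum.inl_injective (α := D) (β := Bool × Bool))
    have r₁ : ∀ x, ρ' (Sum.inl x) = Sum.inl (ρ x) := fun x => by
      have h₄ := hρ x
      have h₅ := hinv (Sum.inl x)
      generalize ρ' (Sum.inl x) = y at h₄ h₅
      rcases y with y | y
      · rw [h₄.unique Sum.inl_injective (Hits.here y)]
      · cases h₅
    have r₂ : ∀ t i, ρ' (Sum.inr (t, i)) = Sum.inr (!t, i) := fun t i => by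
      have h₅ := hinv (Sum.inr (t, i))
      rcases hy : ρ' (Sum.inr (t, i)) with y | ⟨t', i'⟩
      · rw [hy] at h₅; cases h₅
      · rw [hy] at h₅
        obtain rfl : i' = i := Sum.inr.inj h₅
        by_cases ht : t' = t
        · exfalso
          rw [ht] at hy
          have h₆ := eq_of_sameCycle (ρ := ρ') (g := fun z => z = Sum.inr (t, i')) (fun z =>
            propext ⟨fun e => ρ'.injective (e.trans hy.symm), fun e => by rw [e, hy]⟩)
            ((k₁ (Sum.inr (t, i')) (Sum.inr (!t, i'))).2 rfl)
          simp at h₆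
        · rw [Bool.eq_not.2 ht]
    have cρ : ∀ x y, ρ.SameCycle x y ↔ half x = half y := fun x y => by
      rw [hρ.sameCycle_iff Sum.inl_injective, k₁]
      exact Sum.inl_injective.eq_iff
    refine ⟨ρ, cρ, fun x => ?_, fun s hs => ?_⟩
    · have := k₂ (Sum.inl (ρ (ρ⁻¹ x)))
      rw [← r₁, show ρ'⁻¹ (ρ' (Sum.inl (ρ⁻¹ x))) = _ from Equiv.symm_apply_apply _ _, r₁,
        show ρ (ρ⁻¹ x) = x from Equiv.apply_symm_apply _ _] at this
      exact Sum.inl.inj ((r₁ _).symm.trans this)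
    · have hs' : ∀ t i, s (ρ (n (!t, i))) + s (n (!t, i)) = s (ρ (n (t, i))) + s (n (t, i)) :=
        fun t i => by rw [hn, hs]
      obtain ⟨p, q, hp, hq, hpq⟩ := k₃
        (fun y => match y with
          | Sum.inl x => s x
          | Sum.inr (true, i) => s (ρ (n (true, i))) + s (n (true, i))
          | Sum.inr (false, i) => 0) fun y => by
        rcases y with x | ⟨t, i⟩
        · by_cases hx : ∃ y, x = n y
          · obtain ⟨⟨t, i⟩, rfl⟩ := hx
            have := hs' t i
            rw [h₁, r₂, r₁]
            cases t <;> simp at this ⊢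
            exact this
          · rw [h₃ x fun y e => hx ⟨y, e⟩, r₁, r₁]
            exact hs x
        · have := hs' t i
          rw [h₂, r₂, r₁]
          cases t <;> simp at this ⊢
          exact this.symm
      refine ⟨fun x => p (Sum.inl x), fun x => q (Sum.inl x), fun x => ?_, fun x => ?_,
        fun x => hpq (Sum.inl x)⟩
      · simp only [← r₁, hp]
      · by_cases hx : ∃ y, x = n y
        · obtain ⟨⟨t, i⟩, rfl⟩ := hx
          have e₁ := hq (Sum.inl (n (t, i)))
          have e₂ := hq (Sum.inr (!t, i))
          rw [h₁, r₂] at e₁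
          rw [h₂, r₁] at e₂
          rw [← hn]
          exact e₂.trans e₁
        · have := hq (Sum.inl x)
          rwa [h₃ x fun y e => hx ⟨y, e⟩, r₁] at this

end SubdivideFace

namespace TwoComplex

variable (C : TwoComplex.{u})

theorem hasPlanarRotationSystem_subdivideEdge (h : C.Half) :
    C.HasPlanarRotationSystem ↔ (C.subdivideEdge h).HasPlanarRotationSystem := by
  have e₁ : (C.subdivideEdge h).half = subdivideHalf C.half h := by
    funext x; rcases x with x | ⟨x, i⟩ <;> rfl
  have e₂ : (C.subdivideEdge h).across = subdivideAcross C.half C.across h := by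
    funext x; rcases x with x | ⟨x, _ | _⟩ <;> rfl
  have e₃ : (C.subdivideEdge h).turn = subdivideTurn C.half C.turn h := by
    funext x; rcases x with x | ⟨x, i⟩ <;> rfl
  have hne : ∀ x, C.half x = h → C.half (C.across x) ≠ h := fun x e => by
    rw [C.half_across, e]; exact C.flip_ne h
  rw [hasPlanarRotationSystem_iff, hasPlanarRotationSystem_iff, e₁, e₂, e₃]
  exact ⟨planarFlags_subdivide hne,
    PlanarFlags.of_subdivide C.across_across fun x y e => by
      rw [C.half_across, C.half_across, e]⟩

theorem hasPlanarRotationSystem_subdivideFace (φ ψ : C.Flag) (hφψ : ∃ S, C.IsArc S φ ψ) :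
    C.HasPlanarRotationSystem ↔ (C.subdivideFace φ ψ hφψ).HasPlanarRotationSystem := by
  have e₁ : (C.subdivideFace φ ψ hφψ).half = chordHalf C.half := by
    funext x; rcases x with x | ⟨x, i⟩ <;> rfl
  have e₂ : (C.subdivideFace φ ψ hφψ).across = chordAcross C.across := by
    funext x; rcases x with x | ⟨x, i⟩ <;> rfl
  let n : Bool × Bool → C.Flag := fun y => match y with
    | (true, false) => φ
    | (true, true) => ψ
    | (false, false) => C.turn φ
    | (false, true) => C.turn ψ
  have h₂ : ∀ y, (C.subdivideFace φ ψ hφψ).turn (Sum.inr y) = Sum.inl (n y) := by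
    rintro ⟨_ | _, _ | _⟩ <;> rfl
  rw [hasPlanarRotationSystem_iff, hasPlanarRotationSystem_iff, e₁, e₂]
  refine planarFlags_chord_iff (n := n) ?_ (fun y => ?_) h₂ fun x hx => ?_
  · rintro (_ | _) (_ | _)
    · exact (C.turn_turn φ).symm
    · exact (C.turn_turn ψ).symm
    · rfl
    · rfl
  · rw [← h₂]; exact (C.subdivideFace φ ψ hφψ).turn_turn _
  · have b₁ : x ≠ φ := hx (true, false)
    have b₂ : x ≠ ψ := hx (true, true)
    have b₃ : x ≠ C.turn φ := hx (false, false)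
    have b₄ : x ≠ C.turn ψ := hx (false, true)
    simp [subdivideFace, b₁, b₂, b₃, b₄]

variable {C} in
theorem IsSubdivision.hasPlanarRotationSystem_iff {D : TwoComplex.{u}} (h : C.IsSubdivision D) :
    C.HasPlanarRotationSystem ↔ D.HasPlanarRotationSystem := by
  obtain ⟨E, h, ⟨i⟩⟩ := h
  rw [← i.hasPlanarRotationSystem_iff]
  clear i
  induction h with
  | refl => rfl
  | tail _ h ih =>
    rw [ih]
    obtain ⟨k, ⟨i⟩⟩ | ⟨φ, ψ, arc, ⟨i⟩⟩ := h
    · rw [← i.hasPlanarRotationSystem_iff, hasPlanarRotationSystem_subdivideEdge _ k]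
    · rw [← i.hasPlanarRotationSystem_iff, hasPlanarRotationSystem_subdivideFace _ φ ψ arc]

end TwoComplex

/-! ### Stretching an edge -/

section Pair

variable {D H H' : Type*} {half : D → H} {lab : D → Option Bool} {base : Bool → H}
  {leaf : Bool → H'} {centre : H → H'} {J β : D → D}

/-- Two consecutive elements of a rotator form an interval of it. -/
theorem IsStar.planarFlags_star_of_apply_eq [Finite D] (hs : IsStar half lab base leaf centre)
    (hJ : ∀ x, J (J x) = x) {f₁ f₂ : D} (hne : f₁ ≠ f₂)
    (hfalse : ∀ x, lab x = some false ↔ x = f₁ ∨ x = f₂)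
    (htrue : ∀ x, lab x = some true ↔ x = J f₁ ∨ x = J f₂) {ρ : Equiv.Perm D}
    (h₁ : ∀ x y, ρ.SameCycle x y ↔ half x = half y) (h₂ : ∀ x, ρ (J x) = J (ρ⁻¹ x))
    (h₃ : Flat ρ β) (hf : ρ f₁ = f₂) :
    PlanarFlags (starHalf half lab base leaf centre) (starAcross J not) (starTurn β) := by
  have hf' : ρ (J f₂) = J f₁ := by
    rw [h₂, ← hf, show ρ⁻¹ (ρ f₁) = f₁ from Equiv.symm_apply_apply _ _]
  have hne' : J f₁ ≠ J f₂ := fun e => hne (by rw [← hJ f₁, e, hJ])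
  refine hs.planarFlags_star hJ Bool.not_not h₁ h₂ h₃ (α := fun i => cond i (J f₂) f₁)
    (ω := fun i => cond i (J f₁) f₂) ?_ ?_ ?_ ?_ ?_
  · rintro (_ | _)
    exacts [(hfalse _).2 (Or.inl rfl), (htrue _).2 (Or.inr rfl)]
  · rintro (_ | _)
    exacts [(hfalse _).2 (Or.inr rfl), (htrue _).2 (Or.inl rfl)]
  · rintro (_ | _)
    exacts [rfl, hJ f₂]
  · rintro x (_ | _) hx
    · obtain rfl | rfl := (hfalse x).1 hx
      · exact Or.inr ⟨by rw [hf, hfalse]; exact Or.inr rfl, by rw [hf]; exact hne.symm⟩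
      · exact Or.inl rfl
    · obtain rfl | rfl := (htrue x).1 hx
      · exact Or.inl rfl
      · exact Or.inr ⟨by rw [hf', htrue]; exact Or.inl rfl, by rw [hf']; exact hne'⟩
  · rintro x (_ | _) hx
    · obtain e | e := (hfalse _).1 hx
      · exact Or.inl e
      · obtain rfl := ρ.injective (e.trans hf.symm)
        exact Or.inr ⟨(hfalse _).2 (Or.inl rfl), hne⟩
    · obtain e | e := (htrue _).1 hx
      · obtain rfl := ρ.injective (e.trans hf'.symm)
        exact Or.inr ⟨(htrue _).2 (Or.inr rfl), hne'.symm⟩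
      · exact Or.inl e

end Pair

namespace TwoComplex

variable (C : TwoComplex.{u})

open Classical in
/-- The faces which are moved to a new edge when the edge `{h, flip h}` is stretched, seen from its
two ends. -/
noncomputable def pairLabel (f₁ f₂ : C.Flag) (x : C.Flag) : Option Bool :=
  if x = f₁ ∨ x = f₂ then some false
  else if C.across x = f₁ ∨ C.across x = f₂ then some true else none

theorem hasPlanarRotationSystem_preStretchEdge (h : C.Half) (f₁ f₂ : C.Flag) (h₁ : C.half f₁ = h)
    (h₂ : C.half f₂ = h) (ne : f₁ ≠ f₂) (adjacent : C.AlwaysAdjacent h f₁ f₂ h₁ h₂) :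
    C.HasPlanarRotationSystem ↔ (C.preStretchEdge h f₁ f₂ h₁ h₂).HasPlanarRotationSystem := by
  classical
  let base : Bool → C.Half := fun i => cond i (C.flip h) h
  have e₁ : (C.preStretchEdge h f₁ f₂ h₁ h₂).half
      = starHalf C.half (C.pairLabel f₁ f₂) base Sum.inr Sum.inl := by
    funext x
    rcases x with x | ⟨_ | _, _ | _⟩
    · by_cases b₁ : x = f₁ ∨ x = f₂
      · simp [preStretchEdge, starHalf, pairLabel, b₁]
      by_cases b₂ : C.across x = f₁ ∨ C.across x = f₂
      · simp [preStretchEdge, starHalf, pairLabel, b₁, b₂]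
      · simp [preStretchEdge, starHalf, pairLabel, b₁, b₂]
    all_goals rfl
  have e₂ : (C.preStretchEdge h f₁ f₂ h₁ h₂).across = starAcross C.across not := by
    funext x; rcases x with x | ⟨x, i⟩ <;> rfl
  have e₃ : (C.preStretchEdge h f₁ f₂ h₁ h₂).turn = starTurn C.turn := by
    funext x; rcases x with x | ⟨x, i⟩ <;> rfl
  have hac : ∀ x f, C.half x = h → C.half f = h → C.across x ≠ f := fun x f hx hf e =>
    C.flip_ne h (by rw [← hx, ← C.half_across, e, hf, hx])
  have key : ∀ x f, x = C.across f ↔ C.across x = f := fun x f =>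
    ⟨fun e => by rw [e, C.across_across], fun e => by rw [← e, C.across_across]⟩
  have hfalse : ∀ x, C.pairLabel f₁ f₂ x = some false ↔ x = f₁ ∨ x = f₂ := fun x => by
    unfold pairLabel; split_ifs <;> simp_all
  have htrue : ∀ x, C.pairLabel f₁ f₂ x = some true ↔ x = C.across f₁ ∨ x = C.across f₂ :=
    fun x => by
      rw [key, key]
      unfold pairLabel
      split_ifs with a₁ a₂
      · simp only [Option.some.injEq, Bool.false_eq_true, false_iff]
        have hx : C.half x = h := by rcases a₁ with rfl | rfl <;> assumption
        exact fun a => a.elim (hac x f₁ hx h₁) (hac x f₂ hx h₂)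
      · simp [a₂]
      · simp [a₂]
  have hs : IsStar C.half (C.pairLabel f₁ f₂) base
      (Sum.inr : Bool → C.Half ⊕ Bool) Sum.inl :=
    { half_eq := by
        rintro x (_ | _) hx
        · obtain rfl | rfl := (hfalse x).1 hx <;> assumption
        · obtain rfl | rfl := (htrue x).1 hx
          · rw [C.half_across, h₁]; rfl
          · rw [C.half_across, h₂]; rfl
      exists_lab := by
        rintro (_ | _)
        exacts [⟨f₁, (hfalse _).2 (Or.inl rfl)⟩, ⟨_, (htrue _).2 (Or.inl rfl)⟩]
      leaf_injective := Sum.inr_injective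
      centre_injective := Sum.inl_injective
      leaf_ne := fun i h e => by cases e }
  rw [hasPlanarRotationSystem_iff, hasPlanarRotationSystem_iff, e₁, e₂, e₃]
  refine ⟨?_, hs.planarFlags⟩
  rintro ⟨ρ, k₁, k₂, k₃⟩
  have hρ : C.IsRotationSystem ρ := ⟨k₁, k₂⟩
  obtain hf | hf := adjacent _ (C.isPlanarLinkRotation_atVertex hρ k₃ (C.vert h))
  · exact hs.planarFlags_star_of_apply_eq C.across_across ne hfalse htrue k₁ k₂ k₃
      (congrArg Subtype.val hf)
  · exact hs.planarFlags_star_of_apply_eq C.across_across ne.symm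
      (fun x => (hfalse x).trans or_comm) (fun x => (htrue x).trans or_comm) k₁ k₂ k₃
      (congrArg Subtype.val hf)

/-! ### Stretching a branch -/

theorem linkReach_of_inComp {v : C.V} {S : Set C.Half} {X : (C.linkDel v S).ConnectedComponent}
    {φ ψ : C.Flag} (hφ : C.InComp X (C.half φ)) (hψ : C.InComp X (C.half ψ)) :
    LinkReach C.half C.turn
      (fun χ => C.InComp X (C.half χ) ∧ C.InComp X (C.half (C.turn χ))) φ ψ := by
  obtain ⟨k₁, e₁⟩ := hφ
  obtain ⟨k₂, e₂⟩ := hψ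
  obtain ⟨w⟩ := SimpleGraph.ConnectedComponent.exact (e₁.trans e₂.symm)
  have key : ∀ x y (_ : (C.linkDel v S).Walk x y), (C.linkDel v S).connectedComponentMk x = X →
      ∀ φ ψ, C.half φ = x.1 → C.half ψ = y.1 → LinkReach C.half C.turn
      (fun χ => C.InComp X (C.half χ) ∧ C.InComp X (C.half (C.turn χ))) φ ψ := by
    intro x y w
    induction w with
    | nil => exact fun _ φ ψ h₁ h₂ => LinkReach.of_half (h₁.trans h₂.symm)
    | @cons x z y h w ih =>
      intro hX φ ψ h₁ h₂
      have hX' : (C.linkDel v S).connectedComponentMk z = X := by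
        rw [← hX]; exact (SimpleGraph.ConnectedComponent.sound h.reachable).symm
      obtain ⟨-, χ, a₁, a₂⟩ := h
      have a₁' : C.half χ = x.1 := a₁
      have a₂' : C.half (C.turn χ) = z.1 := a₂
      refine (LinkReach.of_half (h₁.trans a₁'.symm)).trans
        ((LinkReach.edge ⟨?_, ?_⟩).trans (ih hX' _ ψ a₂' h₂))
      · rw [a₁']; exact ⟨x.2, hX⟩
      · rw [a₂']; exact ⟨z.2, hX'⟩
  exact key _ _ w e₁ φ ψ rfl rfl

theorem inComp_turn {v : C.V} {S : Set C.Half} {X : (C.linkDel v S).ConnectedComponent}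
    {φ : C.Flag} (h : C.InComp X (C.half φ)) (hS : C.half (C.turn φ) ∉ S) :
    C.InComp X (C.half (C.turn φ)) := by
  obtain ⟨hk, hX⟩ := h
  exact ⟨⟨(C.vert_turn φ).trans hk.1, hS⟩, (C.comp_turn φ hk _).trans hX⟩

theorem hasPlanarRotationSystem_preStretchBranch (e : C.Half)
    (X : (C.linkDel (C.vert e) {e}).ConnectedComponent) :
    C.HasPlanarRotationSystem ↔ (C.preStretchBranch e X).HasPlanarRotationSystem := by
  classical
  have he : ¬ C.InComp X e := fun ⟨hk, _⟩ => hk.2 rfl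
  let side : C.Flag → Option Unit := fun x => if C.InComp X (C.half x) then some () else none
  have hside : ∀ x, side x = some () ↔ C.InComp X (C.half x) := fun x => by simp [side]
  have hside' : ∀ x, side x = none ↔ ¬ C.InComp X (C.half x) := fun x => by simp [side]
  have e₂ : (C.preStretchBranch e X).across = bondAcross C.across := by
    funext x; rcases x with x | ⟨x, i⟩ <;> rfl
  have hb : IsBond C.half C.turn side
      (Subtype.val : {φ : C.Flag // C.half φ = e ∧ C.InComp X (C.half (C.turn φ))} → C.Flag)
      (fun _ => ()) (C.preStretchBranch e X).half (C.preStretchBranch e X).turn :=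
    { turn_turn := C.turn_turn
      turn_ne := C.turn_ne
      injective := Subtype.val_injective
      side_cut := fun κ => by rw [hside', κ.2.1]; exact he
      side_turn_cut := fun κ => by rw [hside]; exact κ.2.2
      side_eq := fun x y h => by simp only [side, h]
      side_turn := fun x h₁ h₂ => by
        have k₁ : ∀ y, (∀ κ : {φ : C.Flag // C.half φ = e ∧ C.InComp X (C.half (C.turn φ))},
            y ≠ C.turn κ.1) → C.InComp X (C.half y) → C.InComp X (C.half (C.turn y)) :=
          fun y hy h => C.inComp_turn h fun h' => hy ⟨C.turn y, h', by rwa [C.turn_turn]⟩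
            (C.turn_turn y).symm
        have k₂ : C.InComp X (C.half (C.turn x)) ↔ C.InComp X (C.half x) :=
          ⟨fun h => by
            have := k₁ (C.turn x) (fun κ h' => h₁ κ (by
              rw [← C.turn_turn x, h', C.turn_turn])) h
            rwa [C.turn_turn] at this, k₁ x h₂⟩
        simp only [side, k₂]
      half_inl := fun x y => Sum.inl_injective.eq_iff
      half_inr := fun κ b κ' b' => Sum.inr_injective.eq_iff.trans (by simp)
      half_ne := fun x y h => by cases h
      turn_inl := fun x h₁ h₂ => by
        have a₁ : ¬ (C.half x = e ∧ C.InComp X (C.half (C.turn x))) := fun h => h₁ ⟨x, h⟩ rfl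
        have a₂ : ¬ (C.half (C.turn x) = e ∧ C.InComp X (C.half (C.turn (C.turn x)))) :=
          fun h => h₂ ⟨_, h⟩ (C.turn_turn x).symm
        simp only [preStretchBranch, a₁, a₂, dite_false]
      turn_cut := fun κ => ((C.preStretchBranch e X).turn_turn (Sum.inr (κ, false)))
      turn_cut' := fun κ => ((C.preStretchBranch e X).turn_turn (Sum.inr (κ, true)))
      turn_false := fun κ => rfl
      turn_true := fun κ => rfl }
  rw [hasPlanarRotationSystem_iff, hasPlanarRotationSystem_iff, e₂]
  refine ⟨hb.planarFlags_bond (fun κ κ' _ => ?_) fun κ κ' _ => ?_, hb.planarFlags⟩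
  · simp only [hside]
    exact C.linkReach_of_inComp κ.2.2 κ'.2.2
  · exact LinkReach.of_half (κ.2.1.trans κ'.2.1.symm)

end TwoComplex

/-! ### Separators of the link graph -/

namespace TwoComplex

variable (C : TwoComplex.{u})

theorem compOf_eq_some_iff {v : C.V} {S : Set C.Half} {k : C.Half}
    {X : (C.linkDel v S).ConnectedComponent} : C.compOf v S k = some X ↔ C.InComp X k := by
  unfold compOf InComp
  split_ifs with hk
  · exact Iff.intro (fun h => ⟨hk, Option.some.inj h⟩) fun h => congrArg some h.2
  · exact Iff.intro (fun h => by cases h) fun h => (hk h.1).elim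

variable {C} in
theorem InComp.unique {v : C.V} {S : Set C.Half} {X Y : (C.linkDel v S).ConnectedComponent}
    {k : C.Half} (h : C.InComp X k) (h' : C.InComp Y k) : X = Y :=
  h.2.symm.trans h'.2

/-- In a 2-connected link graph, every component left by the separator `{A, B}` is joined to `A`. -/
theorem exists_flag_of_twoConnected {v : C.V} (hv : C.LinkTwoConnected v) {S : Set C.Half}
    {A B : C.Half} (hS : ∀ k, k ∈ S ↔ k = A ∨ k = B) (hAB : A ≠ B) (hA : C.vert A = v)
    (hB : C.vert B = v) (X : (C.linkDel v S).ConnectedComponent) :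
    ∃ φ, C.half φ = A ∧ C.InComp X (C.half (C.turn φ)) := by
  obtain ⟨⟨k, hk⟩, hX⟩ := X.exists_rep
  have hkB : k ≠ B := fun e => hk.2 ((hS k).2 (Or.inr e))
  have hX' : C.InComp X k := ⟨hk, hX⟩
  obtain ⟨w⟩ := (hv.2.2 B hB).preconnected ⟨k, hk.1, hkB⟩ ⟨A, hA, hAB⟩
  obtain ⟨d, -, h₁, h₂⟩ := w.exists_boundary_dart {x | C.InComp X x.1} hX' fun h =>
    h.1.2 ((hS A).2 (Or.inl rfl))
  obtain ⟨-, χ, a₁, a₂⟩ := d.adj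
  have a₁' : C.half χ = d.fst.1 := a₁
  have a₂' : C.half (C.turn χ) = d.snd.1 := a₂
  have h₁' : C.InComp X (C.half χ) := by rw [a₁']; exact h₁
  have h₂' : ¬ C.InComp X (C.half (C.turn χ)) := by rw [a₂']; exact h₂
  have h₃ : C.half (C.turn χ) ∈ S := by
    by_contra h₃
    exact h₂' (C.inComp_turn h₁' h₃)
  refine ⟨C.turn χ, ((hS _).1 h₃).resolve_right fun e => d.snd.2.2 (a₂'.symm.trans e), ?_⟩
  rwa [C.turn_turn]

/-- In a planar rotation system, the edges from `A` to `X` are left only once along the rotator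
at `A`.  A closed curve through two such edges and `X` would otherwise separate two other edges
at `A`, although these are joined by a path that avoids `A` and `X`. -/
theorem eq_of_exit {v : C.V} {S : Set C.Half} {A B : C.Half} (hS : ∀ k, k ∈ S ↔ k = A ∨ k = B)
    (hAB : A ≠ B) (hA : C.vert A = v)
    (hattB : ∀ X : (C.linkDel v S).ConnectedComponent,
      ∃ φ, C.half φ = B ∧ C.InComp X (C.half (C.turn φ)))
    {ρ : Equiv.Perm C.Flag} (hρ : ∀ x y, ρ.SameCycle x y ↔ C.half x = C.half y)
    (hflat : Flat ρ C.turn) {X : (C.linkDel v S).ConnectedComponent} {φ₁ φ₂ : C.Flag}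
    (h₁ : C.half φ₁ = A) (h₂ : C.half φ₂ = A)
    (hX₁ : C.InComp X (C.half (C.turn φ₁))) (hX₂ : C.InComp X (C.half (C.turn φ₂)))
    (hn₁ : ¬ C.InComp X (C.half (C.turn (ρ φ₁)))) (hn₂ : ¬ C.InComp X (C.half (C.turn (ρ φ₂)))) :
    φ₁ = φ₂ := by
  classical
  have := Fintype.ofFinite C.Flag
  by_contra hne
  have hρh := apply_eq_of_sameCycle_iff hρ
  have hAX : ¬ C.InComp X A := fun h => h.1.2 ((hS A).2 (Or.inl rfl))
  obtain ⟨u₀, a₁, a₂, a₃⟩ := (C.linkReach_of_inComp hX₁ hX₂).exists_path C.turn_turn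
    fun x hx => ⟨hx.2, by rw [C.turn_turn]; exact hx.1⟩
  let E : C.Flag → C.Flag → ZMod 2 := fun φ => Pi.single φ 1 + Pi.single (C.turn φ) 1
  have hE : ∀ φ x, E φ (C.turn x) = E φ x := fun φ x => by
    have e₁ : C.turn x = φ ↔ x = C.turn φ :=
      ⟨fun e => by rw [← e, C.turn_turn], fun e => by rw [e, C.turn_turn]⟩
    have e₂ : C.turn x = C.turn φ ↔ x = φ :=
      ⟨fun e => by rw [← C.turn_turn x, e, C.turn_turn], fun e => by rw [e]⟩
    simp only [E, Pi.add_apply, Pi.single_apply, e₁, e₂]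
    exact add_comm _ _
  let u : C.Flag → ZMod 2 := u₀ + E φ₁ + E φ₂
  have hu : ∀ x, u (C.turn x) = u x := fun x => by simp only [u, Pi.add_apply, hE, a₁]
  obtain ⟨s, hs⟩ := exists_jump_eq hρ (u := u) fun g => by
    have e : ∑ x, g (C.half x) * u x = ∑ x, g (C.half x) * u₀ x + (g A + g (C.half (C.turn φ₁)))
        + (g A + g (C.half (C.turn φ₂))) := by
      simp [u, E, mul_add, Finset.sum_add_distrib, Pi.single_apply, h₁, h₂]
    rw [e, a₃]
    have z : ∀ t : ZMod 2, t + t = 0 := fun t => ZMod.two_add_eq_zero.2 rfl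
    linear_combination z (g A) + z (g (C.half (C.turn φ₁))) + z (g (C.half (C.turn φ₂)))
  obtain ⟨p, q, hp, hq, hpq⟩ := hflat s fun x => by rw [hs, hs, hu]
  have hqu : ∀ x, q (ρ x) + q x = u x := fun x => by
    rw [← hs, hpq, hpq, hp]
    have z := (ZMod.two_add_eq_zero (a := p x)).2 rfl
    linear_combination -z
  have hqt : ∀ x, q (ρ x) = q (C.turn x) := fun x => by rw [← hq (C.turn x), C.turn_turn]
  -- `u` lives on the edges inside `X` and on the two given edges from `X` to `A`
  have hu₀ : ∀ x, ¬ C.InComp X (C.half x) → u₀ x = 0 := fun x hx => a₂ x fun h => hx h.1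
  have hE₀ : ∀ φ x, ¬ C.InComp X (C.half x) → C.InComp X (C.half (C.turn φ)) → x ≠ φ →
      E φ x = 0 := fun φ x hx hφ hxφ => by
    have : x ≠ C.turn φ := fun e => hx (by rwa [e])
    simp [E, hxφ, this]
  have hE₁ : ∀ φ, E φ φ = 1 := fun φ => by simp [E, (C.turn_ne φ).symm]
  have hu₁ : u φ₁ = 1 := by
    have e : ¬ C.InComp X (C.half φ₁) := by rwa [h₁]
    simp only [u, Pi.add_apply, hu₀ _ e, hE₁, hE₀ _ _ e hX₂ hne, zero_add, add_zero]
  have hu₃ : ∀ x, ¬ C.InComp X (C.half x) → x ≠ φ₁ → x ≠ φ₂ → u x = 0 := fun x hx k₁ k₂ => by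
    simp only [u, Pi.add_apply, hu₀ _ hx, hE₀ _ _ hx hX₁ k₁, hE₀ _ _ hx hX₂ k₂, zero_add]
  -- hence `q` is constant at each vertex, and along each edge, of the rest of the link graph
  have hq₁ : ∀ x y, C.half x = C.half y → ¬ C.InComp X (C.half x) → C.half x ≠ A → q x = q y := by
    intro x y e hx hxA
    have key := eq_of_sameCycle
      (g := fun z => if ¬ C.InComp X (C.half z) ∧ C.half z ≠ A then q z else 0) (fun z => by
        simp only [hρh]
        split_ifs with hz
        · rw [← ZMod.two_add_eq_zero, hqu]
          exact hu₃ z hz.1 (fun e => hz.2 (by rw [e, h₁])) fun e => hz.2 (by rw [e, h₂])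
        · rfl) ((hρ x y).2 e)
    simpa [← e, hx, hxA] using key
  have hq₂ : ∀ x, ¬ C.InComp X (C.half x) → C.half x ≠ A → q (C.turn x) = q x :=
    fun x hx hxA => by
      rw [← hqt]
      exact hq₁ _ _ (hρh x) (by rwa [hρh]) (by rwa [hρh])
  obtain ⟨χ, hχ, -⟩ := hattB X
  have hBX : ∀ Y : (C.linkDel v S).ConnectedComponent, ¬ C.InComp Y B := fun Y h =>
    h.1.2 ((hS B).2 (Or.inr rfl))
  have hAY : ∀ Y : (C.linkDel v S).ConnectedComponent, ¬ C.InComp Y A := fun Y h =>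
    h.1.2 ((hS A).2 (Or.inl rfl))
  have hq₃ : ∀ x, C.vert (C.half x) = v → ¬ C.InComp X (C.half x) → C.half x ≠ A →
      q x = q χ := fun x hv hx hxA => by
    by_cases hxB : C.half x = B
    · exact hq₁ _ _ (hxB.trans hχ.symm) hx hxA
    have hxS : C.half x ∉ S := fun h => ((hS _).1 h).elim hxA hxB
    let Y := (C.linkDel v S).connectedComponentMk ⟨C.half x, hv, hxS⟩
    have hxY : C.InComp Y (C.half x) := ⟨_, rfl⟩
    have hYX : Y ≠ X := fun e => hx (e ▸ hxY)
    obtain ⟨ψ, hψ, hψY⟩ := hattB Y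
    have hYn : ∀ k, C.InComp Y k → ¬ C.InComp X k ∧ k ≠ A := fun k hk =>
      ⟨fun h => hYX (hk.unique h), fun e => hAY Y (e ▸ hk)⟩
    have key := (C.linkReach_of_inComp hxY hψY).apply_eq
      (g := fun z => if C.InComp Y (C.half z) then q z else 0)
      (fun y z e => by
        simp only [e]
        split_ifs with hz
        · exact hq₁ _ _ e (by rw [e]; exact (hYn _ hz).1) (by rw [e]; exact (hYn _ hz).2)
        · rfl)
      fun z hz => by
        simp only [hz.1, hz.2, if_true]
        exact hq₂ z (hYn _ hz.1).1 (hYn _ hz.1).2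
    simp only [hxY, hψY, if_true] at key
    have hψA : C.half ψ ≠ A := by rw [hψ]; exact hAB.symm
    have hψX : ¬ C.InComp X (C.half ψ) := by rw [hψ]; exact hBX X
    rw [key, hq₂ ψ hψX hψA]
    exact hq₁ _ _ (hψ.trans hχ.symm) hψX hψA
  -- but `q` changes at both exits
  have hexit : ∀ φ, C.half φ = A → ¬ C.InComp X (C.half (C.turn (ρ φ))) → q (ρ φ) = q χ :=
    fun φ hφ hn => by
      have hρA : C.half (ρ φ) = A := (hρh φ).trans hφ
      have hA' : C.half (C.turn (ρ φ)) ≠ A := fun e => C.half_turn_ne (ρ φ) (e.trans hρA.symm)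
      rw [← C.turn_turn (ρ φ), hq₂ _ hn hA']
      exact hq₃ _ (by rw [C.vert_turn, hρA, hA]) hn hA'
  obtain ⟨n, -, hn⟩ := ((hρ (ρ φ₁) φ₁).2 (hρh φ₁)).exists_pow_eq'
  have hcl : ∀ n : ℕ, C.half ((ρ ^ n) (ρ φ₁)) = A ∧ q ((ρ ^ n) (ρ φ₁)) = q χ := fun n => by
    induction n with
    | zero => exact ⟨(hρh φ₁).trans h₁, hexit _ h₁ hn₁⟩
    | succ n ih =>
      rw [pow_succ', Equiv.Perm.mul_apply]
      refine ⟨(hρh _).trans ih.1, ?_⟩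
      generalize (ρ ^ n) (ρ φ₁) = x at ih
      by_cases k₁ : x = φ₁
      · rw [k₁]; exact hexit _ h₁ hn₁
      by_cases k₂ : x = φ₂
      · rw [k₂]; exact hexit _ h₂ hn₂
      rw [← ih.2, ← ZMod.two_add_eq_zero, hqu]
      exact hu₃ x (by rw [ih.1]; exact hAX) k₁ k₂
  have e₁ := (hcl n).2
  rw [hn] at e₁
  have e₂ := hqu φ₁
  rw [hexit _ h₁ hn₁, e₁, hu₁, ZMod.two_add_eq_zero.2 rfl] at e₂
  exact zero_ne_one e₂

/-- The edges from `A` to `X` form an interval of the rotator at `A`, with first element `α` and last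
element `ω`. -/
theorem exists_interval {v : C.V} {S : Set C.Half} {A B : C.Half}
    (hS : ∀ k, k ∈ S ↔ k = A ∨ k = B) (hAB : A ≠ B) (hA : C.vert A = v)
    (hattA : ∀ X : (C.linkDel v S).ConnectedComponent,
      ∃ φ, C.half φ = A ∧ C.InComp X (C.half (C.turn φ)))
    (hattB : ∀ X : (C.linkDel v S).ConnectedComponent,
      ∃ φ, C.half φ = B ∧ C.InComp X (C.half (C.turn φ)))
    {ρ : Equiv.Perm C.Flag} (hρ : ∀ x y, ρ.SameCycle x y ↔ C.half x = C.half y)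
    (hflat : Flat ρ C.turn) {X Y : (C.linkDel v S).ConnectedComponent} (hXY : X ≠ Y)
    {F : C.Flag → Prop} (hF : ∀ x, F x ↔ C.half x = A ∧ C.InComp X (C.half (C.turn x))) :
    ∃ α ω, F α ∧ F ω ∧ (∀ x, F x → x = ω ∨ (F (ρ x) ∧ ρ x ≠ α)) ∧
      ∀ x, F (ρ x) → ρ x = α ∨ (F x ∧ x ≠ ω) := by
  have hρh := apply_eq_of_sameCycle_iff hρ
  obtain ⟨τ, hτ⟩ := exists_isFirstReturn ρ (Subtype.val_injective (p := F))
  have hτ' : ∀ x : Subtype F, F (ρ x.1) → (τ x).1 = ρ x.1 := fun x hx => by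
    have h : Hits ρ Subtype.val (ρ x.1) (⟨_, hx⟩ : Subtype F) := Hits.here (⟨_, hx⟩ : Subtype F)
    rw [(hτ x).unique Subtype.val_injective h]
  -- some element of the rotator is not in the interval, so the interval is left somewhere
  obtain ⟨ω, hω⟩ : ∃ ω : Subtype F, ¬ F (ρ ω.1) := by
    by_contra hno
    push Not at hno
    obtain ⟨φ, hφ, hφX⟩ := hattA X
    obtain ⟨ψ, hψ, hψY⟩ := hattA Y
    have h₁ := eq_of_sameCycle (g := F) (fun x => propext ⟨fun h => ?_, fun h => hno ⟨x, h⟩⟩)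
      ((hρ φ ψ).2 (hφ.trans hψ.symm))
    · have h₂ : F ψ := by rw [← h₁]; exact (hF φ).2 ⟨hφ, hφX⟩
      exact hXY (((hF ψ).1 h₂).2.unique hψY)
    · obtain ⟨y, hy⟩ := τ.surjective ⟨_, h⟩
      have h₂ := hτ' y (hno y)
      rw [hy] at h₂
      rw [ρ.injective h₂]
      exact y.2
  have hexit : ∀ x : Subtype F, x ≠ ω → F (ρ x.1) := fun x hx => by
    by_contra hn
    refine hx (Subtype.ext ?_)
    have k : ∀ y : Subtype F, ¬ F (ρ y.1) → ¬ C.InComp X (C.half (C.turn (ρ y.1))) :=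
      fun y hy h => hy ((hF _).2 ⟨(hρh _).trans ((hF _).1 y.2).1, h⟩)
    exact C.eq_of_exit hS hAB hA hattB hρ hflat ((hF _).1 x.2).1 ((hF _).1 ω.2).1
      ((hF _).1 x.2).2 ((hF _).1 ω.2).2 (k x hn) (k ω hω)
  refine ⟨(τ ω).1, ω.1, (τ ω).2, ω.2, fun x hx => ?_, fun x hx => ?_⟩
  · by_cases h : (⟨x, hx⟩ : Subtype F) = ω
    · exact Or.inl (congrArg Subtype.val h)
    · refine Or.inr ⟨hexit _ h, fun e => h (τ.injective (Subtype.ext ?_))⟩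
      rw [hτ' ⟨x, hx⟩ (hexit _ h), e]
  · obtain ⟨y, hy⟩ := τ.surjective ⟨_, hx⟩
    by_cases h : y = ω
    · rw [← h, hy]; exact Or.inl rfl
    · have h₂ := hτ' y (hexit y h)
      rw [hy] at h₂
      obtain rfl := ρ.injective h₂
      exact Or.inr ⟨y.2, fun e => h (Subtype.ext e)⟩

end TwoComplex

/-! ### Stretching a 2-separator -/

namespace TwoComplex

variable (C : TwoComplex.{u})

section StretchPair

variable {a b : C.Half}

open Classical in
/-- The faces which are moved to a new edge when the pair `{a, b}` is stretched, seen from their two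
ends.  The label `(X, s, i)` is given to the faces which join `X` to `a` (for `s = false`) or to `b`
(for `s = true`); `i` is `false` at the common endvertex of `a` and `b`, and `true` at the other
ends of these edges. -/
noncomputable def separatorLabel (a b : C.Half) (x : C.Flag) :
    Option ((C.linkDel (C.vert a) {a, b}).ConnectedComponent × Bool × Bool) :=
  if C.half x = a then
    (C.compOf (C.vert a) {a, b} (C.half (C.turn x))).map fun X => (X, false, false)
  else if C.half x = b then
    (C.compOf (C.vert a) {a, b} (C.half (C.turn x))).map fun X => (X, true, false)
  else if C.half x = C.flip a then
    (C.compOf (C.vert a) {a, b} (C.half (C.turn (C.across x)))).map fun X => (X, false, true)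
  else if C.half x = C.flip b then
    (C.compOf (C.vert a) {a, b} (C.half (C.turn (C.across x)))).map fun X => (X, true, true)
  else none

/-- Stretching the pair `{a, b}` amounts to expanding the link vertices `a`, `b`, `flip a` and
`flip b` to stars, and to cutting, for every component `X`, the bond formed by the two star edges at
`X`.  This is the bijection between the flags on both sides: the ends of the edge `0` of a new
triangle lie at the centres, those of the edge `2` at the leaves, and those of the edge `1` come
from cutting the bond. -/
def separatorEquiv (hab : a ≠ b) (hv : C.vert b = C.vert a) (ha : C.vert (C.flip a) ≠ C.vert a)
    (hb : C.vert (C.flip b) ≠ C.vert b) :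
    (C.Flag ⊕ Bool × (C.linkDel (C.vert a) {a, b}).ConnectedComponent × Bool × Bool) ⊕
      ((C.linkDel (C.vert a) {a, b}).ConnectedComponent × Bool) × Bool ≃
      (C.stretchPair a b hab hv ha hb).Flag where
  toFun y := match y with
    | Sum.inl (Sum.inl φ) => Sum.inl φ
    | Sum.inl (Sum.inr (true, X, s, i)) => Sum.inr (X, s, 0, i)
    | Sum.inl (Sum.inr (false, X, s, i)) => Sum.inr (X, s, 2, !i)
    | Sum.inr ((X, s), i) => Sum.inr (X, s, 1, i)
  invFun y := match y with
    | Sum.inl φ => Sum.inl (Sum.inl φ)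
    | Sum.inr (X, s, 0, i) => Sum.inl (Sum.inr (true, X, s, i))
    | Sum.inr (X, s, 2, i) => Sum.inl (Sum.inr (false, X, s, !i))
    | Sum.inr (X, s, 1, i) => Sum.inr ((X, s), i)
  left_inv y := by rcases y with (φ | ⟨_ | _, X, s, i⟩) | ⟨⟨X, s⟩, i⟩ <;> simp
  right_inv y := by
    rcases y with φ | ⟨X, s, j, i⟩
    · rfl
    · fin_cases j <;> cases i <;> rfl

theorem separatorLabel_false {X : (C.linkDel (C.vert a) {a, b}).ConnectedComponent} (hab : a ≠ b)
    (s : Bool) (x : C.Flag) : C.separatorLabel a b x = some (X, s, false) ↔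
      C.half x = cond s b a ∧ C.InComp X (C.half (C.turn x)) := by
  rw [← compOf_eq_some_iff]
  unfold separatorLabel
  split_ifs with h₁ h₂ h₃ h₄ <;> cases s <;> simp_all

theorem separatorLabel_true {X : (C.linkDel (C.vert a) {a, b}).ConnectedComponent} (hab : a ≠ b)
    (hv : C.vert b = C.vert a) (ha : C.vert (C.flip a) ≠ C.vert a)
    (hb : C.vert (C.flip b) ≠ C.vert b)
    (s : Bool) (x : C.Flag) : C.separatorLabel a b x = some (X, s, true) ↔
      C.separatorLabel a b (C.across x) = some (X, s, false) := by
  rw [C.separatorLabel_false hab, ← compOf_eq_some_iff]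
  have a₁ : C.flip a ≠ b := fun e => ha (by rw [e, hv])
  have a₂ : C.flip b ≠ a := fun e => hb (by rw [e, hv])
  have a₃ := C.flip_ne a
  have a₄ := C.flip_ne b
  have a₅ : C.flip a ≠ C.flip b := fun e => hab (by rw [← C.flip_flip a, e, C.flip_flip])
  have a₆ : ∀ k, C.half (C.across x) = k ↔ C.half x = C.flip k := fun k => by
    rw [C.half_across, C.flip_eq_iff]
  unfold separatorLabel
  split_ifs with h₁ h₂ h₃ h₄ <;> cases s <;> simp_all [eq_comm]

/-- The link vertex of the edges that carry a given label, before the expansion. -/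
def separatorBase (a b : C.Half)
    (i : (C.linkDel (C.vert a) {a, b}).ConnectedComponent × Bool × Bool) : C.Half :=
  cond i.2.2 (C.flip (cond i.2.1 b a)) (cond i.2.1 b a)

/-- The link vertex of the edges that carry a given label, after the expansion. -/
def separatorLeaf (a b : C.Half)
    (i : (C.linkDel (C.vert a) {a, b}).ConnectedComponent × Bool × Bool) :
    C.Half ⊕ (C.linkDel (C.vert a) {a, b}).ConnectedComponent × Option Bool × Bool :=
  Sum.inr (i.1, some i.2.1, !i.2.2)

theorem isStar_separator (hab : a ≠ b) (hv : C.vert b = C.vert a)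
    (ha : C.vert (C.flip a) ≠ C.vert a) (hb : C.vert (C.flip b) ≠ C.vert b)
    (htwo : C.LinkTwoConnected (C.vert a)) :
    IsStar C.half (C.separatorLabel a b) (C.separatorBase a b) (C.separatorLeaf a b)
      Sum.inl where
  half_eq := by
    rintro x ⟨X, s, _ | _⟩ hx
    · exact ((C.separatorLabel_false hab s x).1 hx).1
    · rw [C.separatorLabel_true hab hv ha hb, C.separatorLabel_false hab, C.half_across,
        C.flip_eq_iff] at hx
      exact hx.1
  exists_lab := by
    have key : ∀ X s, ∃ x, C.separatorLabel a b x = some (X, s, false) := fun X s => by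
      simp only [C.separatorLabel_false hab]
      cases s
      · exact C.exists_flag_of_twoConnected htwo (fun k => Iff.rfl) hab rfl hv X
      · exact C.exists_flag_of_twoConnected htwo (fun k => or_comm) hab.symm hv rfl X
    rintro ⟨X, s, _ | _⟩
    · exact key X s
    · obtain ⟨x, hx⟩ := key X s
      exact ⟨C.across x, by rwa [C.separatorLabel_true hab hv ha hb, C.across_across]⟩
  leaf_injective := by
    rintro ⟨X, s, i⟩ ⟨Y, t, j⟩ h
    simpa [separatorLeaf] using h
  centre_injective := Sum.inl_injective
  leaf_ne := fun i h e => by cases e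

/-- The link vertex of a flag after `a`, `b`, `flip a` and `flip b` are expanded to stars. -/
noncomputable abbrev separatorHalf (a b : C.Half) :
    C.Flag ⊕ Bool × (C.linkDel (C.vert a) {a, b}).ConnectedComponent × Bool × Bool →
      C.Half ⊕ (C.linkDel (C.vert a) {a, b}).ConnectedComponent × Option Bool × Bool :=
  starHalf C.half (C.separatorLabel a b) (C.separatorBase a b) (C.separatorLeaf a b) Sum.inl

/-- The component `X` such that the given link vertex lies at the new vertex `X`, if there is one. -/
noncomputable def separatorComp (a b : C.Half) :
    C.Half ⊕ (C.linkDel (C.vert a) {a, b}).ConnectedComponent × Option Bool × Bool →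
      Option (C.linkDel (C.vert a) {a, b}).ConnectedComponent
  | Sum.inl k => C.compOf (C.vert a) {a, b} k
  | Sum.inr (_, _, false) => none
  | Sum.inr (X, _, true) => some X

section Equiv

variable (hab : a ≠ b) (hv : C.vert b = C.vert a) (ha : C.vert (C.flip a) ≠ C.vert a)
  (hb : C.vert (C.flip b) ≠ C.vert b)

theorem half_separatorEquiv
    (y : C.Flag ⊕ Bool × (C.linkDel (C.vert a) {a, b}).ConnectedComponent × Bool × Bool) :
    (C.stretchPair a b hab hv ha hb).half (C.separatorEquiv hab hv ha hb (Sum.inl y))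
      = C.separatorHalf a b y := by
  rcases y with x | ⟨_ | _, X, s, _ | _⟩
  · change (C.stretchPair a b hab hv ha hb).half (Sum.inl x) = _
    by_cases b₁ : C.half x = a
    · simp only [stretchPair, starHalf, separatorLabel, b₁, if_true]
      cases C.compOf (C.vert a) {a, b} (C.half (C.turn x)) <;> rfl
    by_cases b₂ : C.half x = b
    · simp only [stretchPair, starHalf, separatorLabel, b₂, hab.symm, if_true, if_false]
      cases C.compOf (C.vert a) {a, b} (C.half (C.turn x)) <;> rfl
    by_cases b₃ : C.half x = C.flip a
    · simp only [stretchPair, starHalf, separatorLabel, b₁, b₂, if_false]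
      simp only [b₃, if_true]
      cases C.compOf (C.vert a) {a, b} (C.half (C.turn (C.across x))) <;> rfl
    by_cases b₄ : C.half x = C.flip b
    · simp only [stretchPair, starHalf, separatorLabel, b₁, b₂, b₃, if_false]
      simp only [b₄, if_true]
      cases C.compOf (C.vert a) {a, b} (C.half (C.turn (C.across x))) <;> rfl
    · simp only [stretchPair, starHalf, separatorLabel, b₁, b₂, b₃, b₄, if_false]
      rfl
  all_goals rfl

theorem across_separatorEquiv
    (y : (C.Flag ⊕ Bool × (C.linkDel (C.vert a) {a, b}).ConnectedComponent × Bool × Bool) ⊕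
      ((C.linkDel (C.vert a) {a, b}).ConnectedComponent × Bool) × Bool) :
    (C.stretchPair a b hab hv ha hb).across (C.separatorEquiv hab hv ha hb y)
      = C.separatorEquiv hab hv ha hb
        (bondAcross (starAcross C.across fun i => (i.1, i.2.1, !i.2.2)) y) := by
  rcases y with (x | ⟨_ | _, X, s, i⟩) | ⟨⟨X, s⟩, i⟩ <;> rfl

theorem turn_separatorEquiv
    (y : C.Flag ⊕ Bool × (C.linkDel (C.vert a) {a, b}).ConnectedComponent × Bool × Bool)
    (h₁ : ∀ X s, y ≠ Sum.inr (true, X, s, false)) (h₂ : ∀ X s, y ≠ Sum.inr (false, X, s, false)) :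
    (C.stretchPair a b hab hv ha hb).turn (C.separatorEquiv hab hv ha hb (Sum.inl y))
      = C.separatorEquiv hab hv ha hb (Sum.inl (starTurn C.turn y)) := by
  rcases y with x | ⟨_ | _, X, s, _ | _⟩
  · rfl
  · exact (h₂ X s rfl).elim
  · rfl
  · exact (h₁ X s rfl).elim
  · rfl

theorem separatorComp_half
    (x : (C.stretchPair a b hab hv ha hb).Flag) :
    C.separatorComp a b ((C.stretchPair a b hab hv ha hb).half x)
      = ((C.stretchPair a b hab hv ha hb).vert
          ((C.stretchPair a b hab hv ha hb).half x)).getRight? := by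
  generalize (C.stretchPair a b hab hv ha hb).half x = k
  rcases k with k | ⟨X, _ | _ | _, _ | _⟩
  · simp only [stretchPair, separatorComp]
    cases C.compOf (C.vert a) {a, b} k <;> rfl
  all_goals rfl

/-- Cutting the star edges at the new vertices `X` turns the expanded link graphs into those of
`stretchPair`. -/
theorem isBond_separator : IsBond (C.separatorHalf a b) (starTurn C.turn)
    (fun y => C.separatorComp a b (C.separatorHalf a b y))
    (fun κ : (C.linkDel (C.vert a) {a, b}).ConnectedComponent × Bool =>
      Sum.inr (true, κ.1, κ.2, false)) Prod.fst
    (fun y => (C.stretchPair a b hab hv ha hb).half (C.separatorEquiv hab hv ha hb y))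
    (fun y => (C.separatorEquiv hab hv ha hb).symm
      ((C.stretchPair a b hab hv ha hb).turn (C.separatorEquiv hab hv ha hb y))) where
  turn_turn := by rintro (x | ⟨c, i⟩) <;> simp [starTurn, C.turn_turn]
  turn_ne := by rintro (x | ⟨c, i⟩) <;> simp [starTurn, C.turn_ne]
  injective := by rintro ⟨X, s⟩ ⟨Y, t⟩ h; simpa using h
  side_cut := by
    rintro ⟨X, _ | _⟩
    · exact C.compOf_eq_none (Or.inr (Or.inl rfl))
    · exact C.compOf_eq_none (Or.inr (Or.inr rfl))
  side_turn_cut := fun κ => rfl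
  side_eq := fun x y h => by simp only [h]
  side_turn := fun x h₁ h₂ => by
    have e := C.turn_separatorEquiv hab hv ha hb x (fun X s => h₁ (X, s)) fun X s => h₂ (X, s)
    rw [← C.half_separatorEquiv hab hv ha hb, ← C.half_separatorEquiv hab hv ha hb,
      separatorComp_half, separatorComp_half, ← e, (C.stretchPair a b hab hv ha hb).vert_turn]
  half_inl := fun x y => by
    rw [half_separatorEquiv, half_separatorEquiv]
    exact Iff.rfl
  half_inr := by
    rintro ⟨X, s⟩ i ⟨Y, t⟩ j
    change (Sum.inr (X, none, i) : C.Half ⊕ _) = Sum.inr (Y, none, j) ↔ _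
    simp [and_comm]
  half_ne := by
    rintro x ⟨⟨X, s⟩, i⟩
    rw [half_separatorEquiv]
    change _ ≠ (Sum.inr (X, none, i) : C.Half ⊕ _)
    rcases x with x | ⟨_ | _, i⟩
    · cases hx : C.separatorLabel a b x <;> simp [starHalf, hx, separatorLeaf]
    · simp [starHalf, separatorLeaf]
    · simp [starHalf]
  turn_inl := fun x h₁ h₂ => by
    rw [C.turn_separatorEquiv hab hv ha hb x (fun X s => h₁ (X, s)) fun X s => h₂ (X, s),
      Equiv.symm_apply_apply]
  turn_cut := fun κ => rfl
  turn_cut' := fun κ => rfl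
  turn_false := fun κ => rfl
  turn_true := fun κ => rfl

end Equiv

/-- In a planar rotation system, the faces that are moved to the same new edge form an interval of
their rotator. -/
theorem planarFlags_separatorStar (hab : a ≠ b) (hv : C.vert b = C.vert a)
    (ha : C.vert (C.flip a) ≠ C.vert a) (hb : C.vert (C.flip b) ≠ C.vert b)
    (htwo : C.LinkTwoConnected (C.vert a))
    (hsep : ∃ X Y : (C.linkDel (C.vert a) {a, b}).ConnectedComponent, X ≠ Y)
    (hp : PlanarFlags C.half C.across C.turn) :
    PlanarFlags (C.separatorHalf a b) (starAcross C.across fun i => (i.1, i.2.1, !i.2.2))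
      (starTurn C.turn) := by
  obtain ⟨ρ, hρ, hrev, hflat⟩ := hp
  have hatt : ∀ (s : Bool) (X : (C.linkDel (C.vert a) {a, b}).ConnectedComponent),
      ∃ φ, C.half φ = cond s b a ∧ C.InComp X (C.half (C.turn φ)) := fun s X => by
    cases s
    · exact C.exists_flag_of_twoConnected htwo (fun k => Iff.rfl) hab rfl hv X
    · exact C.exists_flag_of_twoConnected htwo (fun k => or_comm) hab.symm hv rfl X
  have hint : ∀ (X : (C.linkDel (C.vert a) {a, b}).ConnectedComponent) (s : Bool),
      ∃ α ω, C.separatorLabel a b α = some (X, s, false) ∧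
        C.separatorLabel a b ω = some (X, s, false) ∧
        (∀ x, C.separatorLabel a b x = some (X, s, false) →
          x = ω ∨ (C.separatorLabel a b (ρ x) = some (X, s, false) ∧ ρ x ≠ α)) ∧
        ∀ x, C.separatorLabel a b (ρ x) = some (X, s, false) →
          ρ x = α ∨ (C.separatorLabel a b x = some (X, s, false) ∧ x ≠ ω) := fun X s => by
    obtain ⟨Y, hXY⟩ : ∃ Y, X ≠ Y := by
      obtain ⟨Y, Z, hYZ⟩ := hsep
      by_cases h : X = Y
      · exact ⟨Z, fun e => hYZ (h.symm.trans e)⟩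
      · exact ⟨Y, h⟩
    cases s
    · exact C.exists_interval (fun k => Iff.rfl) hab rfl (hatt false) (hatt true) hρ hflat hXY
        (F := fun x => C.separatorLabel a b x = some (X, false, false))
        fun x => C.separatorLabel_false hab false x
    · exact C.exists_interval (fun k => or_comm) hab.symm hv (hatt true) (hatt false) hρ hflat hXY
        (F := fun x => C.separatorLabel a b x = some (X, true, false))
        fun x => C.separatorLabel_false hab true x
  choose α ω hα hω hnext hprev using hint
  have hlab := fun X s x => C.separatorLabel_true (X := X) hab hv ha hb s x
  have hJ := C.across_across
  have hrev' : ∀ x, ρ (C.across (ρ x)) = C.across x := fun x => by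
    rw [hrev, show ρ⁻¹ (ρ x) = x from Equiv.symm_apply_apply _ _]
  refine (C.isStar_separator hab hv ha hb htwo).planarFlags_star hJ (fun i => by simp) hρ hrev hflat
    (α := fun i => cond i.2.2 (C.across (ω i.1 i.2.1)) (α i.1 i.2.1))
    (ω := fun i => cond i.2.2 (C.across (α i.1 i.2.1)) (ω i.1 i.2.1)) ?_ ?_ ?_ ?_ ?_
  · rintro ⟨X, s, _ | _⟩
    · exact hα X s
    · exact (hlab X s _).2 (by rw [cond_true, hJ]; exact hω X s)
  · rintro ⟨X, s, _ | _⟩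
    · exact hω X s
    · exact (hlab X s _).2 (by rw [cond_true, hJ]; exact hα X s)
  · rintro ⟨X, s, _ | _⟩
    · rfl
    · exact hJ _
  · rintro x ⟨X, s, _ | _⟩ hx
    · exact hnext X s x hx
    · -- the rotator at the other end of the edge is reversed
      obtain ⟨y, hy⟩ := ρ.surjective (C.across x)
      have hx' := (hlab X s x).1 hx
      rw [← hy] at hx'
      have e : ρ x = C.across y := by rw [← hrev' y, hy, hJ]
      refine (hprev X s y hx').imp (fun h => ?_) fun h => ⟨?_, fun h' => h.2 ?_⟩
      · change x = C.across (α X s)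
        rw [← h, hy, hJ]
      · rw [hlab, e, hJ]; exact h.1
      · have h'' : C.across y = C.across (ω X s) := e.symm.trans h'
        rw [← hJ y, h'', hJ]
  · rintro x ⟨X, s, _ | _⟩ hx
    · exact hprev X s x hx
    · have hx' := (hlab X s _).1 hx
      refine (hnext X s _ hx').imp (fun h => ?_) fun h => ⟨?_, fun h' => h.2 ?_⟩
      · change ρ x = C.across (ω X s)
        rw [← h, hJ]
      · rw [hlab, ← hrev']; exact h.1
      · have h'' : x = C.across (α X s) := h'
        rw [hrev', h'', hJ]

theorem separatorHalf_of_inComp (hv : C.vert b = C.vert a) (ha : C.vert (C.flip a) ≠ C.vert a)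
    (hb : C.vert (C.flip b) ≠ C.vert b) {X : (C.linkDel (C.vert a) {a, b}).ConnectedComponent}
    {x : C.Flag} (hx : C.InComp X (C.half x)) :
    C.separatorHalf a b (Sum.inl x) = Sum.inl (C.half x) := by
  obtain ⟨⟨h₁, h₂⟩, -⟩ := hx
  have b₁ : C.half x ≠ a := fun e => h₂ (Or.inl e)
  have b₂ : C.half x ≠ b := fun e => h₂ (Or.inr e)
  have b₃ : C.half x ≠ C.flip a := fun e => ha (by rw [← e, h₁])
  have b₄ : C.half x ≠ C.flip b := fun e => hb (by rw [← e, h₁, hv])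
  simp [starHalf, separatorLabel, b₁, b₂, b₃, b₄]

/-- The leaves next to the component `X` are joined through `X`. -/
theorem linkReach_separator_leaf (hab : a ≠ b) (hv : C.vert b = C.vert a)
    (ha : C.vert (C.flip a) ≠ C.vert a) (hb : C.vert (C.flip b) ≠ C.vert b)
    (htwo : C.LinkTwoConnected (C.vert a))
    (X : (C.linkDel (C.vert a) {a, b}).ConnectedComponent) (s t : Bool) :
    LinkReach (C.separatorHalf a b) (starTurn C.turn)
      (fun y => C.separatorComp a b (C.separatorHalf a b y) = some X ∧
        C.separatorComp a b (C.separatorHalf a b (starTurn C.turn y)) = some X)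
      (Sum.inr (false, X, s, false)) (Sum.inr (false, X, t, false)) := by
  have hin : ∀ x, C.InComp X (C.half x) →
      C.separatorComp a b (C.separatorHalf a b (Sum.inl x)) = some X := fun x hx => by
    rw [C.separatorHalf_of_inComp hv ha hb hx]
    exact C.compOf_eq_some_iff.2 hx
  have key : ∀ s, ∃ φ, C.InComp X (C.half φ) ∧ LinkReach (C.separatorHalf a b) (starTurn C.turn)
      (fun y => C.separatorComp a b (C.separatorHalf a b y) = some X ∧
        C.separatorComp a b (C.separatorHalf a b (starTurn C.turn y)) = some X)
      (Sum.inr (false, X, s, false)) (Sum.inl φ) := fun s => by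
    obtain ⟨φ, hφ⟩ := (C.isStar_separator hab hv ha hb htwo).exists_lab (X, s, false)
    have hφ' := ((C.separatorLabel_false hab s φ).1 hφ).2
    have h₁ : C.separatorHalf a b (Sum.inl φ) = Sum.inr (X, some s, true) := by
      simp [starHalf, hφ, separatorLeaf]
    refine ⟨C.turn φ, hφ', (LinkReach.of_half ?_).trans
      (LinkReach.edge (x := (Sum.inl φ : C.Flag ⊕ _)) ⟨?_, hin _ hφ'⟩)⟩
    · rw [h₁]; rfl
    · rw [h₁]; rfl
  obtain ⟨φ, hφ, h₁⟩ := key s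
  obtain ⟨ψ, hψ, h₂⟩ := key t
  refine h₁.trans (LinkReach.trans ?_ h₂.symm)
  have h₃ := (C.linkReach_of_inComp hφ hψ).apply_eq
    (g := fun z => C.InComp X (C.half z) ∧ LinkReach (C.separatorHalf a b) (starTurn C.turn)
      (fun y => C.separatorComp a b (C.separatorHalf a b y) = some X ∧
        C.separatorComp a b (C.separatorHalf a b (starTurn C.turn y)) = some X)
      (Sum.inl φ) (Sum.inl z)) (fun y z e => ?_) fun z hz => ?_
  · exact (h₃.mp ⟨hφ, LinkReach.of_half rfl⟩).2
  · rw [e]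
    refine propext (and_congr_right fun hz => ?_)
    have h₄ : C.separatorHalf a b (Sum.inl y) = C.separatorHalf a b (Sum.inl z) := by
      rw [C.separatorHalf_of_inComp hv ha hb hz,
        C.separatorHalf_of_inComp hv ha hb (by rwa [e]), e]
    exact ⟨fun h => h.trans (LinkReach.of_half h₄), fun h => h.trans (LinkReach.of_half h₄.symm)⟩
  · have h₄ := LinkReach.edge (half := C.separatorHalf a b) (β := starTurn C.turn)
      (P := fun y => C.separatorComp a b (C.separatorHalf a b y) = some X ∧
        C.separatorComp a b (C.separatorHalf a b (starTurn C.turn y)) = some X)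
      (x := (Sum.inl z : C.Flag ⊕ _)) ⟨hin _ hz.1, hin _ hz.2⟩
    exact propext ⟨fun h => ⟨hz.1, h.2.trans h₄.symm⟩, fun h => ⟨hz.2, h.2.trans h₄⟩⟩

theorem hasPlanarRotationSystem_stretchPair (hab : a ≠ b) (hv : C.vert b = C.vert a)
    (ha : C.vert (C.flip a) ≠ C.vert a) (hb : C.vert (C.flip b) ≠ C.vert b)
    (htwo : C.LinkTwoConnected (C.vert a))
    (hsep : ∃ X Y : (C.linkDel (C.vert a) {a, b}).ConnectedComponent, X ≠ Y) :
    C.HasPlanarRotationSystem ↔ (C.stretchPair a b hab hv ha hb).HasPlanarRotationSystem := by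
  have hs := C.isStar_separator hab hv ha hb htwo
  have hbond := C.isBond_separator hab hv ha hb
  rw [hasPlanarRotationSystem_iff, hasPlanarRotationSystem_iff,
    ← PlanarFlags.conj_iff (C.separatorEquiv hab hv ha hb) (fun x y => Iff.rfl)
      (fun y => (C.across_separatorEquiv hab hv ha hb y).symm)
      fun y => Equiv.apply_symm_apply _ _]
  refine ⟨fun hp => hbond.planarFlags_bond ?_ ?_
    (C.planarFlags_separatorStar hab hv ha hb htwo hsep hp), fun hp => ?_⟩
  · rintro ⟨X, s⟩ ⟨Y, t⟩ h
    obtain rfl : X = Y := h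
    exact C.linkReach_separator_leaf hab hv ha hb htwo X s t
  · rintro ⟨X, s⟩ ⟨Y, t⟩ h
    obtain rfl : X = Y := h
    -- the centres are joined through another component
    obtain ⟨Y, hXY⟩ : ∃ Y, Y ≠ X := by
      obtain ⟨Y, Z, hYZ⟩ := hsep
      by_cases h : Y = X
      · exact ⟨Z, fun e => hYZ (h.trans e.symm)⟩
      · exact ⟨Y, h⟩
    have hedge : ∀ s, LinkReach (C.separatorHalf a b) (starTurn C.turn)
        (fun y => C.separatorComp a b (C.separatorHalf a b y) ≠ some X ∧
          C.separatorComp a b (C.separatorHalf a b (starTurn C.turn y)) ≠ some X)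
        (Sum.inr (true, X, s, false)) (Sum.inr (false, Y, s, false)) := fun s => by
      refine LinkReach.trans (y := Sum.inr (true, Y, s, false)) (LinkReach.of_half rfl)
        (LinkReach.edge (β := starTurn C.turn)
          (x := (Sum.inr (true, Y, s, false) : C.Flag ⊕ _)) ?_)
      refine ⟨fun e => ?_, fun e => hXY (Option.some.inj e)⟩
      exact Option.some_ne_none X (e.symm.trans (hbond.side_cut (Y, s)))
    exact (hedge s).trans (((C.linkReach_separator_leaf hab hv ha hb htwo Y s t).mono fun y hy => by
      rw [hy.1, hy.2]
      exact ⟨fun e => hXY (Option.some.inj e), fun e => hXY (Option.some.inj e)⟩).trans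
        (hedge t).symm)
  · exact hs.planarFlags (hbond.planarFlags hp)

end StretchPair

end TwoComplex

namespace TwoComplex

/-! ### Stretchings -/

theorem StretchStep.hasPlanarRotationSystem_iff {C D : TwoComplex.{u}} (h : C.StretchStep D) :
    C.HasPlanarRotationSystem ↔ D.HasPlanarRotationSystem := by
  cases h with
  | branch e X connected cutVertex subdivision =>
    rw [C.hasPlanarRotationSystem_preStretchBranch e X, subdivision.hasPlanarRotationSystem_iff]
  | separator a b hab hv ha hb twoConnected separates iso =>
    obtain ⟨i⟩ := iso
    rw [C.hasPlanarRotationSystem_stretchPair hab hv ha hb twoConnected separates,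
      i.hasPlanarRotationSystem_iff]
  | edge h f₁ f₂ h₁ h₂ ne adjacent subdivision =>
    rw [C.hasPlanarRotationSystem_preStretchEdge h f₁ f₂ h₁ h₂ ne adjacent,
      subdivision.hasPlanarRotationSystem_iff]
  | contraction h hh reversible iso =>
    obtain ⟨i⟩ := iso
    exact Iff.trans reversible i.hasPlanarRotationSystem_iff
  | split v iso =>
    obtain ⟨i⟩ := iso
    rw [C.hasPlanarRotationSystem_splitVertex v, i.hasPlanarRotationSystem_iff]

end TwoComplex

theorem mainTheorem7 (C C' : TwoComplex.{u}) (h : TwoComplex.IsStretching C C') :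
    C.HasPlanarRotationSystem ↔ C'.HasPlanarRotationSystem := by
  induction h with
  | refl => rfl
  | tail _ h ih => exact ih.trans h.hasPlanarRotationSystem_iff
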